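/- \textbf{Setting.} Let $n\ge 0$, $m\ge 1$, $T>0$, $M>0$. Let $|\cdot|$ be the norm $|x|=\sum_i|x_i|$, and let $\mathcal P_1$ be the set of Borel probability measures on $\mathbb R^n$ with finite first moment, with the metric $W_1(\mu,\nu)=\sup\{\int\varphi\,d(\mu-\nu):\varphi\colon\mathbb R^n\to\mathbb R\text{ is 1-Lipschitz}\}$. Let $\vartheta\in\mathcal P_1$ and let $f_0,f_1,\dots,f_m,g\colon\mathbb R^n\to\mathbb R^n$ satisfy $(\mathbf A_1)$ there are $C,L>0$ such that, for all $x,y\in\mathbb R^n$, $\sum_{i=0}^m|f_i(x)|+|g(x)|\le C$ and $\sum_{i=0}^m|f_i(x)-f_i(y)|+|g(x)-g(y)|\le L|x-y|$. Put $(g*\mu)(x)=\int g(x-y)\,d\mu(y)$. For a time-dependent vector field $v$ on $[0,R]$, a weak solution of $\partial_t\mu_t+\nabla\cdot(v_t\mu_t)=0$, $\mu_0=\vartheta$, on $[0,R]$ is an absolutely continuous curve $\mu\colon[0,R]\to\mathcal P_1$ with $\mu_0=\vartheta$ and $\int_0^R\int(\partial_t\varphi+\langle v_t,\nabla_x\varphi\rangle)\,d\mu_t\,dt=0$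 for all $\varphi\in C_c^\infty((0,R)\times\mathbb R^n)$. \emph{Original system.} $\mathcal M$ is the set of weak solutions $\mu$ on $[0,T]$ for the field $v_t=f_0+\sum_{i=1}^m u_i(t)f_i+g*\mu_t$, where $u\colon[0,T]\to\mathbb R^m$ is any Borel measurable essentially bounded function with $\int_0^T\sum_{i=1}^m|u_i(t)|\,dt=M$. \emph{Generalized solutions.} $\overline{\mathcal M}$ is the set of curves $\mu\colon[0,T]\to\mathcal P_1$ of bounded variation, right continuous on $[0,T)$, for which there are $\mu^k\in\mathcal M$ such that $\mu^k_t\to\mu_t$ in $\mathcal P_1$ for $t=T$ and for every continuity point $t\in(0,T)$ of $\mu$. (The common initial value $\vartheta$ of the curves $\mu^k$ is regarded as $\mu_{0^-}$; a jump of $\mu$ at $t=0$ is allowed.) \emph{Reduced system.} Let $S=T+M$. $\hat{\mathcal M}$ is the set of weak solutions $\nu$ on $[0,S]$ for the field $w_s=\alpha(s)(f_0+g*\nu_s)+\sum_{i=1}^m\beta_i(s)f_i$, where $(\alpha,\beta)\colon[0,S]\to\mathbb R^{1+m}$ is any measurable function with $\alpha\ge0$ and $\alpha+\sum_j|\beta_j|\le1$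 a.e. and $\int_0^S\alpha(s)\,ds=T$. \textbf{Theorem.} Assume $(\mathbf A_1)$, and let $\ell\colon\mathbb R^n\to\mathbb R$ be continuous and sublinear, i.e. $|\ell(x)|\le C'(1+|x|)$ for some $C'>0$ and all $x$. Then the problems $$(\bar P)\quad \min\Big\{\int\ell\,d\mu_T:\mu\in\overline{\mathcal M}\Big\},\qquad (\hat P)\quad\min\Big\{\int\ell\,d\nu_S:\nu\in\hat{\mathcal M}\Big\}$$ both have solutions, and, with $(P)$ denoting the problem $\inf\{\int\ell\,d\mu_T:\mu\in\mathcal M\}$, $$\min(\bar P)=\min(\hat P)=\inf(P)$$ (in particular, $\mathcal M$ is nonempty and the infimum is finite). -/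

import Mathlib

open MeasureTheory Set Filter Topology
open scoped ContDiff NNReal

noncomputable section

namespace ImpulsiveTransport

/-- The space `ℝⁿ` with the Manhattan norm `|x| = ∑ i, |x i|` and its Borel σ-algebra. -/
abbrev Rn (n : ℕ) : Type := PiLp 1 (fun _ : Fin n => ℝ)

/-- Borel probability measures on `ℝⁿ` with finite first moment. -/
structure P1 (n : ℕ) where
  /-- The underlying Borel measure. -/
  toMeasure : Measure (Rn n)
  isProb : IsProbabilityMeasure toMeasure
  integrable_norm : Integrable (fun x : Rn n => ‖x‖) toMeasure

attribute [instance] P1.isProb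

/-- The Kantorovich–Wasserstein distance
`W₁(μ,ν) = sup {∫ φ d(μ - ν) : φ : ℝⁿ → ℝ is 1-Lipschitz}`. -/
def W1 {n : ℕ} (μ ν : P1 n) : ℝ :=
  ⨆ φ : {φ : Rn n → ℝ // LipschitzWith 1 φ},
    ((∫ x, φ.1 x ∂μ.toMeasure) - ∫ x, φ.1 x ∂ν.toMeasure)

section Metric

variable {n : ℕ}

theorem abs_sub_zero_le_norm {φ : Rn n → ℝ} (hφ : LipschitzWith 1 φ) (x : Rn n) :
    |φ x - φ 0| ≤ ‖x‖ := by
  have h := hφ.dist_le_mul x 0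
  simpa [Real.dist_eq] using h

theorem integrable_of_lipschitz {φ : Rn n → ℝ} (hφ : LipschitzWith 1 φ) (μ : P1 n) :
    Integrable φ μ.toMeasure := by
  refine Integrable.mono' (μ.integrable_norm.add (integrable_const |φ 0|))
    hφ.continuous.aestronglyMeasurable (ae_of_all _ fun x => ?_)
  have h1 := abs_sub_zero_le_norm hφ x
  have h2 : |φ x| ≤ |φ x - φ 0| + |φ 0| := by simpa using abs_add_le (φ x - φ 0) (φ 0)
  simpa using h2.trans (by linarith)

theorem bddAbove_W1 (μ ν : P1 n) :
    BddAbove (range fun φ : {φ : Rn n → ℝ // LipschitzWith 1 φ} =>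
      (∫ x, φ.1 x ∂μ.toMeasure) - ∫ x, φ.1 x ∂ν.toMeasure) := by
  refine ⟨(∫ x, ‖x‖ ∂μ.toMeasure) + ∫ x, ‖x‖ ∂ν.toMeasure, ?_⟩
  rintro _ ⟨⟨φ, hφ⟩, rfl⟩
  have h1 : (∫ x, φ x ∂μ.toMeasure) ≤ ∫ x, (‖x‖ + φ 0) ∂μ.toMeasure :=
    integral_mono (integrable_of_lipschitz hφ μ)
      (μ.integrable_norm.add (integrable_const _))
      fun x => by have := (abs_le.1 (abs_sub_zero_le_norm hφ x)).2; linarith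
  have h2 : (∫ x, (φ 0 - ‖x‖) ∂ν.toMeasure) ≤ ∫ x, φ x ∂ν.toMeasure :=
    integral_mono ((integrable_const _).sub ν.integrable_norm)
      (integrable_of_lipschitz hφ ν)
      fun x => by have := (abs_le.1 (abs_sub_zero_le_norm hφ x)).1; linarith
  rw [integral_add μ.integrable_norm (integrable_const _)] at h1
  rw [integral_sub (integrable_const _) ν.integrable_norm] at h2
  simp only [integral_const, probReal_univ, one_smul] at h1 h2
  show (∫ x, φ x ∂μ.toMeasure) - ∫ x, φ x ∂ν.toMeasure ≤ _
  linarith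

theorem le_W1 {φ : Rn n → ℝ} (hφ : LipschitzWith 1 φ) (μ ν : P1 n) :
    (∫ x, φ x ∂μ.toMeasure) - ∫ x, φ x ∂ν.toMeasure ≤ W1 μ ν :=
  le_ciSup (bddAbove_W1 μ ν) ⟨φ, hφ⟩

instance instNonemptyLip : Nonempty {φ : Rn n → ℝ // LipschitzWith 1 φ} :=
  ⟨⟨fun _ => 0, LipschitzWith.const' 0⟩⟩

theorem W1_self (μ : P1 n) : W1 μ μ = 0 := by simp [W1]

theorem W1_comm_le (μ ν : P1 n) : W1 μ ν ≤ W1 ν μ := by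
  refine ciSup_le fun φ => ?_
  have h := le_W1 (φ := fun x => -φ.1 x) φ.2.neg ν μ
  rw [integral_neg, integral_neg] at h
  linarith

theorem W1_comm (μ ν : P1 n) : W1 μ ν = W1 ν μ :=
  le_antisymm (W1_comm_le μ ν) (W1_comm_le ν μ)

theorem W1_triangle (μ ν ρ : P1 n) : W1 μ ρ ≤ W1 μ ν + W1 ν ρ := by
  refine ciSup_le fun φ => ?_
  have h1 := le_W1 φ.2 μ ν
  have h2 := le_W1 φ.2 ν ρ
  linarith

theorem integral_eq_of_W1_eq_zero {μ ν : P1 n} (h : W1 μ ν = 0) {K : ℝ≥0} {φ : Rn n → ℝ}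
    (hφ : LipschitzWith K φ) : ∫ x, φ x ∂μ.toMeasure = ∫ x, φ x ∂ν.toMeasure := by
  have hK : (0 : ℝ) < (K : ℝ) + 1 := by positivity
  have hψ : LipschitzWith 1 fun x => ((K : ℝ) + 1)⁻¹ * φ x := by
    refine LipschitzWith.of_dist_le_mul fun x y => ?_
    have h1 := hφ.dist_le_mul x y
    rw [Real.dist_eq] at h1 ⊢
    rw [← mul_sub, abs_mul, abs_of_pos (inv_pos.2 hK), inv_mul_le_iff₀ hK]
    have := dist_nonneg (x := x) (y := y)
    push_cast
    nlinarith
  have h1 := le_W1 hψ μ ν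
  have h2 := le_W1 hψ ν μ
  rw [W1_comm ν μ] at h2
  rw [h] at h1 h2
  rw [integral_const_mul, integral_const_mul] at h1 h2
  have h3 := le_antisymm (sub_nonpos.1 h1) (sub_nonpos.1 h2)
  exact mul_left_cancel₀ (inv_ne_zero hK.ne') h3

theorem eq_of_W1_eq_zero {μ ν : P1 n} (h : W1 μ ν = 0) : μ = ν := by
  have hm : μ.toMeasure = ν.toMeasure := by
    refine ext_of_generate_finite _ (BorelSpace.measurable_eq.trans borel_eq_generateFrom_isClosed)
      isPiSystem_isClosed (fun F hF => ?_) (by simp)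
    have hδ : ∀ k : ℕ, (0 : ℝ) < 1 / ((k : ℝ) + 1) := fun k => Nat.one_div_pos_of_nat
    have hlim := tendsto_one_div_add_atTop_nhds_zero_nat (𝕜 := ℝ)
    have t1 := tendsto_lintegral_thickenedIndicator_of_isClosed μ.toMeasure hF hδ hlim
    have t2 := tendsto_lintegral_thickenedIndicator_of_isClosed ν.toMeasure hF hδ hlim
    refine tendsto_nhds_unique t1 (t2.congr fun k => ?_)
    have hL := lipschitzWith_thickenedIndicator (hδ k) F
    have hL' : LipschitzWith (1 / ((k : ℝ) + 1)).toNNReal⁻¹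
        fun x => ((thickenedIndicator (hδ k) F x : ℝ≥0) : ℝ) := fun x y => hL x y
    have e := integral_eq_of_W1_eq_zero h hL'
    have i : ∀ ρ : P1 n, (∫⁻ x, (thickenedIndicator (hδ k) F x : ENNReal) ∂ρ.toMeasure) =
        ENNReal.ofReal (∫ x, ((thickenedIndicator (hδ k) F x : ℝ≥0) : ℝ) ∂ρ.toMeasure) := by
      intro ρ
      have hi : Integrable (fun x => ((thickenedIndicator (hδ k) F x : ℝ≥0) : ℝ))
          ρ.toMeasure := by
        refine Integrable.mono' (integrable_const (1 : ℝ))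
          hL'.continuous.aestronglyMeasurable (ae_of_all _ fun x => ?_)
        have := thickenedIndicator_le_one (hδ k) F x
        simpa using this
      rw [ofReal_integral_eq_lintegral_ofReal hi (ae_of_all _ fun x => NNReal.coe_nonneg _)]
      simp
    rw [i μ, i ν, e]
  cases μ
  cases ν
  simp only at hm
  subst hm
  rfl

end Metric

/-- `𝒫₁(ℝⁿ)` is always equipped with the metric `W₁`. -/
instance instMetricSpaceP1 (n : ℕ) : MetricSpace (P1 n) where
  dist := W1
  dist_self := W1_self
  dist_comm := W1_comm
  dist_triangle := W1_triangle
  eq_of_dist_eq_zero := eq_of_W1_eq_zero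

/-- The convolution `(g * μ)(x) = ∫ g (x - y) dμ(y)`. -/
def conv {n : ℕ} (g : Rn n → Rn n) (μ : P1 n) (x : Rn n) : Rn n :=
  ∫ y, g (x - y) ∂μ.toMeasure

/-- Hypothesis `(A₁)`: the fields `f₀, f₁, …, fₘ, g` are bounded and Lipschitz. -/
def HypA1 {n m : ℕ} (f₀ : Rn n → Rn n) (f : Fin m → Rn n → Rn n) (g : Rn n → Rn n) : Prop :=
  ∃ C L : ℝ, 0 < C ∧ 0 < L ∧
    (∀ x, (‖f₀ x‖ + ∑ i, ‖f i x‖) + ‖g x‖ ≤ C) ∧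
    ∀ x y, (‖f₀ x - f₀ y‖ + ∑ i, ‖f i x - f i y‖) + ‖g x - g y‖ ≤ L * ‖x - y‖

/-- `μ` is a weak solution on `[0, T]` of `∂ₜ μₜ + ∇ · (vₜ μₜ) = 0`, `μ₀ = ϑ`:
an absolutely continuous curve in `𝒫₁(ℝⁿ)` starting from `ϑ` and satisfying the equation in the
sense of distributions on `(0, T) × ℝⁿ`.  (Only the values `μ t` and `v t` with `0 ≤ t ≤ T`
matter.) -/
def IsWeakSolution {n : ℕ} (T : ℝ) (ϑ : P1 n) (v : ℝ → Rn n → Rn n) (μ : ℝ → P1 n) : Prop :=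
  AbsolutelyContinuousOnInterval μ 0 T ∧ μ 0 = ϑ ∧
    ∀ φ : ℝ → Rn n → ℝ,
      ContDiff ℝ ∞ (fun p : ℝ × Rn n => φ p.1 p.2) →
      HasCompactSupport (fun p : ℝ × Rn n => φ p.1 p.2) →
      tsupport (fun p : ℝ × Rn n => φ p.1 p.2) ⊆ Ioo 0 T ×ˢ univ →
      ∫ t in (0 : ℝ)..T, ∫ x, (deriv (fun s => φ s x) t + fderiv ℝ (φ t) x (v t x))
        ∂(μ t).toMeasure = 0

/-- Admissible controls of the original system: Borel measurable, essentially bounded functions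
`u : [0, T] → ℝᵐ` with `∫₀ᵀ ∑ᵢ |uᵢ(t)| dt = M`. -/
def IsControl {m : ℕ} (T M : ℝ) (u : ℝ → Fin m → ℝ) : Prop :=
  Measurable u ∧
    (∃ K : ℝ, ∀ᵐ t ∂volume.restrict (Icc 0 T), ∀ i, |u t i| ≤ K) ∧
    ∫ t in (0 : ℝ)..T, ∑ i, |u t i| = M

/-- The set of trajectories of the original system, that is, of the nonlocal transport
equation with the field `vₜ = f₀ + ∑ᵢ uᵢ(t) fᵢ + g * μₜ`, over all admissible controls `u`. -/
def trajectories {n m : ℕ} (T M : ℝ) (f₀ : Rn n → Rn n) (f : Fin m → Rn n → Rn n)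
    (g : Rn n → Rn n) (ϑ : P1 n) : Set (ℝ → P1 n) :=
  {μ | ∃ u : ℝ → Fin m → ℝ, IsControl T M u ∧
    IsWeakSolution T ϑ (fun t x => f₀ x + ∑ i, u t i • f i x + conv g (μ t) x) μ}

/-- Functions `[0, T] → X` of bounded variation that are right continuous on `[0, T)`. -/
def IsBVPlus {X : Type*} [PseudoMetricSpace X] (T : ℝ) (F : ℝ → X) : Prop :=
  BoundedVariationOn F (Icc 0 T) ∧ ∀ t ∈ Ico 0 T, ContinuousWithinAt F (Ici t) t

/-- The convergence of the curves `F k` to `G`: pointwise at every continuity point of `G`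
in `(0, T)`, and at `T`.  Nothing is required at the point `0`: the common initial value of the
curves `F k` plays the role of the left limit `G(0⁻)`, and `G` may jump at `0`. -/
def ConvBV {X : Type*} [PseudoMetricSpace X] (T : ℝ) (F : ℕ → ℝ → X) (G : ℝ → X) : Prop :=
  (∀ t ∈ Ioo 0 T, ContinuousAt G t → Tendsto (fun k => F k t) atTop (𝓝 (G t))) ∧
    Tendsto (fun k => F k T) atTop (𝓝 (G T))

/-- The set of generalized solutions: the limits of sequences of trajectories of the original
system. -/
def generalizedSolutions {n m : ℕ} (T M : ℝ) (f₀ : Rn n → Rn n) (f : Fin m → Rn n → Rn n)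
    (g : Rn n → Rn n) (ϑ : P1 n) : Set (ℝ → P1 n) :=
  {μ | IsBVPlus T μ ∧ ∃ μk : ℕ → ℝ → P1 n,
    (∀ k, μk k ∈ trajectories T M f₀ f g ϑ) ∧ ConvBV T μk μ}

/-- Admissible controls `(α, β)` of the reduced system on `[0, S]`, `S = T + M`: measurable
functions with `α ≥ 0`, `α + ∑ⱼ |βⱼ| ≤ 1` a.e. on `[0, S]` and `∫₀ˢ α(s) ds = T`. -/
def IsReducedControl {m : ℕ} (T M : ℝ) (α : ℝ → ℝ) (β : ℝ → Fin m → ℝ) : Prop :=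
  Measurable α ∧ Measurable β ∧
    (∀ᵐ s ∂volume.restrict (Icc 0 (T + M)), 0 ≤ α s ∧ α s + ∑ j, |β s j| ≤ 1) ∧
    ∫ s in (0 : ℝ)..(T + M), α s = T

/-- The set of trajectories of the reduced system on `[0, T + M]`, whose field is
`w_s = α(s) (f₀ + g * ν_s) + ∑ᵢ βᵢ(s) fᵢ`. -/
def reducedTrajectories {n m : ℕ} (T M : ℝ) (f₀ : Rn n → Rn n) (f : Fin m → Rn n → Rn n)
    (g : Rn n → Rn n) (ϑ : P1 n) : Set (ℝ → P1 n) :=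
  {ν | ∃ (α : ℝ → ℝ) (β : ℝ → Fin m → ℝ), IsReducedControl T M α β ∧
    IsWeakSolution (T + M) ϑ
      (fun s x => α s • (f₀ x + conv g (ν s) x) + ∑ i, β s i • f i x) ν}

/-- The terminal cost `μ ↦ ∫ ℓ dμ_T`. -/
def cost {n : ℕ} (ℓ : Rn n → ℝ) (T : ℝ) (μ : ℝ → P1 n) : ℝ :=
  ∫ x, ℓ x ∂(μ T).toMeasure

end ImpulsiveTransport

end

open ImpulsiveTransport

open MeasureTheory Set Filter Topology
open scoped ContDiff NNReal

noncomputable section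

/-! The nonlocal transport equation is rewritten as an ordinary differential equation in a Banach
space. A solution is the push-forward of `ϑ` under `x ↦ x + ξ t x`, where `ξ t` is a bounded
continuous displacement, and `ξ` solves `ξ' = ∑ j, c j • G j ξ` with autonomous, bounded, Lipschitz
fields `G j = nonlocal ϑ j`: the measure enters only through `push ϑ ξ`, which is 1-Lipschitz in
`ξ`. That every weak solution has this form (`FieldData.exists_isFlow_of_isWeakSolution`) rests on
uniqueness for the linear continuity equation with a Lipschitz field
(`IsIntegratedSolution.unique`), applied after freezing the measure in the velocity.

For such an equation only the primitive `P` of the control matters. The relation `Driven` expresses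
`dξ = ∑ j, G j ξ dP j` without derivatives. It is stable under Lipschitz time changes, determines
`ξ` from its initial value, and makes the endpoint of `ξ` continuous in `P` for mere pointwise
convergence (`Driven.tendsto`).

The primitives of reduced controls form a compact set (`isCompact_reducedPaths`), so the endpoints
of reduced trajectories form a compact set `𝓔` of measures. The time change `s = t + ∫ |u|` shows
that endpoints of original trajectories lie in `𝓔`. Conversely, every point of `𝓔` is the endpoint
of a generalized solution: a reduced control is first extended by a loop, back and forth along one
controlled field, so that its variation is exactly `M` (`exists_extension`); then its drift
coefficient is perturbed to a positive one (`exists_regularization`), which allows the time change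
to be undone and gives original trajectories; these converge to the reduced flow read along the
right-continuous inverse of physical time (`exists_mem_generalizedSolutions`).

The cost is `W₁`-continuous (`continuous_integral_of_sublinear`), so it has a minimum over `𝓔`. This
is the minimum of the reduced problem; it bounds the cost of original trajectories from below, hence
also that of their limits; and it is attained by a generalized solution, itself a limit of original
trajectories, so it is the infimum of the original problem. -/

namespace ImpulsiveTransport

/-! ### Curves driven by Lipschitz paths: stability, uniqueness, reparametrization. -/

section Driven

variable {E ι : Type*} [NormedAddCommGroup E] [NormedSpace ℝ E] [Fintype ι]

/-- The curve `ξ` is driven on `[a, b]` by the path `P` along the vector fields `G j`: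
`dξ = ∑ j, G j (ξ) dP j`, with a quadratic local error. -/
def Driven (G : ι → E → E) (P : ℝ → ι → ℝ) (ξ : ℝ → E) (a b C : ℝ) : Prop :=
  ∀ s ∈ Icc a b, ∀ t ∈ Icc a b,
    ‖ξ t - ξ s - ∑ j, (P t j - P s j) • G j (ξ s)‖ ≤ C * (t - s) ^ 2

theorem Driven.mono {G : ι → E → E} {P : ℝ → ι → ℝ} {ξ : ℝ → E} {a b C a' b' : ℝ}
    (h : Driven G P ξ a b C) (ha : a ≤ a') (hb : b' ≤ b) : Driven G P ξ a' b' C :=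
  fun s hs t ht => h s ⟨ha.trans hs.1, hs.2.trans hb⟩ t ⟨ha.trans ht.1, ht.2.trans hb⟩

/-- The local error is quadratic, so a Lipschitz change of time only multiplies it by `Λ ^ 2`.
Monotonicity of `θ` plays no role, and the reflection of time used for the loop below relies on
this. -/
theorem Driven.comp {G : ι → E → E} {P : ℝ → ι → ℝ} {ξ : ℝ → E} {a b C : ℝ} (hC : 0 ≤ C)
    (h : Driven G P ξ a b C) {θ : ℝ → ℝ} {a' b' Λ : ℝ} (hmaps : MapsTo θ (Icc a' b') (Icc a b))
    (hθ : ∀ s ∈ Icc a' b', ∀ t ∈ Icc a' b', |θ t - θ s| ≤ Λ * |t - s|) :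
    Driven G (P ∘ θ) (ξ ∘ θ) a' b' (C * Λ ^ 2) := by
  intro s hs t ht
  refine (h _ (hmaps hs) _ (hmaps ht)).trans ?_
  rw [mul_assoc, ← mul_pow]
  refine mul_le_mul_of_nonneg_left ?_ hC
  rw [sq_le_sq]
  refine (hθ s hs t ht).trans ?_
  rw [abs_mul]
  exact mul_le_mul_of_nonneg_right (le_abs_self _) (abs_nonneg _)

theorem Driven.congr {G : ι → E → E} {P P' : ℝ → ι → ℝ} {ξ : ℝ → E} {a b C : ℝ}
    (h : Driven G P ξ a b C) (hP : ∀ t ∈ Icc a b, P' t = P t) : Driven G P' ξ a b C := by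
  intro s hs t ht
  rw [hP s hs, hP t ht]
  exact h s hs t ht

/-- One step of a discrete Gronwall argument. The two paths are compared only at the endpoints `s`
and `t`, which is why pointwise convergence of paths will suffice. -/
theorem Driven.norm_sub_step {G : ι → E → E} {P P' : ℝ → ι → ℝ} {ξ ξ' : ℝ → E}
    {a b C C' K κ : ℝ} (h : Driven G P ξ a b C) (h' : Driven G P' ξ' a b C')
    (hGK : ∀ j x, ‖G j x‖ ≤ K) (hGL : ∀ j x y, ‖G j x - G j y‖ ≤ K * ‖x - y‖) (hK : 0 ≤ K)
    (hP : ∀ s t, ∑ j, |P t j - P s j| ≤ κ * |t - s|)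
    {s t : ℝ} (hs : s ∈ Icc a b) (ht : t ∈ Icc a b) (hst : s ≤ t) {δ : ℝ}
    (hδs : ∑ j, |P s j - P' s j| ≤ δ) (hδt : ∑ j, |P t j - P' t j| ≤ δ) :
    ‖ξ t - ξ' t‖ ≤ (1 + K * κ * (t - s)) * ‖ξ s - ξ' s‖ +
      (2 * K * δ + (C + C') * (t - s) ^ 2) := by
  -- Two local errors, the change of the fields between the two curves, and the discrepancy of the
  -- path increments. The latter involves both endpoints, hence the term `2 * K * δ`.
  have e : ξ t - ξ' t = (ξ s - ξ' s) + (ξ t - ξ s - ∑ j, (P t j - P s j) • G j (ξ s))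
      - (ξ' t - ξ' s - ∑ j, (P' t j - P' s j) • G j (ξ' s))
      + ∑ j, (P t j - P s j) • (G j (ξ s) - G j (ξ' s))
      + ∑ j, ((P t j - P' t j) - (P s j - P' s j)) • G j (ξ' s) := by
    simp only [smul_sub, sub_smul, Finset.sum_sub_distrib]
    abel
  have h1 := h s hs t ht
  have h2 := h' s hs t ht
  have h3 : ‖∑ j, (P t j - P s j) • (G j (ξ s) - G j (ξ' s))‖
      ≤ κ * (t - s) * (K * ‖ξ s - ξ' s‖) := by
    refine (norm_sum_le _ _).trans ?_
    have := hP s t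
    rw [abs_of_nonneg (sub_nonneg.2 hst)] at this
    refine le_trans ?_ (mul_le_mul_of_nonneg_right this (by positivity))
    rw [Finset.sum_mul]
    refine Finset.sum_le_sum fun j _ => ?_
    rw [norm_smul, Real.norm_eq_abs]
    exact mul_le_mul_of_nonneg_left (hGL j _ _) (abs_nonneg _)
  have h4 : ‖∑ j, ((P t j - P' t j) - (P s j - P' s j)) • G j (ξ' s)‖ ≤ (δ + δ) * K := by
    refine (norm_sum_le _ _).trans ?_
    refine le_trans ?_ (mul_le_mul_of_nonneg_right (add_le_add hδt hδs) hK)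
    rw [← Finset.sum_add_distrib, Finset.sum_mul]
    refine Finset.sum_le_sum fun j _ => ?_
    rw [norm_smul, Real.norm_eq_abs]
    exact mul_le_mul (abs_sub _ _) (hGK j _) (norm_nonneg _) (by positivity)
  rw [e]
  refine (norm_add_le _ _).trans ?_
  refine (add_le_add_left (norm_add_le _ _) _).trans ?_
  refine (add_le_add_left (add_le_add_left (norm_sub_le _ _) _) _).trans ?_
  refine (add_le_add_left (add_le_add_left (add_le_add_left (norm_add_le _ _) _) _) _).trans ?_
  linarith

/-- Two driven curves stay close if the driving paths are close on a uniform grid. -/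
theorem Driven.norm_sub_le {G : ι → E → E} {P P' : ℝ → ι → ℝ} {ξ ξ' : ℝ → E}
    {a b C C' K κ : ℝ} (hab : a ≤ b) (h : Driven G P ξ a b C) (h' : Driven G P' ξ' a b C')
    (hGK : ∀ j x, ‖G j x‖ ≤ K) (hGL : ∀ j x y, ‖G j x - G j y‖ ≤ K * ‖x - y‖) (hK : 0 ≤ K)
    (hκ : 0 ≤ κ) (hC : 0 ≤ C) (hC' : 0 ≤ C')
    (hP : ∀ s t, ∑ j, |P t j - P s j| ≤ κ * |t - s|) {N : ℕ} (hN : 0 < N) {δ : ℝ} (hδ0 : 0 ≤ δ)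
    (hδ : ∀ k ≤ N, ∑ j, |P (a + k * ((b - a) / N)) j - P' (a + k * ((b - a) / N)) j| ≤ δ) :
    ‖ξ b - ξ' b‖ ≤ Real.exp (K * κ * (b - a)) *
      (‖ξ a - ξ' a‖ + 2 * K * (N * δ) + (C + C') * (b - a) ^ 2 / N) := by
  have hN' : (0 : ℝ) < N := Nat.cast_pos.2 hN
  set τ : ℝ := (b - a) / N with hτ
  have hτ0 : 0 ≤ τ := div_nonneg (sub_nonneg.2 hab) hN'.le
  set q : ℝ := K * κ * τ with hq
  have hq0 : 0 ≤ q := by positivity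
  set r : ℝ := 2 * K * δ + (C + C') * τ ^ 2 with hr
  have hr0 : 0 ≤ r := by positivity
  have hmem : ∀ k ≤ N, a + k * τ ∈ Icc a b := fun k hk => by
    have : (k : ℝ) * τ ≤ N * τ := mul_le_mul_of_nonneg_right (Nat.cast_le.2 hk) hτ0
    have e : (N : ℝ) * τ = b - a := by rw [hτ]; field_simp
    exact ⟨by nlinarith [Nat.cast_nonneg (α := ℝ) k], by linarith⟩
  have key : ∀ k ≤ N, ‖ξ (a + k * τ) - ξ' (a + k * τ)‖ ≤
      (1 + q) ^ k * (‖ξ a - ξ' a‖ + k * r) := by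
    intro k
    induction k with
    | zero => intro _; simp
    | succ k ih =>
      intro hk
      have hk' : k ≤ N := by omega
      have hs := h.norm_sub_step h' hGK hGL hK hP (hmem k hk') (hmem (k + 1) hk)
        (by push_cast; nlinarith) (hδ k hk') (hδ (k + 1) hk)
      have e1 : a + ((k + 1 : ℕ) : ℝ) * τ - (a + k * τ) = τ := by push_cast; ring
      rw [e1] at hs
      refine hs.trans ?_
      have h1 := mul_le_mul_of_nonneg_left (ih hk') (by positivity : 0 ≤ 1 + q)
      have h2 : r ≤ (1 + q) ^ (k + 1) * r :=
        le_mul_of_one_le_left hr0 (one_le_pow₀ (by linarith))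
      have h3 : (1 + q) ^ (k + 1) * (‖ξ a - ξ' a‖ + ((k + 1 : ℕ) : ℝ) * r) =
          (1 + q) * ((1 + q) ^ k * (‖ξ a - ξ' a‖ + k * r)) + (1 + q) ^ (k + 1) * r := by
        push_cast; ring
      rw [h3]
      linarith
  have hf := key N le_rfl
  have e1 : a + (N : ℝ) * τ = b := by rw [hτ]; field_simp; ring
  rw [e1] at hf
  refine hf.trans ?_
  have h1 : (1 + q) ^ N ≤ Real.exp (K * κ * (b - a)) := by
    have : K * κ * (b - a) = N * q := by rw [hq, hτ]; field_simp
    rw [this, Real.exp_nat_mul]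
    exact pow_le_pow_left₀ (by positivity) (by linarith [Real.add_one_le_exp q]) _
  have h2 : (N : ℝ) * r = 2 * K * (N * δ) + (C + C') * (b - a) ^ 2 / N := by
    rw [hr, hτ]; field_simp
  rw [add_assoc, ← h2]
  exact mul_le_mul_of_nonneg_right h1 (by positivity)

/-- Driven curves depend continuously on the driving path, for pointwise convergence. -/
theorem Driven.tendsto {G : ι → E → E} {α : Type*} {l : Filter α} {P : ℝ → ι → ℝ}
    {Q : α → ℝ → ι → ℝ} {ξ : ℝ → E} {η : α → ℝ → E}
    {a b C C' K κ : ℝ} (hab : a ≤ b) (h : Driven G P ξ a b C)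
    (h' : ∀ i, Driven G (Q i) (η i) a b C')
    (hGK : ∀ j x, ‖G j x‖ ≤ K) (hGL : ∀ j x y, ‖G j x - G j y‖ ≤ K * ‖x - y‖) (hK : 0 ≤ K)
    (hκ : 0 ≤ κ) (hC : 0 ≤ C) (hC' : 0 ≤ C')
    (hP : ∀ s t, ∑ j, |P t j - P s j| ≤ κ * |t - s|)
    (hinit : ∀ i, η i a = ξ a)
    (hlim : ∀ t ∈ Icc a b, ∀ j, Tendsto (fun i => Q i t j) l (𝓝 (P t j))) :
    Tendsto (fun i => η i b) l (𝓝 (ξ b)) := by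
  rw [Metric.tendsto_nhds]
  intro ε hε
  set X := Real.exp (K * κ * (b - a)) with hX
  have hXpos : 0 < X := Real.exp_pos _
  -- The grid is fixed first, to make the accumulated quadratic errors small; the tolerance `δ` on
  -- the paths may then depend on `N`, and only finitely many times have to be controlled.
  obtain ⟨N, hN⟩ := exists_nat_gt (max 0 (X * ((C + C') * (b - a) ^ 2) / (ε / 2)))
  have hN0 : (0 : ℝ) < N := (le_max_left _ _).trans_lt hN
  have hN1 : X * ((C + C') * (b - a) ^ 2 / N) < ε / 2 := by
    have := (le_max_right _ _).trans_lt hN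
    rw [div_lt_iff₀ (by positivity)] at this
    rw [← mul_div_assoc, div_lt_iff₀ hN0]
    linarith
  have hNn : 0 < N := Nat.cast_pos.1 hN0
  set δ : ℝ := (ε / 2) / (X * (2 * K * N + 1)) with hδ
  have hδ0 : 0 < δ := by positivity
  have hδ1 : X * (2 * K * (N * δ)) < ε / 2 := by
    rw [hδ, ← sub_pos]
    have : ε / 2 - X * (2 * K * (N * (ε / 2 / (X * (2 * K * N + 1))))) =
      (ε / 2) / (2 * K * N + 1) := by field_simp; ring
    rw [this]; positivity
  have hmem : ∀ k ≤ N, a + k * ((b - a) / N) ∈ Icc a b := fun k hk => by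
    have h1 : (0 : ℝ) ≤ k * ((b - a) / N) :=
      mul_nonneg (Nat.cast_nonneg _) (div_nonneg (sub_nonneg.2 hab) hN0.le)
    have h2 : (k : ℝ) * ((b - a) / N) ≤ N * ((b - a) / N) :=
      mul_le_mul_of_nonneg_right (Nat.cast_le.2 hk) (div_nonneg (sub_nonneg.2 hab) hN0.le)
    have e : (N : ℝ) * ((b - a) / N) = b - a := by field_simp
    exact ⟨by linarith, by linarith⟩
  have hev : ∀ᶠ i in l, ∀ k ∈ Finset.range (N + 1),
      ∑ j, |P (a + k * ((b - a) / N)) j - Q i (a + k * ((b - a) / N)) j| < δ := by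
    rw [Filter.eventually_all_finset]
    intro k hk
    have hk' := hmem k (by simpa [Nat.lt_succ_iff] using hk)
    have : Tendsto (fun i => ∑ j, |P (a + k * ((b - a) / N)) j - Q i (a + k * ((b - a) / N)) j|)
        l (𝓝 (∑ j : ι, |P (a + k * ((b - a) / N)) j - P (a + k * ((b - a) / N)) j|)) :=
      tendsto_finsetSum _ fun j _ => (tendsto_const_nhds.sub (hlim _ hk' j)).abs
    simp only [sub_self, abs_zero, Finset.sum_const_zero] at this
    exact this.eventually_lt_const hδ0
  filter_upwards [hev] with i hi
  have := h.norm_sub_le hab (h' i) hGK hGL hK hκ hC hC' hP hNn hδ0.le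
    (fun k hk => (hi k (by simpa [Nat.lt_succ_iff] using hk)).le)
  rw [hinit i, sub_self, norm_zero] at this
  rw [dist_comm, dist_eq_norm]
  refine this.trans_lt ?_
  rw [← hX]
  calc X * (0 + 2 * K * (N * δ) + (C + C') * (b - a) ^ 2 / N)
      = X * (2 * K * (N * δ)) + X * ((C + C') * (b - a) ^ 2 / N) := by ring
    _ < ε := by linarith

/-- The two curves may carry different error constants and need not come from an integral equation,
so a solution can be compared with a time-changed one by comparing driving paths alone. -/
theorem Driven.unique {G : ι → E → E} {P : ℝ → ι → ℝ} {ξ ξ' : ℝ → E}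
    {a b C C' K κ : ℝ} (h : Driven G P ξ a b C) (h' : Driven G P ξ' a b C')
    (hGK : ∀ j x, ‖G j x‖ ≤ K) (hGL : ∀ j x y, ‖G j x - G j y‖ ≤ K * ‖x - y‖) (hK : 0 ≤ K)
    (hκ : 0 ≤ κ) (hC : 0 ≤ C) (hC' : 0 ≤ C')
    (hP : ∀ s t, ∑ j, |P t j - P s j| ≤ κ * |t - s|) (hinit : ξ' a = ξ a)
    {t : ℝ} (ht : t ∈ Icc a b) : ξ' t = ξ t := by
  -- Continuous dependence applied to a constant family: the constant `ξ' t` tends to `ξ t`.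
  have := Driven.tendsto (l := (⊤ : Filter Unit)) ht.1 (h.mono le_rfl ht.2)
    (fun _ => h'.mono le_rfl ht.2) hGK hGL hK hκ hC hC' hP (fun _ => hinit)
    (fun t _ j => tendsto_const_nhds)
  exact tendsto_nhds_unique (tendsto_const_nhds (x := ξ' t) (f := (⊤ : Filter Unit))) this

end Driven

/-! ### Ordinary differential equations with measurable controls in a Banach space. -/

section Picard

theorem intervalIntegrable_of_norm_le {E : Type*} [NormedAddCommGroup E] {h : ℝ → E} {K : ℝ}
    (hm : AEStronglyMeasurable h volume) (hb : ∀ r, ‖h r‖ ≤ K) (a b : ℝ) :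
    IntervalIntegrable h volume a b :=
  (intervalIntegrable_const (c := K)).mono_fun hm.restrict
    (ae_of_all _ fun r => (hb r).trans (le_abs_self K))

variable {E : Type*} [NormedAddCommGroup E] [NormedSpace ℝ E]

/-- The Picard–Lindelöf theorem for vector fields that are merely measurable in time. -/
theorem exists_integral_solution [CompleteSpace E] {F : ℝ → E → E} {K R : ℝ} (hR : 0 ≤ R)
    (hK : 0 ≤ K) (hb : ∀ t x, ‖F t x‖ ≤ K) (hL : ∀ t x y, ‖F t x - F t y‖ ≤ K * ‖x - y‖)
    (hm : ∀ ξ : ℝ → E, Continuous ξ → AEStronglyMeasurable (fun r => F r (ξ r)) volume) :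
    ∃ ξ : ℝ → E, Continuous ξ ∧ ∀ t ∈ Icc 0 R, ξ t = ∫ r in (0 : ℝ)..t, F r (ξ r) := by
  have hint : ∀ (ξ : ℝ → E), Continuous ξ → ∀ a b,
      IntervalIntegrable (fun r => F r (ξ r)) volume a b := fun ξ hξ a b =>
    intervalIntegrable_of_norm_le (hm ξ hξ) (fun r => hb r _) a b
  let X (ξ : C(Icc 0 R, E)) : ℝ → E := IccExtend hR ξ
  have hX : ∀ ξ, Continuous (X ξ) := fun ξ => ξ.continuous.Icc_extend'
  let Γ (ξ : C(Icc 0 R, E)) : C(Icc 0 R, E) :=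
    ⟨fun t => ∫ r in (0 : ℝ)..t, F r (X ξ r),
      (intervalIntegral.continuous_primitive (hint _ (hX ξ)) 0).comp continuous_subtype_val⟩
  have hiter : ∀ (k : ℕ) (ξ η : C(Icc 0 R, E)) (t : Icc 0 R),
      ‖(Γ^[k] ξ) t - (Γ^[k] η) t‖ ≤ (K * t) ^ k / k.factorial * dist ξ η := by
    intro k ξ η
    induction k with
    | zero =>
      intro t
      simp only [Function.iterate_zero, id_eq, pow_zero, Nat.factorial_zero, Nat.cast_one, div_one,
        one_mul]
      rw [← dist_eq_norm]
      exact ContinuousMap.dist_apply_le_dist t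
    | succ k ih =>
      intro t
      rw [Function.iterate_succ_apply', Function.iterate_succ_apply']
      change ‖(∫ r in (0 : ℝ)..t, F r (X (Γ^[k] ξ) r)) - ∫ r in (0 : ℝ)..t, F r (X (Γ^[k] η) r)‖ ≤ _
      rw [← intervalIntegral.integral_sub (hint _ (hX _) _ _) (hint _ (hX _) _ _)]
      have hb1 : ∀ r ∈ Ioc (0 : ℝ) t, ‖F r (X (Γ^[k] ξ) r) - F r (X (Γ^[k] η) r)‖ ≤
          K * ((K * r) ^ k / k.factorial * dist ξ η) := by
        intro r hr
        have hr' : r ∈ Icc 0 R := ⟨hr.1.le, hr.2.trans t.2.2⟩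
        refine (hL r _ _).trans (mul_le_mul_of_nonneg_left ?_ hK)
        have := ih ⟨r, hr'⟩
        simpa [X, IccExtend_of_mem hR _ hr'] using this
      have hint2 : ∀ a b : ℝ, IntervalIntegrable
          (fun r : ℝ => K * ((K * r) ^ k / k.factorial * dist ξ η)) volume a b :=
        fun a b => Continuous.intervalIntegrable (by fun_prop) _ _
      refine (intervalIntegral.norm_integral_le_of_norm_le t.2.1
        (ae_of_all _ fun r hr => hb1 r hr) (hint2 _ _)).trans ?_
      have e : (fun r : ℝ => K * ((K * r) ^ k / k.factorial * dist ξ η)) =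
          fun r => (K ^ (k + 1) / k.factorial * dist ξ η) * r ^ k := by
        funext r; rw [mul_pow]; ring
      rw [e, intervalIntegral.integral_const_mul, integral_pow]
      apply le_of_eq
      rw [Nat.factorial_succ]
      have : ((k.factorial : ℕ) : ℝ) ≠ 0 := Nat.cast_ne_zero.2 k.factorial_ne_zero
      have h2 : ((k : ℝ) + 1) ≠ 0 := by positivity
      push_cast
      rw [zero_pow (Nat.succ_ne_zero k), mul_pow]
      field_simp
      ring
  -- The Picard map need not be a contraction on `[0, R]`, but its `k`-th iterate has Lipschitz
  -- constant at most `(K * R) ^ k / k!`. The fixed point of the iterate is then fixed by the map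
  -- itself.
  obtain ⟨k, hk⟩ := ((FloorSemiring.tendsto_pow_div_factorial_atTop (K * R)).eventually_lt_const
    (show (0 : ℝ) < 1 / 2 by norm_num)).exists
  have hcontr : ContractingWith (1 / 2 : ℝ≥0) Γ^[k] := by
    refine ⟨by simpa using NNReal.inv_lt_one_iff two_ne_zero |>.2 one_lt_two, ?_⟩
    refine LipschitzWith.of_dist_le_mul fun ξ η => ?_
    rw [ContinuousMap.dist_le (by positivity)]
    intro t
    rw [dist_eq_norm]
    refine (hiter k ξ η t).trans (mul_le_mul_of_nonneg_right ?_ dist_nonneg)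
    have : (K * t) ^ k / k.factorial ≤ (K * R) ^ k / k.factorial := by
      have h0 := t.2.1
      have h1 := t.2.2
      gcongr
    refine this.trans (hk.le.trans ?_)
    norm_num
  have : Nonempty C(Icc 0 R, E) := ⟨0⟩
  have hfix := hcontr.isFixedPt_fixedPoint_iterate
  set ξ := ContractingWith.fixedPoint Γ^[k] hcontr
  refine ⟨X ξ, hX ξ, fun t ht => ?_⟩
  have : (Γ ξ) ⟨t, ht⟩ = ξ ⟨t, ht⟩ := by rw [hfix]
  rw [show X ξ t = ξ ⟨t, ht⟩ from IccExtend_of_mem hR _ ht, ← this]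
  rfl

theorem aestronglyMeasurable_sum_smul {ι : Type*} [Fintype ι] {c : ℝ → ι → ℝ} (hc : Measurable c)
    {G : ι → E → E} (hG : ∀ j, Continuous (G j)) {ξ : ℝ → E} (hξ : Continuous ξ) :
    AEStronglyMeasurable (fun r => ∑ j, c r j • G j (ξ r)) volume := by
  refine Finset.aestronglyMeasurable_fun_sum _ fun j _ => ?_
  exact ((measurable_pi_iff.1 hc j).aestronglyMeasurable).smul
    ((hG j).comp hξ).aestronglyMeasurable

theorem norm_sum_smul_le {ι : Type*} [Fintype ι] {c : ι → ℝ} {x : ι → E} {K κ : ℝ}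
    (hκ : ∑ j, |c j| ≤ κ) (hx : ∀ j, ‖x j‖ ≤ K) (hK : 0 ≤ K) : ‖∑ j, c j • x j‖ ≤ κ * K := by
  refine (norm_sum_le _ _).trans ((Finset.sum_le_sum fun j _ => ?_).trans
    ((Finset.sum_mul _ _ _).symm.le.trans (mul_le_mul_of_nonneg_right hκ hK)))
  rw [norm_smul, Real.norm_eq_abs]
  exact mul_le_mul_of_nonneg_left (hx j) (abs_nonneg _)

theorem norm_sum_smul_sub_le {ι : Type*} [Fintype ι] {c : ι → ℝ} {x y : ι → E} {B κ : ℝ}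
    (hκ : ∑ j, |c j| ≤ κ) (hx : ∀ j, ‖x j - y j‖ ≤ B) (hB : 0 ≤ B) :
    ‖∑ j, c j • x j - ∑ j, c j • y j‖ ≤ κ * B := by
  have : ∑ j, c j • x j - ∑ j, c j • y j = ∑ j, c j • (x j - y j) := by
    simp only [smul_sub, Finset.sum_sub_distrib]
  rw [this]
  exact norm_sum_smul_le hκ hx hB

theorem intervalIntegrable_coord {ι : Type*} [Fintype ι] {c : ℝ → ι → ℝ} (hc : Measurable c)
    {κ : ℝ} (hcκ : ∀ t, ∑ j, |c t j| ≤ κ) (j : ι) (a b : ℝ) :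
    IntervalIntegrable (fun r => c r j) volume a b :=
  intervalIntegrable_of_norm_le (measurable_pi_iff.1 hc j).aestronglyMeasurable
    (fun r => (Finset.single_le_sum (f := fun j => |c r j|) (fun _ _ => abs_nonneg _)
      (Finset.mem_univ j)).trans (hcκ r)) a b

/-- Solutions in integral form are driven by the primitive of the control. -/
theorem driven_of_integral_solution [CompleteSpace E] {ι : Type*} [Fintype ι] {G : ι → E → E}
    {c : ℝ → ι → ℝ} {ξ : ℝ → E} {K κ R : ℝ} (hc : Measurable c) (hcκ : ∀ t, ∑ j, |c t j| ≤ κ)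
    (hGK : ∀ j x, ‖G j x‖ ≤ K) (hGL : ∀ j x y, ‖G j x - G j y‖ ≤ K * ‖x - y‖) (hK : 0 ≤ K)
    (hξc : Continuous ξ)
    (hξ : ∀ t ∈ Icc 0 R, ξ t = ∫ r in (0 : ℝ)..t, ∑ j, c r j • G j (ξ r)) :
    Driven G (fun t j => ∫ r in (0 : ℝ)..t, c r j) ξ 0 R (κ * (K * (κ * K))) := by
  have hκ : 0 ≤ κ := (Finset.sum_nonneg fun _ _ => abs_nonneg _).trans (hcκ 0)
  have hGc : ∀ j, Continuous (G j) := fun j =>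
    (LipschitzWith.of_dist_le_mul (K := K.toNNReal) fun x y => by
      rw [dist_eq_norm, dist_eq_norm, Real.coe_toNNReal _ hK]; exact hGL j x y).continuous
  have hint : ∀ a b, IntervalIntegrable (fun r => ∑ j, c r j • G j (ξ r)) volume a b :=
    intervalIntegrable_of_norm_le (aestronglyMeasurable_sum_smul hc hGc hξc)
      fun r => norm_sum_smul_le (hcκ r) (fun j => hGK j _) hK
  have hdiff : ∀ s ∈ Icc 0 R, ∀ t ∈ Icc 0 R,
      ξ t - ξ s = ∫ r in s..t, ∑ j, c r j • G j (ξ r) := fun s hs t ht => by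
    rw [hξ t ht, hξ s hs, intervalIntegral.integral_interval_sub_left (hint _ _) (hint _ _)]
  have hlip : ∀ s ∈ Icc 0 R, ∀ t ∈ Icc 0 R, ‖ξ t - ξ s‖ ≤ κ * K * |t - s| := by
    intro s hs t ht
    rw [hdiff s hs t ht]
    exact intervalIntegral.norm_integral_le_of_norm_le_const
      fun r _ => norm_sum_smul_le (hcκ r) (fun j => hGK j _) hK
  intro s hs t ht
  have e : ∑ j, ((∫ r in (0 : ℝ)..t, c r j) - ∫ r in (0 : ℝ)..s, c r j) • G j (ξ s) =
      ∫ r in s..t, ∑ j, c r j • G j (ξ s) := by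
    rw [intervalIntegral.integral_finsetSum]
    · refine Finset.sum_congr rfl fun j _ => ?_
      rw [intervalIntegral.integral_smul_const, intervalIntegral.integral_interval_sub_left
        (intervalIntegrable_coord hc hcκ j _ _) (intervalIntegrable_coord hc hcκ j _ _)]
    · intro j _
      have := intervalIntegrable_coord hc hcκ j s t
      exact ⟨Integrable.smul_const this.1 _, Integrable.smul_const this.2 _⟩
  have hint2 : IntervalIntegrable (fun r => ∑ j, c r j • G j (ξ s)) volume s t :=
    intervalIntegrable_of_norm_le (aestronglyMeasurable_sum_smul hc
      (G := fun j _ => G j (ξ s)) (fun j => continuous_const) hξc)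
      (fun r => norm_sum_smul_le (hcκ r) (fun j => hGK j _) hK) _ _
  rw [e, hdiff s hs t ht, ← intervalIntegral.integral_sub (hint _ _) hint2]
  -- The error of freezing the fields at time `s`: the curve is `κ * K`-Lipschitz, so the integrand
  -- is `O(|t - s|)` and its integral is quadratic.
  have hbd : ∀ r ∈ uIoc s t, ‖∑ j, c r j • G j (ξ r) - ∑ j, c r j • G j (ξ s)‖ ≤
      κ * (K * (κ * K * |t - s|)) := by
    intro r hr
    have hr' : r ∈ uIcc s t := uIoc_subset_uIcc hr
    have hrR : r ∈ Icc 0 R := (uIcc_subset_Icc hs ht) hr'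
    rw [← Finset.sum_sub_distrib]
    simp_rw [← smul_sub]
    refine norm_sum_smul_le (hcκ r) (fun j => (hGL j _ _).trans ?_) (by positivity)
    refine mul_le_mul_of_nonneg_left ((hlip s hs r hrR).trans ?_) hK
    exact mul_le_mul_of_nonneg_left (abs_sub_left_of_mem_uIcc hr') (by positivity)
  refine (intervalIntegral.norm_integral_le_of_norm_le_const hbd).trans (le_of_eq ?_)
  rw [← sq_abs (t - s)]
  ring

end Picard

/-! ### Continuity of integrals in the metric `W₁`. -/

section Wasserstein

variable {n : ℕ}

theorem P1.integrable_of_sublinear {ℓ : Rn n → ℝ} (hℓ : Continuous ℓ) {C : ℝ}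
    (hC : ∀ x, |ℓ x| ≤ C * (1 + ‖x‖)) (μ : P1 n) : Integrable ℓ μ.toMeasure :=
  Integrable.mono' (((integrable_const (1 : ℝ)).add μ.integrable_norm).const_mul C)
    hℓ.aestronglyMeasurable (ae_of_all _ hC)

theorem P1.integrable_of_lipschitzWith {K : ℝ≥0} {φ : Rn n → ℝ} (hφ : LipschitzWith K φ)
    (μ : P1 n) : Integrable φ μ.toMeasure := by
  refine μ.integrable_of_sublinear hφ.continuous (C := |φ 0| + K) fun x => ?_
  have h := hφ.dist_le_mul x 0
  rw [Real.dist_eq, dist_zero_right] at h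
  have h2 : |φ x| ≤ |φ x - φ 0| + |φ 0| := by simpa using abs_add_le (φ x - φ 0) (φ 0)
  nlinarith [norm_nonneg x, abs_nonneg (φ 0), K.coe_nonneg, mul_nonneg (abs_nonneg (φ 0)) (norm_nonneg x)]

theorem P1.abs_integral_sub_le {K : ℝ} (hK : 0 ≤ K) {φ : Rn n → ℝ}
    (hφ : ∀ x y, |φ x - φ y| ≤ K * ‖x - y‖) (μ ν : P1 n) :
    |(∫ x, φ x ∂μ.toMeasure) - ∫ x, φ x ∂ν.toMeasure| ≤ K * dist μ ν := by
  have key : ∀ (φ : Rn n → ℝ), (∀ x y, |φ x - φ y| ≤ K * ‖x - y‖) →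
      (∫ x, φ x ∂μ.toMeasure) - ∫ x, φ x ∂ν.toMeasure ≤ K * dist μ ν := by
    intro φ hφ
    refine le_of_forall_pos_le_add fun ε hε => ?_
    -- Dividing by `K + δ` instead of `K` also covers `K = 0`; the excess costs `δ * dist μ ν ≤ ε`.
    set δ := ε / (dist μ ν + 1) with hδ
    have hd : (0 : ℝ) ≤ dist μ ν := dist_nonneg
    have hδ0 : 0 < δ := by positivity
    have hψ : LipschitzWith 1 fun x => (K + δ)⁻¹ * φ x := by
      refine LipschitzWith.of_dist_le_mul fun x y => ?_
      rw [Real.dist_eq, dist_eq_norm, ← mul_sub, abs_mul, abs_of_pos (by positivity),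
        inv_mul_le_iff₀ (by positivity)]
      push_cast
      have := hφ x y
      nlinarith [norm_nonneg (x - y)]
    have h1 : _ ≤ dist μ ν := le_W1 hψ μ ν
    rw [integral_const_mul, integral_const_mul, ← mul_sub, inv_mul_le_iff₀ (by positivity)] at h1
    refine h1.trans ?_
    have : δ * dist μ ν ≤ ε := by
      rw [hδ, div_mul_eq_mul_div, div_le_iff₀ (by positivity)]
      nlinarith
    linarith
  rw [abs_le]
  refine ⟨?_, key φ hφ⟩
  have := key (fun x => -φ x) fun x y => by
    rw [← neg_sub_neg, abs_sub_comm] at *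
    simpa [abs_sub_comm] using hφ x y
  rw [integral_neg, integral_neg] at this
  linarith

/-- The Pasch–Hausdorff envelope. -/
def lipEnvelope (ℓ : Rn n → ℝ) (k : ℕ) (x : Rn n) : ℝ := ⨅ y, (ℓ y + k * ‖x - y‖)

/-- Once the slope `k` exceeds the growth constant `C`, the penalty dominates `ℓ`. This makes the
infimum in `lipEnvelope` bounded below and confines near-minimizers to a small neighbourhood of `x`
for large `k`. -/
theorem sublinear_lower_bound {ℓ : Rn n → ℝ} {C : ℝ} (hC0 : 0 ≤ C)
    (hC : ∀ x, |ℓ x| ≤ C * (1 + ‖x‖)) (k : ℕ) (x y : Rn n) :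
    -(C * (1 + ‖x‖)) + (k - C) * ‖x - y‖ ≤ ℓ y + k * ‖x - y‖ := by
  have h1 := (abs_le.1 (hC y)).1
  have h2 : ‖y‖ ≤ ‖x‖ + ‖x - y‖ := by
    have := norm_sub_le x (x - y)
    simpa using this
  nlinarith

theorem sublinear_lower_bound' {ℓ : Rn n → ℝ} {C : ℝ} (hC0 : 0 ≤ C)
    (hC : ∀ x, |ℓ x| ≤ C * (1 + ‖x‖)) {k : ℕ} (hk : C ≤ k) (x y : Rn n) :
    -(C * (1 + ‖x‖)) ≤ ℓ y + k * ‖x - y‖ := by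
  have := sublinear_lower_bound hC0 hC k x y
  have h := mul_nonneg (sub_nonneg.2 hk) (norm_nonneg (x - y))
  linarith

theorem bddBelow_envelope {ℓ : Rn n → ℝ} {C : ℝ} (hC0 : 0 ≤ C)
    (hC : ∀ x, |ℓ x| ≤ C * (1 + ‖x‖)) {k : ℕ} (hk : C ≤ k) (x : Rn n) :
    BddBelow (range fun y => ℓ y + k * ‖x - y‖) :=
  ⟨_, by rintro _ ⟨y, rfl⟩; exact sublinear_lower_bound' hC0 hC hk x y⟩

theorem lipEnvelope_le {ℓ : Rn n → ℝ} {C : ℝ} (hC0 : 0 ≤ C)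
    (hC : ∀ x, |ℓ x| ≤ C * (1 + ‖x‖)) {k : ℕ} (hk : C ≤ k) (x : Rn n) :
    lipEnvelope ℓ k x ≤ ℓ x := by
  have := ciInf_le (bddBelow_envelope hC0 hC hk x) x
  simpa [lipEnvelope] using this

theorem le_lipEnvelope {ℓ : Rn n → ℝ} {C : ℝ} (hC0 : 0 ≤ C)
    (hC : ∀ x, |ℓ x| ≤ C * (1 + ‖x‖)) {k : ℕ} (hk : C ≤ k) (x : Rn n) :
    -(C * (1 + ‖x‖)) ≤ lipEnvelope ℓ k x :=
  le_ciInf fun y => sublinear_lower_bound' hC0 hC hk x y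

theorem abs_lipEnvelope_sub_le {ℓ : Rn n → ℝ} {C : ℝ} (hC0 : 0 ≤ C)
    (hC : ∀ x, |ℓ x| ≤ C * (1 + ‖x‖)) {k : ℕ} (hk : C ≤ k) (x x' : Rn n) :
    |lipEnvelope ℓ k x - lipEnvelope ℓ k x'| ≤ k * ‖x - x'‖ := by
  have key : ∀ x x' : Rn n, lipEnvelope ℓ k x ≤ lipEnvelope ℓ k x' + k * ‖x - x'‖ := by
    intro x x'
    rw [← sub_le_iff_le_add]
    refine le_ciInf fun y => ?_
    rw [sub_le_iff_le_add]
    refine (ciInf_le (bddBelow_envelope hC0 hC hk x) y).trans ?_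
    have h1 : ‖x - y‖ ≤ ‖x - x'‖ + ‖x' - y‖ := norm_sub_le_norm_sub_add_norm_sub x x' y
    have := mul_le_mul_of_nonneg_left h1 (Nat.cast_nonneg (α := ℝ) k)
    linarith
  rw [abs_le]
  have h1 := key x x'
  have h2 := key x' x
  rw [norm_sub_rev x' x] at h2
  constructor <;> linarith

theorem tendsto_lipEnvelope {ℓ : Rn n → ℝ} (hℓ : Continuous ℓ) {C : ℝ} (hC0 : 0 ≤ C)
    (hC : ∀ x, |ℓ x| ≤ C * (1 + ‖x‖)) (x : Rn n) :
    Tendsto (fun k => lipEnvelope ℓ k x) atTop (𝓝 (ℓ x)) := by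
  rw [tendsto_order]
  constructor
  · intro a ha
    obtain ⟨b, hab, hb⟩ := exists_between ha
    obtain ⟨δ, hδ, hball⟩ := Metric.eventually_nhds_iff.1 (hℓ.continuousAt.eventually_const_lt hb)
    have hev : ∀ᶠ k : ℕ in atTop, C + (b + C * (1 + ‖x‖)) / δ ≤ (k : ℝ) :=
      tendsto_natCast_atTop_atTop.eventually_ge_atTop _
    have hev2 : ∀ᶠ k : ℕ in atTop, C ≤ (k : ℝ) := tendsto_natCast_atTop_atTop.eventually_ge_atTop _
    filter_upwards [hev, hev2] with k hk hkC
    refine hab.trans_le (le_ciInf fun y => ?_)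
    -- For `y` near `x`, continuity of `ℓ` gives the lower bound `b`; for `y` far from `x`, the
    -- penalty `(k - C) * δ` does.
    by_cases hy : dist y x < δ
    · have := hball hy
      have h2 : (0 : ℝ) ≤ k * ‖x - y‖ := by positivity
      linarith
    · have h1 := sublinear_lower_bound hC0 hC k x y
      rw [not_lt, dist_comm, dist_eq_norm] at hy
      have h2 : (k - C) * δ ≤ (k - C) * ‖x - y‖ :=
        mul_le_mul_of_nonneg_left hy (sub_nonneg.2 hkC)
      have h3 : b + C * (1 + ‖x‖) ≤ (k - C) * δ := by
        rw [← div_le_iff₀ hδ]; linarith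
      linarith
  · intro a ha
    filter_upwards [tendsto_natCast_atTop_atTop.eventually_ge_atTop C] with k hk
    exact (lipEnvelope_le hC0 hC hk x).trans_lt ha

/-- Lower semicontinuity of the integral. The envelopes are Lipschitz, so their integrals are
`W₁`-continuous; they lie below `ℓ`, and by dominated convergence one of them already has integral
above `a`. Applied to `ℓ` and `-ℓ` it gives continuity. -/
theorem eventually_lt_integral_of_sublinear {ℓ : Rn n → ℝ} (hℓ : Continuous ℓ) {C : ℝ}
    (hC0 : 0 ≤ C) (hC : ∀ x, |ℓ x| ≤ C * (1 + ‖x‖)) (μ : P1 n) {a : ℝ}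
    (ha : a < ∫ x, ℓ x ∂μ.toMeasure) : ∀ᶠ ν in 𝓝 μ, a < ∫ x, ℓ x ∂ν.toMeasure := by
  have hev2 : ∀ᶠ k : ℕ in atTop, C ≤ (k : ℝ) := tendsto_natCast_atTop_atTop.eventually_ge_atTop _
  have hlip : ∀ k : ℕ, C ≤ k → Continuous (lipEnvelope ℓ k) := fun k hk =>
    (LipschitzWith.of_dist_le_mul (K := k) fun x y => by
      rw [Real.dist_eq, dist_eq_norm]
      simpa using abs_lipEnvelope_sub_le hC0 hC hk x y).continuous
  have hbd : ∀ k : ℕ, C ≤ k → ∀ x, |lipEnvelope ℓ k x| ≤ C * (1 + ‖x‖) := fun k hk x =>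
    abs_le.2 ⟨le_lipEnvelope hC0 hC hk x,
      (lipEnvelope_le hC0 hC hk x).trans ((le_abs_self _).trans (hC x))⟩
  have hlim : Tendsto (fun k => ∫ x, lipEnvelope ℓ k x ∂μ.toMeasure) atTop
      (𝓝 (∫ x, ℓ x ∂μ.toMeasure)) := by
    refine tendsto_integral_filter_of_dominated_convergence (fun x => C * (1 + ‖x‖)) ?_ ?_
      (((integrable_const (1 : ℝ)).add μ.integrable_norm).const_mul C)
      (ae_of_all _ fun x => tendsto_lipEnvelope hℓ hC0 hC x)
    · filter_upwards [hev2] with k hk using (hlip k hk).aestronglyMeasurable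
    · filter_upwards [hev2] with k hk using ae_of_all _ fun x => hbd k hk x
  obtain ⟨k, hk1, hk2⟩ := ((hlim.eventually_const_lt ha).and hev2).exists
  have hcont : Continuous fun ν : P1 n => ∫ x, lipEnvelope ℓ k x ∂ν.toMeasure :=
    (LipschitzWith.of_dist_le_mul (K := k) fun μ ν => by
      rw [Real.dist_eq]
      simpa using P1.abs_integral_sub_le (Nat.cast_nonneg k)
        (abs_lipEnvelope_sub_le hC0 hC hk2) μ ν).continuous
  filter_upwards [hcont.continuousAt.eventually_const_lt hk1] with ν hν
  refine hν.trans_le (integral_mono (ν.integrable_of_sublinear (hlip k hk2) (hbd k hk2))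
    (ν.integrable_of_sublinear hℓ hC) fun x => lipEnvelope_le hC0 hC hk2 x)

/-- Convergence in `W₁` implies convergence of the integrals of continuous functions of linear
growth. -/
theorem continuous_integral_of_sublinear {ℓ : Rn n → ℝ} (hℓ : Continuous ℓ) {C : ℝ}
    (hC0 : 0 ≤ C) (hC : ∀ x, |ℓ x| ≤ C * (1 + ‖x‖)) :
    Continuous fun μ : P1 n => ∫ x, ℓ x ∂μ.toMeasure := by
  rw [continuous_iff_continuousAt]
  intro μ
  refine tendsto_order.2 ⟨fun a ha => eventually_lt_integral_of_sublinear hℓ hC0 hC μ ha,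
    fun a ha => ?_⟩
  have := eventually_lt_integral_of_sublinear hℓ.neg hC0 (fun x => by simpa using hC x) μ
    (a := -a) (by simpa [integral_neg] using ha)
  filter_upwards [this] with ν hν
  simp only [Pi.neg_apply, integral_neg] at hν
  linarith

/-- Compactly supported Lipschitz functions determine a measure. -/
theorem P1.ext_of_integral_eq {μ ν : P1 n}
    (h : ∀ (Λ : ℝ≥0) (ψ : Rn n → ℝ), LipschitzWith Λ ψ → HasCompactSupport ψ →
      ∫ x, ψ x ∂μ.toMeasure = ∫ x, ψ x ∂ν.toMeasure) : μ = ν := by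
  refine eq_of_W1_eq_zero ?_
  have hz : ∀ φ : {φ : Rn n → ℝ // LipschitzWith 1 φ},
      (∫ x, φ.1 x ∂μ.toMeasure) - ∫ x, φ.1 x ∂ν.toMeasure = 0 := by
    rintro ⟨φ, hφ⟩
    let a : ℕ → Rn n → ℝ := fun k x => max (k - ‖x‖) 0
    -- The function `φ - φ 0` is clipped between `-a k` and `a k`. This keeps it 1-Lipschitz, makes
    -- the support compact, and changes nothing where `2 * ‖x‖ ≤ k`. Subtracting `φ 0` is harmless
    -- because both measures have mass one.
    let ψ : ℕ → Rn n → ℝ := fun k x => max (-a k x) (min (φ x - φ 0) (a k x))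
    have ha : ∀ k, LipschitzWith 1 (a k) := fun k => by
      have h1 : LipschitzWith 1 fun x : Rn n => (k : ℝ) - ‖x‖ := by
        simpa using (LipschitzWith.const' (K := 0) (k : ℝ)).sub lipschitzWith_one_norm
      simpa using h1.max (LipschitzWith.const' (K := 1) (0 : ℝ))
    have hφ0 : LipschitzWith 1 fun x => φ x - φ 0 := by
      simpa using hφ.sub (LipschitzWith.const' (K := 0) (φ 0))
    have hψ : ∀ k, LipschitzWith 1 (ψ k) := fun k => by
      simpa using (ha k).neg.max (hφ0.min (ha k))
    have hcs : ∀ k, HasCompactSupport (ψ k) := fun k => by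
      refine HasCompactSupport.of_support_subset_isCompact (isCompact_closedBall (0 : Rn n) k) ?_
      intro x hx
      by_contra hx'
      have h1 : (k : ℝ) < ‖x‖ := by simpa using hx'
      have h2 : a k x = 0 := max_eq_right (by linarith)
      exact hx (by simp [ψ, h2])
    have hbd : ∀ k x, |ψ k x| ≤ ‖x‖ := fun k x => by
      have h1 := abs_sub_zero_le_norm hφ x
      have h2 : |ψ k x| ≤ |φ x - φ 0| := by
        have h0 : 0 ≤ a k x := le_max_right _ _
        simp only [ψ]
        rcases le_total 0 (φ x - φ 0) with h | h
        · rw [abs_of_nonneg h, abs_of_nonneg (le_max_of_le_right (le_min h h0))]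
          exact max_le (by linarith) (min_le_left _ _)
        · rw [min_eq_left (h.trans h0), abs_of_nonpos h,
            abs_of_nonpos (max_le (by linarith) h)]
          linarith [le_max_right (-a k x) (φ x - φ 0)]
      exact h2.trans h1
    have hlim : ∀ x, Tendsto (fun k => ψ k x) atTop (𝓝 (φ x - φ 0)) := fun x => by
      refine tendsto_const_nhds.congr' ?_
      filter_upwards [tendsto_natCast_atTop_atTop.eventually_ge_atTop (2 * ‖x‖)] with k hk
      have h1 := abs_le.1 (abs_sub_zero_le_norm hφ x)
      have h2 : ‖x‖ ≤ a k x := le_max_of_le_left (by linarith)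
      simp only [ψ]
      rw [min_eq_left (by linarith), max_eq_right (by linarith)]
    have hI : ∀ ρ : P1 n, Tendsto (fun k => ∫ x, ψ k x ∂ρ.toMeasure) atTop
        (𝓝 (∫ x, (φ x - φ 0) ∂ρ.toMeasure)) := fun ρ =>
      tendsto_integral_of_dominated_convergence (fun x => ‖x‖)
        (fun k => (hψ k).continuous.aestronglyMeasurable) ρ.integrable_norm
        (fun k => ae_of_all _ (hbd k)) (ae_of_all _ hlim)
    have e := tendsto_nhds_unique (hI μ)
      ((hI ν).congr fun k => (h 1 (ψ k) (hψ k) (hcs k)).symm)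
    rw [integral_sub (integrable_of_lipschitz hφ μ) (integrable_const _),
      integral_sub (integrable_of_lipschitz hφ ν) (integrable_const _)] at e
    simp only [integral_const, probReal_univ, one_smul] at e
    show (∫ x, φ x ∂μ.toMeasure) - ∫ x, φ x ∂ν.toMeasure = 0
    linarith
  simp [W1, hz]

end Wasserstein

/-! ### Displacement fields and push-forwards. -/

section Push

variable {n : ℕ}

/-- Bounded displacement fields on `ℝⁿ`. -/
abbrev Disp (n : ℕ) : Type := BoundedContinuousFunction (Rn n) (Rn n)

/-- The map `x ↦ x + ξ x`. -/
def shift (ξ : Disp n) : C(Rn n, Rn n) := ⟨fun x => x + ξ x, by fun_prop⟩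

@[simp] theorem shift_apply (ξ : Disp n) (x : Rn n) : shift ξ x = x + ξ x := rfl

/-- The push-forward of `ϑ` under `x ↦ x + ξ x`. -/
def push (ϑ : P1 n) (ξ : Disp n) : P1 n where
  toMeasure := ϑ.toMeasure.map (shift ξ)
  isProb := Measure.isProbabilityMeasure_map (shift ξ).continuous.aemeasurable
  integrable_norm := by
    rw [integrable_map_measure continuous_norm.aestronglyMeasurable
      (shift ξ).continuous.aemeasurable]
    refine Integrable.mono' (ϑ.integrable_norm.add (integrable_const ‖ξ‖))
      (continuous_norm.comp (shift ξ).continuous).aestronglyMeasurable (ae_of_all _ fun x => ?_)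
    simpa using (norm_add_le x (ξ x)).trans (by gcongr; exact ξ.norm_coe_le_norm x)

theorem integral_push {F : Type*} [NormedAddCommGroup F] [NormedSpace ℝ F] (ϑ : P1 n) (ξ : Disp n)
    {φ : Rn n → F} (hφ : Continuous φ) :
    ∫ x, φ x ∂(push ϑ ξ).toMeasure = ∫ x, φ (x + ξ x) ∂ϑ.toMeasure :=
  integral_map (shift ξ).continuous.aemeasurable hφ.aestronglyMeasurable

theorem push_zero (ϑ : P1 n) : push ϑ 0 = ϑ := by
  refine P1.ext_of_integral_eq fun Λ ψ hψ _ => ?_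
  rw [integral_push ϑ 0 hψ.continuous]
  simp

theorem dist_push_le (ϑ : P1 n) (ξ η : Disp n) : dist (push ϑ ξ) (push ϑ η) ≤ ‖ξ - η‖ := by
  refine ciSup_le fun φ => ?_
  have hi : ∀ ξ : Disp n, Integrable (fun x => φ.1 (x + ξ x)) ϑ.toMeasure := fun ξ => by
    have := integrable_of_lipschitz φ.2 (push ϑ ξ)
    exact (integrable_map_measure φ.2.continuous.aestronglyMeasurable
      (shift ξ).continuous.aemeasurable).1 this
  rw [integral_push ϑ ξ φ.2.continuous, integral_push ϑ η φ.2.continuous,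
    ← integral_sub (hi ξ) (hi η)]
  have : ∫ x, (φ.1 (x + ξ x) - φ.1 (x + η x)) ∂ϑ.toMeasure ≤ ∫ _x, ‖ξ - η‖ ∂ϑ.toMeasure := by
    refine integral_mono ((hi ξ).sub (hi η)) (integrable_const _) fun x => ?_
    have h1 := φ.2.dist_le_mul (x + ξ x) (x + η x)
    rw [Real.dist_eq, dist_eq_norm, add_sub_add_left_eq_sub] at h1
    have h2 := (ξ - η).norm_coe_le_norm x
    have h3 := le_abs_self (φ.1 (x + ξ x) - φ.1 (x + η x))
    rw [BoundedContinuousFunction.sub_apply] at h2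
    push_cast at h1
    linarith
  simpa using this

theorem lipschitzWith_push (ϑ : P1 n) : LipschitzWith 1 (push ϑ) :=
  LipschitzWith.of_dist_le_mul fun ξ η => by
    simpa [dist_eq_norm] using dist_push_le ϑ ξ η

end Push

/-! ### The vector fields of the system, lifted to displacements. -/

section Fields

variable {n m : ℕ}

/-- A bounded Lipschitz function has integrals that are Lipschitz in the measure. -/
theorem P1.norm_integral_sub_le {F : Type*} [NormedAddCommGroup F] [NormedSpace ℝ F]
    [CompleteSpace F] {K : ℝ} (hK : 0 ≤ K) {φ : Rn n → F}
    (hφ : ∀ x y, ‖φ x - φ y‖ ≤ K * ‖x - y‖) {μ ν : P1 n} (hμ : Integrable φ μ.toMeasure)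
    (hν : Integrable φ ν.toMeasure) :
    ‖(∫ x, φ x ∂μ.toMeasure) - ∫ x, φ x ∂ν.toMeasure‖ ≤ K * dist μ ν := by
  -- A norming functional of the difference reduces the vector-valued estimate to the scalar one.
  obtain ⟨L, hL1, hL⟩ := exists_dual_vector'' ℝ
    ((∫ x, φ x ∂μ.toMeasure) - ∫ x, φ x ∂ν.toMeasure)
  have hL' : L ((∫ x, φ x ∂μ.toMeasure) - ∫ x, φ x ∂ν.toMeasure) =
    ‖(∫ x, φ x ∂μ.toMeasure) - ∫ x, φ x ∂ν.toMeasure‖ := by simpa using hL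
  rw [← hL', map_sub, ← L.integral_comp_comm hμ, ← L.integral_comp_comm hν]
  refine (le_abs_self _).trans (P1.abs_integral_sub_le hK (fun x y => ?_) μ ν)
  rw [← map_sub, ← Real.norm_eq_abs]
  refine (L.le_opNorm _).trans ?_
  calc ‖L‖ * ‖φ x - φ y‖ ≤ 1 * ‖φ x - φ y‖ := by gcongr
    _ ≤ _ := by rw [one_mul]; exact hφ x y

/-- The vector fields of the system, with explicit bounds. -/
structure FieldData (n m : ℕ) where
  f₀ : Disp n
  g : Disp n
  f : Fin m → Disp n
  K : ℝ
  K_nonneg : 0 ≤ K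
  norm_drift : ‖f₀‖ + ‖g‖ ≤ K
  norm_f : ∀ i, ‖f i‖ ≤ K
  lip_f₀ : ∀ x y, ‖f₀ x - f₀ y‖ ≤ K / 2 * ‖x - y‖
  lip_g : ∀ x y, ‖g x - g y‖ ≤ K / 2 * ‖x - y‖
  lip_f : ∀ i x y, ‖f i x - f i y‖ ≤ K * ‖x - y‖

namespace FieldData

variable (D : FieldData n m)

theorem integrable_conv (μ : P1 n) (x : Rn n) : Integrable (fun y => D.g (x - y)) μ.toMeasure :=
  Integrable.mono' (integrable_const ‖D.g‖)
    (D.g.continuous.comp (by fun_prop)).aestronglyMeasurable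
    (ae_of_all _ fun y => D.g.norm_coe_le_norm _)

theorem norm_conv_le (μ : P1 n) (x : Rn n) : ‖conv D.g μ x‖ ≤ ‖D.g‖ := by
  have := norm_integral_le_of_norm_le_const (μ := μ.toMeasure)
    (ae_of_all _ fun y => D.g.norm_coe_le_norm (x - y))
  simpa [conv] using this

theorem norm_drift_sub_le (μ : P1 n) (x y : Rn n) :
    ‖(D.f₀ x + conv D.g μ x) - (D.f₀ y + conv D.g μ y)‖ ≤ D.K * ‖x - y‖ := by
  have h1 : ‖conv D.g μ x - conv D.g μ y‖ ≤ D.K / 2 * ‖x - y‖ := by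
    unfold conv
    rw [← integral_sub (D.integrable_conv μ x) (D.integrable_conv μ y)]
    have := norm_integral_le_of_norm_le_const (μ := μ.toMeasure) (C := D.K / 2 * ‖x - y‖)
      (f := fun z => D.g (x - z) - D.g (y - z)) (ae_of_all _ fun z => by
        simpa using D.lip_g (x - z) (y - z))
    simpa using this
  have h2 := D.lip_f₀ x y
  rw [add_sub_add_comm]
  refine (norm_add_le _ _).trans ?_
  linarith

/-- The drift `f₀ + g * μ`. -/
def drift (μ : P1 n) : Disp n :=
  BoundedContinuousFunction.ofNormedAddCommGroup (fun x => D.f₀ x + conv D.g μ x)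
    (LipschitzWith.of_dist_le_mul (K := D.K.toNNReal) fun x y => by
      rw [dist_eq_norm, dist_eq_norm, Real.coe_toNNReal _ D.K_nonneg]
      exact D.norm_drift_sub_le μ x y).continuous D.K
    fun x => (norm_add_le _ _).trans ((add_le_add (D.f₀.norm_coe_le_norm x)
      (D.norm_conv_le μ x)).trans D.norm_drift)

/-- The drift and the controlled vector fields, indexed by `Option (Fin m)`. -/
def vec (μ : P1 n) : Option (Fin m) → Disp n
  | none => D.drift μ
  | some i => D.f i

theorem norm_vec_le (μ : P1 n) (j : Option (Fin m)) : ‖D.vec μ j‖ ≤ D.K := by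
  cases j with
  | none =>
    refine (BoundedContinuousFunction.norm_le D.K_nonneg).2 fun x => ?_
    exact (norm_add_le _ _).trans ((add_le_add (D.f₀.norm_coe_le_norm x)
      (D.norm_conv_le μ x)).trans D.norm_drift)
  | some i => exact D.norm_f i

theorem norm_vec_apply_sub_le (μ : P1 n) (j : Option (Fin m)) (x y : Rn n) :
    ‖D.vec μ j x - D.vec μ j y‖ ≤ D.K * ‖x - y‖ := by
  cases j with
  | none => exact D.norm_drift_sub_le μ x y
  | some i => exact D.lip_f i x y

theorem norm_vec_sub_le (μ ν : P1 n) (j : Option (Fin m)) :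
    ‖D.vec μ j - D.vec ν j‖ ≤ D.K * dist μ ν := by
  rw [BoundedContinuousFunction.norm_le (mul_nonneg D.K_nonneg dist_nonneg)]
  intro x
  cases j with
  | none =>
    change ‖(D.f₀ x + conv D.g μ x) - (D.f₀ x + conv D.g ν x)‖ ≤ _
    rw [add_sub_add_left_eq_sub]
    refine P1.norm_integral_sub_le D.K_nonneg (fun y z => ?_) (D.integrable_conv μ x)
      (D.integrable_conv ν x)
    have h1 := D.lip_g (x - y) (x - z)
    rw [sub_sub_sub_cancel_left, norm_sub_rev z y] at h1
    have := mul_nonneg D.K_nonneg (norm_nonneg (y - z))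
    linarith
  | some i => simpa [vec] using mul_nonneg D.K_nonneg dist_nonneg

/-- The velocity field of the transport equation. -/
def velocity (c : Option (Fin m) → ℝ) (μ : P1 n) (x : Rn n) : Rn n := ∑ j, c j • D.vec μ j x

/-- The vector field on displacements induced by `vec μ j`. -/
def lifted (μ : P1 n) (j : Option (Fin m)) (ξ : Disp n) : Disp n :=
  (D.vec μ j).compContinuous (shift ξ)

@[simp] theorem lifted_apply (μ : P1 n) (j : Option (Fin m)) (ξ : Disp n) (x : Rn n) :
    D.lifted μ j ξ x = D.vec μ j (x + ξ x) := rfl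

theorem norm_lifted_le (μ : P1 n) (j : Option (Fin m)) (ξ : Disp n) : ‖D.lifted μ j ξ‖ ≤ D.K :=
  (BoundedContinuousFunction.norm_le D.K_nonneg).2 fun _ =>
    ((D.vec μ j).norm_coe_le_norm _).trans (D.norm_vec_le μ j)

theorem norm_lifted_sub_le (μ ν : P1 n) (j : Option (Fin m)) (ξ η : Disp n) :
    ‖D.lifted μ j ξ - D.lifted ν j η‖ ≤ D.K * dist μ ν + D.K * ‖ξ - η‖ := by
  have := D.K_nonneg
  rw [BoundedContinuousFunction.norm_le (by positivity)]
  intro x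
  have e : (D.lifted μ j ξ - D.lifted ν j η) x = (D.vec μ j - D.vec ν j) (x + ξ x) +
      (D.vec ν j (x + ξ x) - D.vec ν j (x + η x)) := by simp
  rw [e]
  refine (norm_add_le _ _).trans (add_le_add ?_ ?_)
  · exact (BoundedContinuousFunction.norm_coe_le_norm _ _).trans (D.norm_vec_sub_le μ ν j)
  · refine (D.norm_vec_apply_sub_le ν j _ _).trans ?_
    rw [add_sub_add_left_eq_sub]
    exact mul_le_mul_of_nonneg_left ((ξ - η).norm_coe_le_norm x) D.K_nonneg

/-- The autonomous vector fields on displacements for the nonlocal system. -/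
def nonlocal (ϑ : P1 n) (j : Option (Fin m)) (ξ : Disp n) : Disp n := D.lifted (push ϑ ξ) j ξ

theorem norm_nonlocal_le (ϑ : P1 n) (j : Option (Fin m)) (ξ : Disp n) :
    ‖D.nonlocal ϑ j ξ‖ ≤ 2 * D.K := by
  have := D.norm_lifted_le (push ϑ ξ) j ξ
  have := D.K_nonneg
  unfold nonlocal
  linarith

theorem norm_nonlocal_sub_le (ϑ : P1 n) (j : Option (Fin m)) (ξ η : Disp n) :
    ‖D.nonlocal ϑ j ξ - D.nonlocal ϑ j η‖ ≤ 2 * D.K * ‖ξ - η‖ := by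
  refine (D.norm_lifted_sub_le _ _ j ξ η).trans ?_
  have := mul_le_mul_of_nonneg_left (dist_push_le ϑ ξ η) D.K_nonneg
  linarith

theorem continuous_lifted {μ : ℝ → P1 n} (hμ : Continuous μ) {ξ : ℝ → Disp n} (hξ : Continuous ξ)
    (j : Option (Fin m)) : Continuous fun t => D.lifted (μ t) j (ξ t) := by
  have h : Continuous fun p : P1 n × Disp n => D.lifted p.1 j p.2 := by
    refine (LipschitzWith.of_dist_le_mul (K := (2 * D.K).toNNReal) fun p q => ?_).continuous
    have hK := D.K_nonneg
    rw [Real.coe_toNNReal _ (by positivity), dist_eq_norm]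
    refine (D.norm_lifted_sub_le _ _ j _ _).trans ?_
    have h1 : dist p.1 q.1 ≤ dist p q := le_max_left _ _
    have h2 : dist p.2 q.2 ≤ dist p q := le_max_right _ _
    rw [dist_eq_norm] at h2
    nlinarith
  exact h.comp (hμ.prodMk hξ)

end FieldData

end Fields

/-! ### Mollification of Lipschitz test functions. -/

section Mollifier

variable {n : ℕ}

/-- A mollifier supported in the closed ball of radius `ε`. -/
structure IsMollifier (ρ : Rn n → ℝ) (ε : ℝ) : Prop where
  contDiff : ContDiff ℝ ∞ ρ
  compact : HasCompactSupport ρ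
  nonneg : ∀ z, 0 ≤ ρ z
  integral_eq : ∫ z, ρ z ∂Measure.addHaar = 1
  norm_le : ∀ z, ρ z ≠ 0 → ‖z‖ ≤ ε

theorem exists_isMollifier {ε : ℝ} (hε : 0 < ε) : ∃ ρ : Rn n → ℝ, IsMollifier ρ ε := by
  let b : ContDiffBump (0 : Rn n) := ⟨ε / 2, ε, by positivity, by linarith⟩
  refine ⟨b.normed Measure.addHaar, b.contDiff_normed, b.hasCompactSupport_normed,
    b.nonneg_normed, b.integral_normed, fun z hz => ?_⟩
  have : z ∈ Function.support (b.normed Measure.addHaar) := hz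
  rw [b.support_normed_eq, mem_ball_zero_iff] at this
  exact this.le

/-- The mollification of `ψ` by `ρ`. -/
def mollify (ρ ψ : Rn n → ℝ) : Rn n → ℝ :=
  convolution ρ ψ (ContinuousLinearMap.lsmul ℝ ℝ : ℝ →L[ℝ] ℝ →L[ℝ] ℝ) Measure.addHaar

theorem mollify_apply (ρ ψ : Rn n → ℝ) (x : Rn n) :
    mollify ρ ψ x = ∫ z, ρ z * ψ (x - z) ∂Measure.addHaar := rfl

namespace IsMollifier

variable {ρ : Rn n → ℝ} {ε : ℝ} (h : IsMollifier ρ ε)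

include h

theorem integrable_mul {φ : Rn n → ℝ} (hφ : Continuous φ) :
    Integrable (fun z => ρ z * φ z) Measure.addHaar :=
  Continuous.integrable_of_hasCompactSupport (f := fun z => ρ z * φ z)
    (h.contDiff.continuous.mul hφ) h.compact.mul_right

theorem abs_integral_sub_le {φ φ' : Rn n → ℝ} (hφ : Continuous φ) (hφ' : Continuous φ') {B : ℝ}
    (hB : ∀ z, ‖z‖ ≤ ε → |φ z - φ' z| ≤ B) :
    |(∫ z, ρ z * φ z ∂Measure.addHaar) - ∫ z, ρ z * φ' z ∂Measure.addHaar| ≤ B := by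
  rw [← integral_sub (h.integrable_mul hφ) (h.integrable_mul hφ')]
  have : |∫ z, (ρ z * φ z - ρ z * φ' z) ∂Measure.addHaar| ≤
      ∫ z, ρ z * B ∂Measure.addHaar := by
    refine norm_integral_le_of_norm_le (f := fun z => ρ z * φ z - ρ z * φ' z)
      (h.integrable_mul continuous_const) (ae_of_all _ fun z => ?_)
    rw [← mul_sub, Real.norm_eq_abs, abs_mul, abs_of_nonneg (h.nonneg z)]
    by_cases hz : ρ z = 0
    · simp [hz]
    · exact mul_le_mul_of_nonneg_left (hB z (h.norm_le z hz)) (h.nonneg z)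
  rwa [integral_mul_const, h.integral_eq, one_mul] at this

theorem integral_mul_const_eq (a : ℝ) : ∫ z, ρ z * a ∂Measure.addHaar = a := by
  rw [integral_mul_const, h.integral_eq, one_mul]

theorem contDiff_mollify {ψ : Rn n → ℝ} (hψ : Continuous ψ) : ContDiff ℝ ∞ (mollify ρ ψ) :=
  h.compact.contDiff_convolution_left _ h.contDiff hψ.locallyIntegrable

theorem hasCompactSupport_mollify {ψ : Rn n → ℝ} (hψ : HasCompactSupport ψ) :
    HasCompactSupport (mollify ρ ψ) :=
  h.compact.convolution _ hψ

theorem abs_mollify_sub_le {ψ : Rn n → ℝ} {Λ : ℝ≥0} (hψ : LipschitzWith Λ ψ) (x : Rn n) :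
    |mollify ρ ψ x - ψ x| ≤ Λ * ε := by
  rw [mollify_apply]
  have := h.abs_integral_sub_le (φ := fun z => ψ (x - z)) (φ' := fun _ => ψ x) (B := Λ * ε)
    (hψ.continuous.comp (by fun_prop)) continuous_const fun z hz => by
      have := hψ.dist_le_mul (x - z) x
      rw [Real.dist_eq, dist_eq_norm, sub_sub_cancel_left, norm_neg] at this
      exact this.trans (mul_le_mul_of_nonneg_left hz Λ.2)
  rwa [h.integral_mul_const_eq] at this

theorem lipschitzWith_mollify {ψ : Rn n → ℝ} {Λ : ℝ≥0} (hψ : LipschitzWith Λ ψ) :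
    LipschitzWith Λ (mollify ρ ψ) := by
  refine LipschitzWith.of_dist_le_mul fun x y => ?_
  rw [Real.dist_eq, mollify_apply, mollify_apply]
  refine h.abs_integral_sub_le (hψ.continuous.comp (by fun_prop))
    (hψ.continuous.comp (by fun_prop)) fun z _ => ?_
  simpa [Real.dist_eq] using hψ.dist_le_mul (x - z) (y - z)

/-- The derivative falls on `ρ`, so no more than the Lipschitz bound on `ψ` is needed. The constant
`∫ ‖fderiv ℝ ρ‖` depends on the mollifier and is not uniform in its radius; later choices must
respect this order. -/
theorem norm_fderiv_mollify_sub_le {ψ : Rn n → ℝ} {Λ : ℝ≥0} (hψ : LipschitzWith Λ ψ)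
    (x y : Rn n) : ‖fderiv ℝ (mollify ρ ψ) x - fderiv ℝ (mollify ρ ψ) y‖ ≤
      Λ * (∫ z, ‖fderiv ℝ ρ z‖ ∂Measure.addHaar) * ‖x - y‖ := by
  have hd := fun x => (h.compact.hasFDerivAt_convolution_left (ContinuousLinearMap.lsmul ℝ ℝ)
    (h.contDiff.of_le (by simp)) (hψ.continuous.locallyIntegrable (μ := Measure.addHaar))
    x).fderiv
  have hc : Continuous (fderiv ℝ ρ) := h.contDiff.continuous_fderiv (by simp)
  have hcs : HasCompactSupport (fderiv ℝ ρ) := h.compact.fderiv ℝ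
  have hi : ∀ x : Rn n, Integrable (fun z => ((ContinuousLinearMap.precompL (Rn n)
      (ContinuousLinearMap.lsmul ℝ ℝ)) (fderiv ℝ ρ z)) (ψ (x - z))) Measure.addHaar := fun x =>
    Continuous.integrable_of_hasCompactSupport
      (((ContinuousLinearMap.continuous _).comp hc).clm_apply (hψ.continuous.comp (by fun_prop)))
      (HasCompactSupport.intro hcs fun z hz => by
        rw [image_eq_zero_of_notMem_tsupport hz]; simp)
  change ‖fderiv ℝ (convolution ρ ψ (ContinuousLinearMap.lsmul ℝ ℝ) Measure.addHaar) x -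
    fderiv ℝ (convolution ρ ψ (ContinuousLinearMap.lsmul ℝ ℝ) Measure.addHaar) y‖ ≤ _
  rw [hd x, hd y, convolution_def, convolution_def, ← integral_sub (hi x) (hi y)]
  have hb : ∀ z, ‖((ContinuousLinearMap.precompL (Rn n)
      (ContinuousLinearMap.lsmul ℝ ℝ)) (fderiv ℝ ρ z)) (ψ (x - z)) -
      ((ContinuousLinearMap.precompL (Rn n)
      (ContinuousLinearMap.lsmul ℝ ℝ)) (fderiv ℝ ρ z)) (ψ (y - z))‖ ≤
      ‖fderiv ℝ ρ z‖ * (Λ * ‖x - y‖) := by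
    intro z
    rw [← map_sub]
    refine ContinuousLinearMap.opNorm_le_bound _ (by positivity) fun w => ?_
    rw [ContinuousLinearMap.precompL_apply, ContinuousLinearMap.lsmul_apply, norm_smul]
    have h1 := (fderiv ℝ ρ z).le_opNorm w
    have h2 := hψ.dist_le_mul (x - z) (y - z)
    rw [dist_eq_norm, dist_eq_norm, sub_sub_sub_cancel_right] at h2
    calc _ ≤ ‖fderiv ℝ ρ z‖ * ‖w‖ * (Λ * ‖x - y‖) := by gcongr
      _ = _ := by ring
  refine (norm_integral_le_of_norm_le ((hc.norm.integrable_of_hasCompactSupport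
    hcs.norm).mul_const _) (ae_of_all _ hb)).trans (le_of_eq ?_)
  rw [integral_mul_const]
  ring

end IsMollifier

end Mollifier

/-! ### Uniqueness for the linear continuity equation by a dual Euler scheme. -/

section Uniqueness

variable {n : ℕ}

/-- The weak formulation of the continuity equation, tested with functions of `x` only and
integrated in time. -/
def IsIntegratedSolution (R : ℝ) (v : ℝ → Rn n → Rn n) (μ : ℝ → P1 n) : Prop :=
  ∀ χ : Rn n → ℝ, ContDiff ℝ ∞ χ → HasCompactSupport χ →
    IntervalIntegrable (fun r => ∫ x, fderiv ℝ χ x (v r x) ∂(μ r).toMeasure) volume 0 R ∧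
    ∀ s ∈ Icc 0 R, ∀ t ∈ Icc 0 R, (∫ x, χ x ∂(μ t).toMeasure) - ∫ x, χ x ∂(μ s).toMeasure =
      ∫ r in s..t, ∫ x, fderiv ℝ χ x (v r x) ∂(μ r).toMeasure

/-- A bounded measurable time-dependent vector field, uniformly Lipschitz in space. -/
structure IsVelocity (v : ℝ → Rn n → Rn n) (K : ℝ) : Prop where
  measurable : Measurable (Function.uncurry v)
  nonneg : 0 ≤ K
  norm_le : ∀ t x, ‖v t x‖ ≤ K
  lip : ∀ t x y, ‖v t x - v t y‖ ≤ K * ‖x - y‖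

theorem IsVelocity.intervalIntegrable {v : ℝ → Rn n → Rn n} {K : ℝ} (hv : IsVelocity v K)
    (x : Rn n) (s t : ℝ) : IntervalIntegrable (fun r => v r x) volume s t :=
  intervalIntegrable_of_norm_le
    (hv.measurable.comp (measurable_id.prodMk measurable_const)).aestronglyMeasurable
    (fun r => hv.norm_le r x) s t

/-- One step of the Euler scheme. -/
def eulerStep (v : ℝ → Rn n → Rn n) (s t : ℝ) (x : Rn n) : Rn n := x + ∫ r in s..t, v r x

theorem IsVelocity.norm_integral_sub_le {v : ℝ → Rn n → Rn n} {K : ℝ} (hv : IsVelocity v K)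
    {s t : ℝ} (hst : s ≤ t) (x y : Rn n) :
    ‖(∫ r in s..t, v r x) - ∫ r in s..t, v r y‖ ≤ K * ‖x - y‖ * (t - s) := by
  rw [← intervalIntegral.integral_sub (hv.intervalIntegrable x s t) (hv.intervalIntegrable y s t)]
  refine (intervalIntegral.norm_integral_le_of_norm_le_const fun r _ => hv.lip r x y).trans ?_
  rw [abs_of_nonneg (sub_nonneg.2 hst)]

theorem IsVelocity.norm_integral_le {v : ℝ → Rn n → Rn n} {K : ℝ} (hv : IsVelocity v K)
    {s t : ℝ} (hst : s ≤ t) (x : Rn n) : ‖∫ r in s..t, v r x‖ ≤ K * (t - s) := by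
  refine (intervalIntegral.norm_integral_le_of_norm_le_const fun r _ => hv.norm_le r x).trans ?_
  rw [abs_of_nonneg (sub_nonneg.2 hst)]

theorem IsVelocity.lipschitzWith_eulerStep {v : ℝ → Rn n → Rn n} {K : ℝ} (hv : IsVelocity v K)
    {s t : ℝ} (hst : s ≤ t) : LipschitzWith (1 + K * (t - s)).toNNReal (eulerStep v s t) := by
  refine LipschitzWith.of_dist_le_mul fun x y => ?_
  have h1 := hv.norm_integral_sub_le hst x y
  have h0 := hv.nonneg
  have h2 : 0 ≤ t - s := sub_nonneg.2 hst
  rw [dist_eq_norm, dist_eq_norm, Real.coe_toNNReal _ (by positivity)]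
  unfold eulerStep
  rw [add_sub_add_comm]
  refine (norm_add_le _ _).trans ?_
  linarith

theorem hasCompactSupport_comp_of_norm_sub_le {ψ : Rn n → ℝ} (hψ : HasCompactSupport ψ)
    {e : Rn n → Rn n} {B : ℝ} (he : ∀ x, ‖e x - x‖ ≤ B) : HasCompactSupport (ψ ∘ e) := by
  obtain ⟨r, hr⟩ := hψ.isCompact.isBounded.subset_closedBall 0
  refine HasCompactSupport.of_support_subset_isCompact (isCompact_closedBall (0 : Rn n) (r + B)) ?_
  intro x hx
  have h1 : e x ∈ Metric.closedBall 0 r := hr (subset_tsupport _ hx)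
  rw [mem_closedBall_zero_iff] at h1 ⊢
  have h2 : ‖x‖ ≤ ‖e x‖ + ‖e x - x‖ := by
    have := norm_sub_le (e x) (e x - x)
    simpa using this
  linarith [he x]

theorem abs_taylor_le {χ : Rn n → ℝ} (hχ : ContDiff ℝ ∞ χ) {A : ℝ} (hA0 : 0 ≤ A)
    (hA : ∀ x y, ‖fderiv ℝ χ x - fderiv ℝ χ y‖ ≤ A * ‖x - y‖) (x w : Rn n) :
    |χ (x + w) - χ x - fderiv ℝ χ x w| ≤ A * ‖w‖ * ‖w‖ := by
  have hd : Differentiable ℝ χ := hχ.differentiable (by simp)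
  have := Convex.norm_image_sub_le_of_norm_hasFDerivWithin_le' (𝕜 := ℝ) (f := χ)
    (f' := fderiv ℝ χ) (φ := fderiv ℝ χ x) (s := Metric.closedBall x ‖w‖) (C := A * ‖w‖)
    (x := x) (y := x + w) (fun z _ => (hd z).hasFDerivAt.hasFDerivWithinAt)
    (fun z hz => (hA z x).trans (mul_le_mul_of_nonneg_left
      (by simpa [dist_eq_norm] using hz) hA0))
    (convex_closedBall _ _) (by simp) (by simp)
  simpa using this

/-- A commutator estimate between mollification and one Euler step. Only the displacement is seen at
points shifted by `z`, and it varies by at most `K * ε * (t - s)`; the gain of the factor `t - s`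
lets the errors be summed over all steps. -/
theorem IsMollifier.abs_mollify_eulerStep_sub_le {ρ : Rn n → ℝ} {ε : ℝ} (hρ : IsMollifier ρ ε)
    {v : ℝ → Rn n → Rn n} {K : ℝ} (hv : IsVelocity v K) {s t : ℝ} (hst : s ≤ t)
    {ψ : Rn n → ℝ} {Λ : ℝ≥0} (hψ : LipschitzWith Λ ψ) (x : Rn n) :
    |mollify ρ (ψ ∘ eulerStep v s t) x - mollify ρ ψ (eulerStep v s t x)| ≤
      Λ * (K * ε * (t - s)) := by
  rw [mollify_apply, mollify_apply]
  refine hρ.abs_integral_sub_le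
    ((hψ.continuous.comp (hv.lipschitzWith_eulerStep hst).continuous).comp (by fun_prop))
    (hψ.continuous.comp (by fun_prop)) fun z hz => ?_
  have h1 := hψ.dist_le_mul (eulerStep v s t (x - z)) (eulerStep v s t x - z)
  rw [Real.dist_eq, dist_eq_norm] at h1
  refine h1.trans (mul_le_mul_of_nonneg_left ?_ Λ.2)
  have h2 := hv.norm_integral_sub_le hst (x - z) x
  have e : eulerStep v s t (x - z) - (eulerStep v s t x - z) =
      (∫ r in s..t, v r (x - z)) - ∫ r in s..t, v r x := by
    unfold eulerStep; abel
  rw [e]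
  refine h2.trans ?_
  rw [sub_sub_cancel_left, norm_neg]
  exact mul_le_mul_of_nonneg_right (mul_le_mul_of_nonneg_left hz hv.nonneg) (sub_nonneg.2 hst)

theorem integral_fderiv_comm {v : ℝ → Rn n → Rn n} {K : ℝ} (hv : IsVelocity v K) {s t : ℝ}
    {χ : Rn n → ℝ} (hχ : ContDiff ℝ ∞ χ) {Λ : ℝ≥0} (hL : LipschitzWith Λ χ) (ν : P1 n) :
    IntervalIntegrable (fun r => ∫ x, fderiv ℝ χ x (v r x) ∂ν.toMeasure) volume s t ∧
    ∫ r in s..t, ∫ x, fderiv ℝ χ x (v r x) ∂ν.toMeasure =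
      ∫ x, fderiv ℝ χ x (∫ r in s..t, v r x) ∂ν.toMeasure := by
  have hDc : Continuous (fderiv ℝ χ) := hχ.continuous_fderiv (by simp)
  have hDb : ∀ x, ‖fderiv ℝ χ x‖ ≤ Λ := fun x => norm_fderiv_le_of_lipschitz ℝ hL
  have hm : Measurable (Function.uncurry fun r x => fderiv ℝ χ x (v r x)) := by
    have h1 : Continuous fun p : (Rn n →L[ℝ] ℝ) × Rn n => p.1 p.2 := by fun_prop
    exact h1.measurable.comp ((hDc.measurable.comp measurable_snd).prodMk hv.measurable)
  have hb : ∀ r x, ‖fderiv ℝ χ x (v r x)‖ ≤ Λ * K := fun r x =>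
    ((fderiv ℝ χ x).le_opNorm _).trans (mul_le_mul (hDb x) (hv.norm_le r x) (norm_nonneg _) Λ.2)
  constructor
  · refine intervalIntegrable_of_norm_le (K := Λ * K)
      (hm.stronglyMeasurable.integral_prod_right.aestronglyMeasurable) (fun r => ?_) s t
    have := norm_integral_le_of_norm_le_const (μ := ν.toMeasure) (ae_of_all _ (hb r))
    simpa using this
  · rw [intervalIntegral_integral_swap]
    · refine integral_congr_ae (ae_of_all _ fun x => ?_)
      exact ContinuousLinearMap.intervalIntegral_comp_comm _ (hv.intervalIntegrable x s t)
    · have : IsFiniteMeasure (volume.restrict (uIoc s t)) := ⟨by simp [uIoc]⟩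
      exact Integrable.mono' (integrable_const (Λ * K : ℝ)) hm.aestronglyMeasurable
        (ae_of_all _ fun p => hb p.1 p.2)

/-- Testing `μ t` with a mollified `ψ` amounts to testing `μ s` with the mollification of `ψ ∘
eulerStep v s t`. The three errors come from commuting mollification with the step, from the Taylor
expansion, and from replacing `μ r` by `μ s`. Mollification is needed because `ψ ∘ eulerStep v s t`
is only Lipschitz. -/
theorem IsIntegratedSolution.abs_step_le {R : ℝ} {v : ℝ → Rn n → Rn n} {μ : ℝ → P1 n}
    (hμ : IsIntegratedSolution R v μ) {K : ℝ} (hv : IsVelocity v K) {ρ : Rn n → ℝ} {ε : ℝ}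
    (hρ : IsMollifier ρ ε) {I : ℝ} (hI : I = ∫ z, ‖fderiv ℝ ρ z‖ ∂Measure.addHaar)
    {s t : ℝ} (hs : s ∈ Icc 0 R) (ht : t ∈ Icc 0 R) (hst : s ≤ t) {σ : ℝ}
    (hσ : ∀ r ∈ Icc s t, dist (μ r) (μ s) ≤ σ) {ψ : Rn n → ℝ} {Λ : ℝ≥0}
    (hψ : LipschitzWith Λ ψ) (hc : HasCompactSupport ψ) :
    |(∫ x, mollify ρ ψ x ∂(μ t).toMeasure) -
        ∫ x, mollify ρ (ψ ∘ eulerStep v s t) x ∂(μ s).toMeasure| ≤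
      Λ * (K * ε * (t - s) + I * (K * (t - s)) ^ 2 + (I + 1) * K * σ * (t - s)) := by
  have hK := hv.nonneg
  have hτ : 0 ≤ t - s := sub_nonneg.2 hst
  have hI0 : 0 ≤ I := by rw [hI]; exact integral_nonneg fun _ => norm_nonneg _
  set χ := mollify ρ ψ with hχdef
  set e := eulerStep v s t with he
  have hχs : ContDiff ℝ ∞ χ := hρ.contDiff_mollify hψ.continuous
  have hχc : HasCompactSupport χ := hρ.hasCompactSupport_mollify hc
  have hχL : LipschitzWith Λ χ := hρ.lipschitzWith_mollify hψ
  have hDb : ∀ x, ‖fderiv ℝ χ x‖ ≤ Λ := fun x => norm_fderiv_le_of_lipschitz ℝ hχL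
  have hDL : ∀ x y, ‖fderiv ℝ χ x - fderiv ℝ χ y‖ ≤ Λ * I * ‖x - y‖ := fun x y => by
    rw [hI]; exact hρ.norm_fderiv_mollify_sub_le hψ x y
  obtain ⟨hq, hqe⟩ := hμ χ hχs hχc
  obtain ⟨hq', hqe'⟩ := integral_fderiv_comm hv hχs hχL (μ s) (s := s) (t := t)
  have hqst := hq.mono_set (c := s) (d := t)
    (by rw [uIcc_of_le (hs.1.trans hs.2)]; exact uIcc_subset_Icc hs ht)
  -- first error: freezing the measure
  have h1 : |(∫ r in s..t, ∫ x, fderiv ℝ χ x (v r x) ∂(μ r).toMeasure) -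
      ∫ r in s..t, ∫ x, fderiv ℝ χ x (v r x) ∂(μ s).toMeasure| ≤
      Λ * ((I + 1) * K * σ * (t - s)) := by
    rw [← intervalIntegral.integral_sub hqst hq']
    have := intervalIntegral.norm_integral_le_of_norm_le_const (a := s) (b := t)
      (f := fun r => (∫ x, fderiv ℝ χ x (v r x) ∂(μ r).toMeasure) -
        ∫ x, fderiv ℝ χ x (v r x) ∂(μ s).toMeasure) (C := (Λ * I * K + Λ * K) * σ) ?_
    · rw [abs_of_nonneg hτ, Real.norm_eq_abs] at this
      refine this.trans (le_of_eq ?_)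
      ring
    · intro r hr
      rw [uIoc_of_le hst] at hr
      refine (P1.abs_integral_sub_le (K := Λ * I * K + Λ * K) (by positivity)
        (fun x y => ?_) _ _).trans
        (mul_le_mul_of_nonneg_left (hσ r ⟨hr.1.le, hr.2⟩) (by positivity))
      have e1 : fderiv ℝ χ x (v r x) - fderiv ℝ χ y (v r y) =
          (fderiv ℝ χ x - fderiv ℝ χ y) (v r x) + fderiv ℝ χ y (v r x - v r y) := by
        simp
      rw [e1]
      refine (abs_add_le _ _).trans ?_
      have a1 := (fderiv ℝ χ x - fderiv ℝ χ y).le_opNorm (v r x)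
      have a2 := (fderiv ℝ χ y).le_opNorm (v r x - v r y)
      rw [Real.norm_eq_abs] at a1 a2
      have b1 : ‖fderiv ℝ χ x - fderiv ℝ χ y‖ * ‖v r x‖ ≤ (Λ * I * ‖x - y‖) * K :=
        mul_le_mul (hDL x y) (hv.norm_le r x) (norm_nonneg _) (by positivity)
      have b2 : ‖fderiv ℝ χ y‖ * ‖v r x - v r y‖ ≤ Λ * (K * ‖x - y‖) :=
        mul_le_mul (hDb y) (hv.lip r x y) (norm_nonneg _) Λ.2
      linarith
  -- second error: pointwise Taylor expansion
  have hec : Continuous e := (hv.lipschitzWith_eulerStep hst).continuous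
  have h2 : ∀ x, |χ x + fderiv ℝ χ x (∫ r in s..t, v r x) - mollify ρ (ψ ∘ e) x| ≤
      Λ * (K * ε * (t - s) + I * (K * (t - s)) ^ 2) := by
    intro x
    have a1 := hρ.abs_mollify_eulerStep_sub_le hv hst hψ x
    have a2 := abs_taylor_le hχs (A := Λ * I) (by positivity) hDL x (∫ r in s..t, v r x)
    have a3 := hv.norm_integral_le hst x
    have a4 : Λ * I * ‖∫ r in s..t, v r x‖ * ‖∫ r in s..t, v r x‖ ≤
        Λ * I * (K * (t - s)) * (K * (t - s)) := by gcongr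
    rw [← he, ← hχdef] at a1
    change |χ (e x) - χ x - _| ≤ _ at a2
    rw [abs_le] at a1 a2 ⊢
    constructor <;> nlinarith
  have hi1 : Integrable χ (μ s).toMeasure := P1.integrable_of_lipschitzWith hχL _
  have hwc : Continuous fun x => ∫ r in s..t, v r x := by
    have : (fun x => ∫ r in s..t, v r x) = fun x => e x - x := by
      funext x; simp [he, eulerStep]
    rw [this]; exact hec.sub continuous_id
  have hi2 : Integrable (fun x => fderiv ℝ χ x (∫ r in s..t, v r x)) (μ s).toMeasure := by
    refine Integrable.mono' (integrable_const (Λ * (K * (t - s))))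
      (((hχs.continuous_fderiv (by simp)).clm_apply hwc).aestronglyMeasurable)
      (ae_of_all _ fun x => ?_)
    exact ((fderiv ℝ χ x).le_opNorm _).trans
      (mul_le_mul (hDb x) (hv.norm_integral_le hst x) (norm_nonneg _) Λ.2)
  have hi3 : Integrable (mollify ρ (ψ ∘ e)) (μ s).toMeasure :=
    P1.integrable_of_lipschitzWith (hρ.lipschitzWith_mollify
      (hψ.comp (hv.lipschitzWith_eulerStep hst))) _
  have h3 : |(∫ x, χ x ∂(μ s).toMeasure) +
      (∫ x, fderiv ℝ χ x (∫ r in s..t, v r x) ∂(μ s).toMeasure) -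
      ∫ x, mollify ρ (ψ ∘ e) x ∂(μ s).toMeasure| ≤
      Λ * (K * ε * (t - s) + I * (K * (t - s)) ^ 2) := by
    have hi12 : Integrable (fun x => χ x + fderiv ℝ χ x (∫ r in s..t, v r x)) (μ s).toMeasure :=
      hi1.add hi2
    rw [← integral_add hi1 hi2, ← integral_sub hi12 hi3]
    have := norm_integral_le_of_norm_le_const (μ := (μ s).toMeasure)
      (f := fun x => χ x + fderiv ℝ χ x (∫ r in s..t, v r x) - mollify ρ (ψ ∘ e) x)
      (ae_of_all _ h2)
    simpa using this
  have h4 := hqe s hs t ht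
  rw [hqe'] at h1
  rw [abs_le] at h1 h3 ⊢
  constructor <;> linarith [h1.1, h1.2, h3.1, h3.2]

/-- Uniqueness for the linear continuity equation with a Lipschitz field. -/
theorem IsIntegratedSolution.unique {R : ℝ} (hR : 0 ≤ R) {v : ℝ → Rn n → Rn n} {μ ν : ℝ → P1 n}
    {K : ℝ} (hv : IsVelocity v K) (hμ : IsIntegratedSolution R v μ)
    (hν : IsIntegratedSolution R v ν) (hμc : ContinuousOn μ (Icc 0 R))
    (hνc : ContinuousOn ν (Icc 0 R)) (h0 : μ 0 = ν 0) : μ R = ν R := by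
  refine P1.ext_of_integral_eq fun Λ ψ hψ hψc => ?_
  have hK := hv.nonneg
  have key : ∀ δ > 0, |(∫ x, ψ x ∂(μ R).toMeasure) - ∫ x, ψ x ∂(ν R).toMeasure| ≤
      (2 * Λ + 2 * Λ * Real.exp (K * R) * (K * R + 1)) * δ := by
    intro δ hδ
    -- Order of choices: the mollifier at scale `δ`, which fixes `I`; then the oscillation `σ` of
    -- the two curves per step; then the number `N` of steps, which makes both that oscillation and
    -- the Taylor error small.
    obtain ⟨ρ, hρ⟩ := exists_isMollifier (n := n) hδ
    set I := ∫ z, ‖fderiv ℝ ρ z‖ ∂Measure.addHaar with hI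
    have hI0 : 0 ≤ I := integral_nonneg fun _ => norm_nonneg _
    set σ := δ / 2 / ((I + 1) * K * R + 1) with hσdef
    have hden : 0 < (I + 1) * K * R + 1 := by positivity
    have hσ : 0 < σ := by positivity
    have hσ1 : (I + 1) * K * σ * R ≤ δ / 2 := by
      have : (I + 1) * K * σ * R = ((I + 1) * K * R) * σ := by ring
      rw [this, hσdef, mul_div_assoc', div_le_iff₀ hden]
      nlinarith
    obtain ⟨d1, hd1, hu1⟩ := Metric.uniformContinuousOn_iff.1
      (isCompact_Icc.uniformContinuousOn_of_continuous hμc) σ hσ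
    obtain ⟨d2, hd2, hu2⟩ := Metric.uniformContinuousOn_iff.1
      (isCompact_Icc.uniformContinuousOn_of_continuous hνc) σ hσ
    obtain ⟨N, hN⟩ := exists_nat_gt (max (R / min d1 d2) (max 0 (I * (K * R) ^ 2 / (δ / 2))))
    have hN0 : (0 : ℝ) < N := (le_max_left _ _).trans_lt ((le_max_right _ _).trans_lt hN)
    have hN1 : R / N < min d1 d2 := by
      have := (le_max_left _ _).trans_lt hN
      rw [div_lt_iff₀ (lt_min hd1 hd2)] at this
      rw [div_lt_iff₀ hN0]; linarith
    have hN2 : I * (K * R) ^ 2 / N ≤ δ / 2 := by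
      have := (le_max_right _ _).trans_lt ((le_max_right _ _).trans_lt hN)
      rw [div_lt_iff₀ (by positivity)] at this
      rw [div_le_iff₀ hN0]; linarith
    set τ := R / N with hτ
    have hτ0 : 0 ≤ τ := by positivity
    have hNτ : (N : ℝ) * τ = R := by rw [hτ]; field_simp
    set B := K * δ * τ + I * (K * τ) ^ 2 + (I + 1) * K * σ * τ with hB
    have hB0 : 0 ≤ B := by positivity
    have hNB : N * B ≤ K * R * δ + δ := by
      have : N * B = K * R * δ + I * (K * R) ^ 2 / N + (I + 1) * K * σ * R := by
        rw [hB, hτ]; field_simp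
      linarith
    have hmem : ∀ k ≤ N, (k : ℝ) * τ ∈ Icc 0 R := fun k hk =>
      ⟨by positivity, by rw [← hNτ]; gcongr⟩
    -- The induction runs over all test functions at once: going back one step replaces `ψ` by its
    -- composition with an Euler step, which multiplies the Lipschitz constant by `1 + K * τ`. Each
    -- step adds one error `B` for each of the two solutions.
    have step : ∀ k ≤ N, ∀ (Λ : ℝ≥0) (ψ : Rn n → ℝ), LipschitzWith Λ ψ → HasCompactSupport ψ →
        |(∫ x, mollify ρ ψ x ∂(μ (k * τ)).toMeasure) -
          ∫ x, mollify ρ ψ x ∂(ν (k * τ)).toMeasure| ≤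
          Λ * (1 + K * τ) ^ k * (k * (2 * B)) := by
      intro k
      induction k with
      | zero => intro _ Λ ψ _ _; simp [h0]
      | succ k ih =>
        intro hk Λ ψ hψ hψc
        have hk' : k ≤ N := by omega
        have hle : (k : ℝ) * τ ≤ ((k + 1 : ℕ) : ℝ) * τ := by push_cast; nlinarith
        have hsub : ((k + 1 : ℕ) : ℝ) * τ - k * τ = τ := by push_cast; ring
        have hIcc : ∀ r ∈ Icc ((k : ℝ) * τ) (((k + 1 : ℕ) : ℝ) * τ), r ∈ Icc 0 R ∧
            dist r (k * τ) < min d1 d2 := fun r hr => by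
          refine ⟨⟨(hmem k hk').1.trans hr.1, hr.2.trans (hmem _ hk).2⟩, ?_⟩
          rw [Real.dist_eq, abs_of_nonneg (sub_nonneg.2 hr.1)]
          have := hr.2
          linarith
        have s1 := hμ.abs_step_le hv hρ hI (hmem k hk') (hmem _ hk) hle (σ := σ)
          (fun r hr => (hu1 r (hIcc r hr).1 _ (hmem k hk')
            ((hIcc r hr).2.trans_le (min_le_left _ _))).le) hψ hψc
        have s2 := hν.abs_step_le hv hρ hI (hmem k hk') (hmem _ hk) hle (σ := σ)
          (fun r hr => (hu2 r (hIcc r hr).1 _ (hmem k hk')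
            ((hIcc r hr).2.trans_le (min_le_right _ _))).le) hψ hψc
        rw [hsub, ← hB] at s1 s2
        have hE := hv.lipschitzWith_eulerStep hle
        have s3 := ih hk' _ _ (hψ.comp hE) (hasCompactSupport_comp_of_norm_sub_le hψc
          (e := eulerStep v (k * τ) ((k + 1 : ℕ) * τ))
          (B := K * τ) fun x => by
            have := hv.norm_integral_le hle x
            rw [hsub] at this
            simpa [eulerStep] using this)
        rw [hsub, NNReal.coe_mul, Real.coe_toNNReal _ (by positivity)] at s3
        have hp : (1 : ℝ) ≤ (1 + K * τ) ^ (k + 1) := one_le_pow₀ (by linarith [mul_nonneg hK hτ0])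
        have hΛB : Λ * B * 2 ≤ (1 + K * τ) ^ (k + 1) * (Λ * B * 2) :=
          le_mul_of_one_le_left (by positivity) hp
        have e1 : (Λ : ℝ) * (1 + K * τ) ^ (k + 1) * (((k + 1 : ℕ) : ℝ) * (2 * B)) =
            Λ * (1 + K * τ) * (1 + K * τ) ^ k * (k * (2 * B)) +
              (1 + K * τ) ^ (k + 1) * (Λ * B * 2) := by push_cast; ring
        rw [e1]
        rw [abs_le] at s1 s2 s3 ⊢
        constructor <;> linarith [s1.1, s1.2, s2.1, s2.2, s3.1, s3.2]
    have hfin := step N le_rfl Λ ψ hψ hψc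
    rw [hNτ] at hfin
    have hexp : (1 + K * τ) ^ N ≤ Real.exp (K * R) := by
      have : K * R = N * (K * τ) := by rw [← hNτ]; ring
      rw [this, Real.exp_nat_mul]
      exact pow_le_pow_left₀ (by positivity) (by linarith [Real.add_one_le_exp (K * τ)]) _
    have hmoll : ∀ κ : P1 n, |(∫ x, mollify ρ ψ x ∂κ.toMeasure) - ∫ x, ψ x ∂κ.toMeasure| ≤
        Λ * δ := fun κ => by
      rw [← integral_sub (κ.integrable_of_lipschitzWith (hρ.lipschitzWith_mollify hψ))
        (κ.integrable_of_lipschitzWith hψ)]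
      have := norm_integral_le_of_norm_le_const (μ := κ.toMeasure)
        (f := fun x => mollify ρ ψ x - ψ x) (ae_of_all _ (hρ.abs_mollify_sub_le hψ))
      simpa using this
    have m1 := hmoll (μ R)
    have m2 := hmoll (ν R)
    have hb : (Λ : ℝ) * (1 + K * τ) ^ N * (N * (2 * B)) ≤
        Λ * Real.exp (K * R) * (2 * (K * R * δ + δ)) := by
      have : (N : ℝ) * (2 * B) ≤ 2 * (K * R * δ + δ) := by linarith
      gcongr
    have e2 : (2 * (Λ : ℝ) + 2 * Λ * Real.exp (K * R) * (K * R + 1)) * δ =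
        2 * (Λ * δ) + Λ * Real.exp (K * R) * (2 * (K * R * δ + δ)) := by ring
    rw [e2]
    rw [abs_le] at m1 m2 hfin ⊢
    constructor <;> linarith [m1.1, m1.2, m2.1, m2.2, hfin.1, hfin.2]
  have hA : 0 ≤ 2 * (Λ : ℝ) + 2 * Λ * Real.exp (K * R) * (K * R + 1) := by positivity
  set A := 2 * (Λ : ℝ) + 2 * Λ * Real.exp (K * R) * (K * R + 1)
  have : |(∫ x, ψ x ∂(μ R).toMeasure) - ∫ x, ψ x ∂(ν R).toMeasure| ≤ 0 := by
    refine le_of_forall_pos_le_add fun η hη => ?_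
    refine (key (η / (A + 1)) (by positivity)).trans ?_
    rw [mul_div_assoc', div_le_iff₀ (by positivity)]
    nlinarith
  exact sub_eq_zero.1 (abs_nonpos_iff.1 this)

end Uniqueness

/-! ### Weak solutions: integrated form, and push-forwards along characteristics. -/

section WeakSolutions

variable {n : ℕ}

theorem AbsolutelyContinuousOnInterval.of_dist_le {X Y : Type*} [PseudoMetricSpace X]
    [PseudoMetricSpace Y] {F : ℝ → X} {H : ℝ → Y} {a b Λ : ℝ}
    (hF : AbsolutelyContinuousOnInterval F a b) (hΛ : 0 ≤ Λ)
    (h : ∀ s ∈ uIcc a b, ∀ t ∈ uIcc a b, dist (H s) (H t) ≤ Λ * dist (F s) (F t)) :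
    AbsolutelyContinuousOnInterval H a b := by
  rw [absolutelyContinuousOnInterval_iff] at hF ⊢
  intro ε hε
  obtain ⟨δ, hδ, hE⟩ := hF (ε / (Λ + 1)) (by positivity)
  refine ⟨δ, hδ, fun E hEm hlt => ?_⟩
  have h1 := hE E hEm hlt
  rw [lt_div_iff₀ (by positivity)] at h1
  have h2 : ∑ i ∈ Finset.range E.1, dist (H (E.2 i).1) (H (E.2 i).2) ≤
      Λ * ∑ i ∈ Finset.range E.1, dist (F (E.2 i).1) (F (E.2 i).2) := by
    rw [Finset.mul_sum]
    refine Finset.sum_le_sum fun i hi => ?_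
    have := hEm.1 i hi
    exact h _ this.1 _ this.2
  have h3 : 0 ≤ ∑ i ∈ Finset.range E.1, dist (F (E.2 i).1) (F (E.2 i).2) :=
    Finset.sum_nonneg fun _ _ => dist_nonneg
  nlinarith

theorem AbsolutelyContinuousOnInterval.continuousOn_of_metric {X : Type*} [PseudoMetricSpace X]
    {F : ℝ → X} {a b : ℝ} (hF : AbsolutelyContinuousOnInterval F a b) :
    ContinuousOn F (uIcc a b) := by
  rw [absolutelyContinuousOnInterval_iff] at hF
  rw [Metric.continuousOn_iff]
  intro s hs ε hε
  obtain ⟨δ, hδ, hE⟩ := hF ε hε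
  refine ⟨δ, hδ, fun t ht hts => ?_⟩
  have := hE (1, fun _ => (t, s)) ⟨fun i _ => ⟨ht, hs⟩, by simp⟩ (by simpa using hts)
  simpa using this

theorem IsWeakSolution.congr {R : ℝ} (hR : 0 ≤ R) {ϑ : P1 n} {v v' : ℝ → Rn n → Rn n}
    {μ μ' : ℝ → P1 n} (h : IsWeakSolution R ϑ v μ)
    (hv : ∀ᵐ t, t ∈ Icc 0 R → ∀ x, v t x = v' t x) (hμ : ∀ t ∈ Icc 0 R, μ t = μ' t) :
    IsWeakSolution R ϑ v' μ' := by
  refine ⟨AbsolutelyContinuousOnInterval.of_dist_le h.1 zero_le_one fun s hs t ht => ?_, ?_,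
    fun φ h1 h2 h3 => ?_⟩
  · rw [uIcc_of_le hR] at hs ht
    rw [hμ s hs, hμ t ht, one_mul]
  · rw [← hμ 0 ⟨le_rfl, hR⟩, h.2.1]
  · refine Eq.trans ?_ (h.2.2 φ h1 h2 h3)
    refine intervalIntegral.integral_congr_ae (E := ℝ) ?_
    filter_upwards [hv] with t ht hmem
    rw [uIoc_of_le hR] at hmem
    have hm : t ∈ Icc 0 R := ⟨hmem.1.le, hmem.2⟩
    rw [hμ t hm]
    simp only [ht hm]

/-- Testing with products `η t * χ x` says that `q` is the distributional derivative of `H`. As `H`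
is absolutely continuous, `q` is also its derivative almost everywhere, and `H` is recovered by
integration. -/
theorem IsWeakSolution.isIntegratedSolution {R : ℝ} (hR : 0 ≤ R) {ϑ : P1 n}
    {v : ℝ → Rn n → Rn n} {μ : ℝ → P1 n} {K : ℝ} (hv : IsVelocity v K)
    (h : IsWeakSolution R ϑ v μ)
    (hq : ∀ χ : Rn n → ℝ, ContDiff ℝ ∞ χ → HasCompactSupport χ →
      IntervalIntegrable (fun r => ∫ x, fderiv ℝ χ x (v r x) ∂(μ r).toMeasure) volume 0 R) :
    IsIntegratedSolution R v μ := by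
  intro χ hχ hχc
  have hqi := hq χ hχ hχc
  refine ⟨hqi, ?_⟩
  obtain ⟨Λ, hΛ⟩ := hχ.lipschitzWith_of_hasCompactSupport hχc (by simp)
  set H : ℝ → ℝ := fun t => ∫ x, χ x ∂(μ t).toMeasure with hH
  set q : ℝ → ℝ := fun r => ∫ x, fderiv ℝ χ x (v r x) ∂(μ r).toMeasure with hqdef
  have hHac : AbsolutelyContinuousOnInterval H 0 R :=
    AbsolutelyContinuousOnInterval.of_dist_le h.1 Λ.2 fun s _ t _ => by
      rw [Real.dist_eq]
      exact P1.abs_integral_sub_le Λ.2 (fun x y => by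
        simpa [Real.dist_eq, dist_eq_norm] using hΛ.dist_le_mul x y) _ _
  have hDb : ∀ x, ‖fderiv ℝ χ x‖ ≤ Λ := fun x => norm_fderiv_le_of_lipschitz ℝ hΛ
  have hDc : Continuous (fderiv ℝ χ) := hχ.continuous_fderiv (by simp)
  have hvc : ∀ t, Continuous (v t) := fun t =>
    (LipschitzWith.of_dist_le_mul (K := K.toNNReal) fun x y => by
      rw [dist_eq_norm, dist_eq_norm, Real.coe_toNNReal _ hv.nonneg]; exact hv.lip t x y).continuous
  have hqint : ∀ t, Integrable (fun x => fderiv ℝ χ x (v t x)) (μ t).toMeasure := fun t =>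
    Integrable.mono' (integrable_const (Λ * K : ℝ)) (hDc.clm_apply (hvc t)).aestronglyMeasurable
      (ae_of_all _ fun x => ((fderiv ℝ χ x).le_opNorm _).trans
        (mul_le_mul (hDb x) (hv.norm_le t x) (norm_nonneg _) Λ.2))
  have hweak : ∀ η : ℝ → ℝ, ContDiff ℝ ∞ η → HasCompactSupport η → tsupport η ⊆ Ioo 0 R →
      ∫ t in (0 : ℝ)..R, (deriv η t * H t + η t * q t) = 0 := by
    intro η hη hηc hηs
    refine Eq.trans ?_ (h.2.2 (fun t x => η t * χ x) ?_ ?_ ?_)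
    · refine intervalIntegral.integral_congr (E := ℝ) fun t _ => ?_
      have e1 : ∀ x, deriv (fun s => η s * χ x) t = deriv η t * χ x := fun x =>
        deriv_mul_const ((hη.differentiable (by simp)) t) _
      have e2 : ∀ x, fderiv ℝ (fun x => η t * χ x) x = η t • fderiv ℝ χ x := fun x =>
        fderiv_const_mul ((hχ.differentiable (by simp)) x) _
      simp only [e1, e2, _root_.smul_apply, smul_eq_mul]
      rw [integral_add ((P1.integrable_of_lipschitzWith hΛ _).const_mul _)
        ((hqint t).const_mul _), integral_const_mul, integral_const_mul]
    · exact (hη.comp contDiff_fst).mul (hχ.comp contDiff_snd)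
    · refine HasCompactSupport.of_support_subset_isCompact (hηc.isCompact.prod hχc.isCompact) ?_
      intro p hp
      simp only [Function.mem_support, ne_eq, mul_eq_zero, not_or] at hp
      exact ⟨subset_tsupport _ hp.1, subset_tsupport _ hp.2⟩
    · have : tsupport (fun p : ℝ × Rn n => η p.1 * χ p.2) ⊆ tsupport η ×ˢ univ := by
        refine closure_minimal (fun p hp => ?_) ((isClosed_tsupport η).prod isClosed_univ)
        simp only [Function.mem_support, ne_eq, mul_eq_zero, not_or] at hp
        exact ⟨subset_tsupport _ hp.1, mem_univ _⟩
      exact this.trans (prod_mono hηs le_rfl)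
  have hdi := hHac.intervalIntegrable_deriv
  have hIoo : volume.restrict (Ioc 0 R) = volume.restrict (Ioo 0 R) :=
    restrict_Ioo_eq_restrict_Ioc.symm
  -- The fundamental lemma of the calculus of variations, after integrating `deriv η * H` by parts.
  have hae : ∀ᵐ t, t ∈ Ioo 0 R → q t - deriv H t = 0 := by
    refine isOpen_Ioo.ae_eq_zero_of_integral_contDiff_smul_eq_zero ?_ ?_
    · exact (((hqi.sub hdi).1).mono_set Ioo_subset_Ioc_self).locallyIntegrableOn
    · intro η hη hηc hηs
      have hηac : AbsolutelyContinuousOnInterval η 0 R :=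
        ContDiffOn.absolutelyContinuousOnInterval (hη.of_le (by simp)).contDiffOn
      have hz : ∀ t, t ∉ Ioo 0 R → η t = 0 := fun t ht =>
        image_eq_zero_of_notMem_tsupport fun h' => ht (hηs h')
      have hibp := hηac.integral_mul_deriv_eq_deriv_mul hHac
      rw [hz R (by simp), hz 0 (by simp)] at hibp
      have hw := hweak η hη hηc hηs
      have hηcont : Continuous η := hη.continuous
      have hη'cont : Continuous (deriv η) := hη.continuous_deriv (by simp)
      have i1 : IntervalIntegrable (fun t => deriv η t * H t) volume 0 R :=
        (hη'cont.continuousOn.mul hHac.continuousOn).intervalIntegrable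
      have i2 : IntervalIntegrable (fun t => η t * q t) volume 0 R :=
        hqi.continuousOn_mul hηcont.continuousOn
      have i3 : IntervalIntegrable (fun t => η t * deriv H t) volume 0 R :=
        hdi.continuousOn_mul hηcont.continuousOn
      rw [intervalIntegral.integral_add i1 i2] at hw
      have e : ∫ t, η t • (q t - deriv H t) = ∫ t in (0 : ℝ)..R, (η t * q t - η t * deriv H t) := by
        rw [intervalIntegral.integral_of_le hR, hIoo,
          setIntegral_eq_integral_of_forall_compl_eq_zero]
        · simp [mul_sub]
        · intro t ht; simp [hz t ht]
      rw [e, intervalIntegral.integral_sub i2 i3]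
      linarith
  intro s hs t ht
  have hsub : uIcc s t ⊆ uIcc 0 R := by rw [uIcc_of_le hR]; exact uIcc_subset_Icc hs ht
  rw [← (hHac.mono hsub).integral_deriv_eq_sub]
  refine intervalIntegral.integral_congr_ae (E := ℝ) ?_
  have h1 : ∀ᵐ r : ℝ, r ≠ R := by simp [ae_iff, measure_singleton]
  filter_upwards [hae, h1] with r hr hrR hmem
  have hr0 : r ∈ Ioc 0 R := by
    have hm : r ∈ Ioc (min s t) (max s t) := hmem
    exact ⟨(le_min hs.1 ht.1).trans_lt hm.1, hm.2.trans (max_le hs.2 ht.2)⟩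
  have := hr ⟨hr0.1, lt_of_le_of_ne hr0.2 hrR⟩
  exact (sub_eq_zero.1 this).symm

theorem continuous_apply_disp {ξ : ℝ → Disp n} (hξ : Continuous ξ) :
    Continuous fun p : ℝ × Rn n => ξ p.1 p.2 := by
  exact (hξ.comp continuous_fst).eval continuous_snd

/-- The test function has zero total variation along each characteristic. -/
theorem integral_along_characteristic {R : ℝ} (hR : 0 ≤ R) {v : ℝ → Rn n → Rn n} {K : ℝ}
    (hv : IsVelocity v K) {ξ : ℝ → Disp n} (hξ : Continuous ξ)
    (hflow : ∀ t ∈ Icc 0 R, ∀ x, ξ t x = ∫ r in (0 : ℝ)..t, v r (x + ξ r x))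
    {Φ : ℝ × Rn n → ℝ} (hΦ : ContDiff ℝ ∞ Φ) (hc : HasCompactSupport Φ)
    (hs : tsupport Φ ⊆ Ioo 0 R ×ˢ univ) (x : Rn n) :
    ∫ t in (0 : ℝ)..R, fderiv ℝ Φ (t, x + ξ t x) (1, v t (x + ξ t x)) = 0 := by
  set V : ℝ → Rn n := fun r => v r (x + ξ r x) with hV
  have hξx : Continuous fun r => x + ξ r x :=
    continuous_const.add ((continuous_apply_disp hξ).comp (continuous_id.prodMk continuous_const))
  have hVm : AEStronglyMeasurable V volume :=
    (hv.measurable.comp (measurable_id.prodMk hξx.measurable)).aestronglyMeasurable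
  have hVi : ∀ a b, IntervalIntegrable V volume a b :=
    intervalIntegrable_of_norm_le hVm fun r => hv.norm_le r _
  set γ : ℝ → Rn n := fun t => x + ∫ r in (0 : ℝ)..t, V r with hγ
  have hγξ : ∀ t ∈ Icc 0 R, γ t = x + ξ t x := fun t ht => by rw [hγ, hflow t ht x]
  have hγL : ∀ s t, ‖γ t - γ s‖ ≤ K * |t - s| := fun s t => by
    simp only [hγ, add_sub_add_left_eq_sub]
    rw [intervalIntegral.integral_interval_sub_left (hVi _ _) (hVi _ _)]
    exact intervalIntegral.norm_integral_le_of_norm_le_const fun r _ => hv.norm_le r _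
  obtain ⟨Λ, hΛ⟩ := hΦ.lipschitzWith_of_hasCompactSupport hc (by simp)
  -- The integrand is almost everywhere the derivative of the Lipschitz function `t ↦ Φ (t, γ t)`,
  -- which vanishes at both ends of `[0, R]`.
  have hyL : LipschitzOnWith (Λ * (1 + K.toNNReal)) (fun t => Φ (t, γ t)) (uIcc 0 R) := by
    refine LipschitzWith.lipschitzOnWith (LipschitzWith.of_dist_le_mul fun s t => ?_)
    refine (hΛ.dist_le_mul _ _).trans ?_
    push_cast
    rw [mul_assoc]
    refine mul_le_mul_of_nonneg_left ?_ Λ.2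
    rw [Real.coe_toNNReal _ hv.nonneg, Prod.dist_eq]
    have h1 := hγL t s
    rw [← dist_eq_norm, ← Real.dist_eq] at h1
    have h2 : 0 ≤ K * dist s t := mul_nonneg hv.nonneg dist_nonneg
    exact max_le (by simp only; linarith) (by linarith [dist_nonneg (x := s) (y := t)])
  have hac := hyL.absolutelyContinuousOnInterval
  have hz : ∀ t, t ∉ Ioo 0 R → ∀ y, Φ (t, y) = 0 := fun t ht y =>
    image_eq_zero_of_notMem_tsupport fun h' => ht (hs h').1
  have hF := hac.integral_deriv_eq_sub
  rw [hz R (by simp), hz 0 (by simp), sub_zero] at hF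
  refine Eq.trans ?_ hF
  refine intervalIntegral.integral_congr_ae (E := ℝ) ?_
  filter_upwards [(hVi 0 R).ae_hasDerivAt_integral] with t ht hmem
  have htI : t ∈ uIcc 0 R := uIoc_subset_uIcc hmem
  have hd : HasDerivAt γ (V t) t := (ht htI 0 (by simp)).const_add x
  have hd2 : HasDerivAt (fun t => (t, γ t)) (1, V t) t := (hasDerivAt_id t).prodMk hd
  have hd3 := ((hΦ.differentiable (by simp)) (t, γ t)).hasFDerivAt.comp_hasDerivAt t hd2
  rw [uIcc_of_le hR] at htI
  have e := hd3.deriv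
  rw [hγξ t htI] at e
  exact e.symm

/-- The push-forward of `ϑ` under the flow is a weak solution. -/
theorem isWeakSolution_push {R : ℝ} (hR : 0 ≤ R) {v : ℝ → Rn n → Rn n} {K : ℝ}
    (hv : IsVelocity v K) {ξ : ℝ → Disp n} (hξ : Continuous ξ)
    (hflow : ∀ t ∈ Icc 0 R, ∀ x, ξ t x = ∫ r in (0 : ℝ)..t, v r (x + ξ r x)) (ϑ : P1 n) :
    IsWeakSolution R ϑ v fun t => push ϑ (ξ t) := by
  have hξx : Continuous fun p : ℝ × Rn n => p.2 + ξ p.1 p.2 :=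
    continuous_snd.add (continuous_apply_disp hξ)
  refine ⟨?_, ?_, ?_⟩
  · refine LipschitzOnWith.absolutelyContinuousOnInterval (K := K.toNNReal)
      (LipschitzOnWith.of_dist_le_mul fun s hs t ht => ?_)
    rw [uIcc_of_le hR] at hs ht
    rw [Real.coe_toNNReal _ hv.nonneg]
    refine (dist_push_le _ _ _).trans ?_
    rw [BoundedContinuousFunction.norm_le (mul_nonneg hv.nonneg dist_nonneg)]
    intro x
    have hVi : ∀ a b, IntervalIntegrable (fun r => v r (x + ξ r x)) volume a b :=
      intervalIntegrable_of_norm_le (hv.measurable.comp (measurable_id.prodMk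
        (hξx.comp (continuous_id.prodMk continuous_const)).measurable)).aestronglyMeasurable
        fun r => hv.norm_le r _
    rw [BoundedContinuousFunction.sub_apply, hflow s hs, hflow t ht,
      intervalIntegral.integral_interval_sub_left (hVi _ _) (hVi _ _), Real.dist_eq]
    exact intervalIntegral.norm_integral_le_of_norm_le_const fun r _ => hv.norm_le r _
  · have : ξ 0 = 0 := by
      ext1 x
      rw [hflow 0 ⟨le_rfl, hR⟩]
      simp
    simp only [this, push_zero]
  · intro φ hφ hφc hφs
    set Φ : ℝ × Rn n → ℝ := fun p => φ p.1 p.2 with hΦ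
    have hdiff : ∀ p, HasFDerivAt Φ (fderiv ℝ Φ p) p := fun p =>
      ((hφ.differentiable (by simp)) p).hasFDerivAt
    have hDc : Continuous (fderiv ℝ Φ) := hφ.continuous_fderiv (by simp)
    have hpt : ∀ t x, deriv (fun s => φ s x) t + fderiv ℝ (φ t) x (v t x) =
        fderiv ℝ Φ (t, x) (1, v t x) := by
      intro t x
      have h1 : HasDerivAt (fun s => φ s x) (fderiv ℝ Φ (t, x) (1, 0)) t :=
        (hdiff (t, x)).comp_hasDerivAt (f := fun s => (s, x)) t
          ((hasDerivAt_id t).prodMk (hasDerivAt_const t x))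
      have h2 : HasFDerivAt (φ t)
          ((fderiv ℝ Φ (t, x)).comp (ContinuousLinearMap.inr ℝ ℝ (Rn n))) x :=
        (hdiff (t, x)).comp x (hasFDerivAt_prodMk_right t x)
      rw [h1.deriv, h2.fderiv, ContinuousLinearMap.comp_apply, ContinuousLinearMap.inr_apply,
        ← map_add]
      simp
    have hvc : ∀ t, Continuous (v t) := fun t =>
      (LipschitzWith.of_dist_le_mul (K := K.toNNReal) fun x y => by
        rw [dist_eq_norm, dist_eq_norm, Real.coe_toNNReal _ hv.nonneg]
        exact hv.lip t x y).continuous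
    obtain ⟨B, hB⟩ := hDc.bounded_above_of_compact_support (hφc.fderiv ℝ)
    have hB0 : 0 ≤ B := (norm_nonneg _).trans (hB 0)
    have e : ∀ t, ∫ x, (deriv (fun s => φ s x) t + fderiv ℝ (φ t) x (v t x))
        ∂(push ϑ (ξ t)).toMeasure =
        ∫ x, fderiv ℝ Φ (t, x + ξ t x) (1, v t (x + ξ t x)) ∂ϑ.toMeasure := fun t => by
      simp only [hpt]
      exact integral_push ϑ (ξ t) (φ := fun x => fderiv ℝ Φ (t, x) (1, v t x))
        ((hDc.comp (by fun_prop)).clm_apply (continuous_const.prodMk (hvc t)))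
    simp only [e]
    rw [intervalIntegral_integral_swap]
    · simp only [integral_along_characteristic hR hv hξ hflow hφ hφc hφs, integral_zero]
    · have : IsFiniteMeasure (volume.restrict (uIoc 0 R)) := ⟨by simp [uIoc]⟩
      have hm : Measurable (Function.uncurry fun t x =>
          fderiv ℝ Φ (t, x + ξ t x) (1, v t (x + ξ t x))) := by
        have h1 : Continuous fun p : (ℝ × Rn n →L[ℝ] ℝ) × (ℝ × Rn n) => p.1 p.2 := by fun_prop
        refine h1.measurable.comp (Measurable.prodMk ?_ (Measurable.prodMk measurable_const ?_))
        · exact (hDc.comp (continuous_fst.prodMk hξx)).measurable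
        · exact hv.measurable.comp (measurable_fst.prodMk hξx.measurable)
      refine Integrable.mono' (integrable_const (B * (1 + K))) hm.aestronglyMeasurable
        (ae_of_all _ fun p => ?_)
      refine ((fderiv ℝ Φ _).le_opNorm _).trans
        (mul_le_mul (hB _) ?_ (norm_nonneg _) hB0)
      rw [Prod.norm_def]
      have hK := hv.nonneg
      refine max_le (by simp; linarith) ((hv.norm_le _ _).trans (by linarith))

end WeakSolutions

/-! ### Weak solutions of the nonlocal equation are push-forwards along flows. -/

section Representation

variable {n m : ℕ}

/-- `ξ` is the displacement flow of the nonlocal system with control `c` on `[0, R]`. -/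
def FieldData.IsFlow (D : FieldData n m) (ϑ : P1 n) (c : ℝ → Option (Fin m) → ℝ) (R : ℝ)
    (ξ : ℝ → Disp n) : Prop :=
  Continuous ξ ∧ ∀ t ∈ Icc 0 R, ξ t = ∫ r in (0 : ℝ)..t, ∑ j, c r j • D.nonlocal ϑ j (ξ r)

variable (D : FieldData n m)

theorem FieldData.continuous_vec (j : Option (Fin m)) : Continuous fun μ : P1 n => D.vec μ j :=
  (LipschitzWith.of_dist_le_mul (K := D.K.toNNReal) fun μ ν => by
    rw [dist_eq_norm, Real.coe_toNNReal _ D.K_nonneg]; exact D.norm_vec_sub_le μ ν j).continuous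

theorem FieldData.isVelocity {c : ℝ → Option (Fin m) → ℝ} (hc : Measurable c) {κ : ℝ}
    (hκ : ∀ t, ∑ j, |c t j| ≤ κ) {μ : ℝ → P1 n} (hμ : Continuous μ) :
    IsVelocity (fun t x => D.velocity (c t) (μ t) x) (κ * D.K) where
  measurable := by
    change Measurable fun p : ℝ × Rn n => ∑ j, c p.1 j • D.vec (μ p.1) j p.2
    refine Finset.measurable_fun_sum _ fun j _ => ?_
    refine Measurable.smul ((measurable_pi_iff.1 hc j).comp measurable_fst) ?_
    exact ((((D.continuous_vec j).comp hμ).comp continuous_fst).eval continuous_snd).measurable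
  nonneg := mul_nonneg ((Finset.sum_nonneg fun _ _ => abs_nonneg _).trans (hκ 0)) D.K_nonneg
  norm_le t x := norm_sum_smul_le (hκ t)
    (fun j => ((D.vec (μ t) j).norm_coe_le_norm x).trans (D.norm_vec_le _ j)) D.K_nonneg
  lip t x y := by
    rw [mul_assoc]
    exact norm_sum_smul_sub_le (hκ t) (fun j => D.norm_vec_apply_sub_le (μ t) j x y)
      (mul_nonneg D.K_nonneg (norm_nonneg _))

/-- Joint continuity in the measure inside the field and the measure of integration. Along
continuous curves of measures it supplies the measurability in time required by
`IsIntegratedSolution`. -/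
theorem FieldData.continuous_integral_fderiv_vec {χ : Rn n → ℝ} (hχ : ContDiff ℝ ∞ χ)
    (hχc : HasCompactSupport χ) (j : Option (Fin m)) :
    Continuous fun p : P1 n × P1 n => ∫ x, fderiv ℝ χ x (D.vec p.1 j x) ∂p.2.toMeasure := by
  obtain ⟨Λ, hΛ⟩ := hχ.lipschitzWith_of_hasCompactSupport hχc (by simp)
  obtain ⟨Λ', hΛ'⟩ := (hχ.fderiv_right (m := ∞) (by simp)).lipschitzWith_of_hasCompactSupport
    (hχc.fderiv ℝ) (by simp)
  have hK := D.K_nonneg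
  have hDb : ∀ x, ‖fderiv ℝ χ x‖ ≤ Λ := fun x => norm_fderiv_le_of_lipschitz ℝ hΛ
  have hDc : Continuous (fderiv ℝ χ) := hχ.continuous_fderiv (by simp)
  have hb : ∀ (ξ : Disp n) x, ‖fderiv ℝ χ x (ξ x)‖ ≤ Λ * ‖ξ‖ := fun ξ x =>
    ((fderiv ℝ χ x).le_opNorm _).trans
      (mul_le_mul (hDb x) (ξ.norm_coe_le_norm x) (norm_nonneg _) Λ.2)
  have hi : ∀ (ξ : Disp n) (ρ : P1 n), Integrable (fun x => fderiv ℝ χ x (ξ x)) ρ.toMeasure :=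
    fun ξ ρ => Integrable.mono' (integrable_const _)
      (hDc.clm_apply ξ.continuous).aestronglyMeasurable (ae_of_all _ (hb ξ))
  refine (LipschitzWith.of_dist_le_mul (K := (Λ' * D.K + Λ * D.K + Λ * D.K).toNNReal)
    fun p q => ?_).continuous
  rw [Real.dist_eq, Real.coe_toNNReal _ (by positivity)]
  have h1 : |(∫ x, fderiv ℝ χ x (D.vec p.1 j x) ∂p.2.toMeasure) -
      ∫ x, fderiv ℝ χ x (D.vec p.1 j x) ∂q.2.toMeasure| ≤ (Λ' * D.K + Λ * D.K) * dist p q := by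
    refine (P1.abs_integral_sub_le (K := Λ' * D.K + Λ * D.K) (by positivity)
      (fun x y => ?_) _ _).trans (mul_le_mul_of_nonneg_left (le_max_right _ _) (by positivity))
    have e1 : fderiv ℝ χ x (D.vec p.1 j x) - fderiv ℝ χ y (D.vec p.1 j y) =
        (fderiv ℝ χ x - fderiv ℝ χ y) (D.vec p.1 j x) +
          fderiv ℝ χ y (D.vec p.1 j x - D.vec p.1 j y) := by simp
    rw [e1]
    refine (abs_add_le _ _).trans ?_
    have a1 := (fderiv ℝ χ x - fderiv ℝ χ y).le_opNorm (D.vec p.1 j x)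
    have a2 := (fderiv ℝ χ y).le_opNorm (D.vec p.1 j x - D.vec p.1 j y)
    rw [Real.norm_eq_abs] at a1 a2
    have a3 := hΛ'.dist_le_mul x y
    rw [dist_eq_norm, dist_eq_norm] at a3
    have b1 : ‖fderiv ℝ χ x - fderiv ℝ χ y‖ * ‖D.vec p.1 j x‖ ≤ (Λ' * ‖x - y‖) * D.K :=
      mul_le_mul a3 (((D.vec p.1 j).norm_coe_le_norm x).trans (D.norm_vec_le _ j))
        (norm_nonneg _) (by positivity)
    have b2 : ‖fderiv ℝ χ y‖ * ‖D.vec p.1 j x - D.vec p.1 j y‖ ≤ Λ * (D.K * ‖x - y‖) :=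
      mul_le_mul (hDb y) (D.norm_vec_apply_sub_le p.1 j x y) (norm_nonneg _) Λ.2
    linarith
  have h2 : |(∫ x, fderiv ℝ χ x (D.vec p.1 j x) ∂q.2.toMeasure) -
      ∫ x, fderiv ℝ χ x (D.vec q.1 j x) ∂q.2.toMeasure| ≤ Λ * D.K * dist p q := by
    rw [← integral_sub (hi _ _) (hi _ _)]
    have hb2 : ∀ x, ‖fderiv ℝ χ x (D.vec p.1 j x) - fderiv ℝ χ x (D.vec q.1 j x)‖ ≤
        Λ * D.K * dist p q := fun x => by
      have := (hb (D.vec p.1 j - D.vec q.1 j) x).trans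
        (mul_le_mul_of_nonneg_left (D.norm_vec_sub_le p.1 q.1 j) Λ.2)
      rw [BoundedContinuousFunction.sub_apply, map_sub] at this
      have h3 : Λ * (D.K * dist p.1 q.1) ≤ Λ * (D.K * dist p q) := by
        gcongr; exact le_max_left _ _
      linarith
    have := norm_integral_le_of_norm_le_const (μ := q.2.toMeasure) (ae_of_all _ hb2)
    simpa using this
  refine (abs_sub_le _ (∫ x, fderiv ℝ χ x (D.vec p.1 j x) ∂q.2.toMeasure) _).trans ?_
  linarith

theorem FieldData.intervalIntegrable_fderiv_velocity {c : ℝ → Option (Fin m) → ℝ}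
    (hc : Measurable c) {κ : ℝ} (hκ : ∀ t, ∑ j, |c t j| ≤ κ) {μ ν : ℝ → P1 n} (hμ : Continuous μ)
    (hν : Continuous ν)
    {χ : Rn n → ℝ} (hχ : ContDiff ℝ ∞ χ) (hχc : HasCompactSupport χ) (a b : ℝ) :
    IntervalIntegrable (fun r => ∫ x, fderiv ℝ χ x (D.velocity (c r) (μ r) x) ∂(ν r).toMeasure)
      volume a b := by
  have hDc : Continuous (fderiv ℝ χ) := hχ.continuous_fderiv (by simp)
  obtain ⟨B, hB⟩ := hDc.bounded_above_of_compact_support (hχc.fderiv ℝ)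
  have hB0 : 0 ≤ B := (norm_nonneg _).trans (hB 0)
  have hi : ∀ (ξ : Disp n) (ρ : P1 n), Integrable (fun x => fderiv ℝ χ x (ξ x)) ρ.toMeasure :=
    fun ξ ρ => Integrable.mono' (integrable_const (B * ‖ξ‖))
      (hDc.clm_apply ξ.continuous).aestronglyMeasurable (ae_of_all _ fun x =>
        ((fderiv ℝ χ x).le_opNorm _).trans
          (mul_le_mul (hB x) (ξ.norm_coe_le_norm x) (norm_nonneg _) hB0))
  have e : (fun r => ∫ x, fderiv ℝ χ x (D.velocity (c r) (μ r) x) ∂(ν r).toMeasure) =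
      fun r => ∑ j, c r j • ∫ x, fderiv ℝ χ x (D.vec (μ r) j x) ∂(ν r).toMeasure := by
    funext r
    simp only [velocity, map_sum, map_smul]
    rw [integral_finsetSum]
    · simp only [integral_smul]
    · exact fun j _ => (hi _ _).smul (c r j)
  rw [e]
  refine intervalIntegrable_of_norm_le (K := κ * (B * D.K)) ?_ (fun r => ?_) a b
  · refine Finset.aestronglyMeasurable_fun_sum _ fun j _ => ?_
    exact ((measurable_pi_iff.1 hc j).aestronglyMeasurable).smul
      ((D.continuous_integral_fderiv_vec hχ hχc j).comp (hμ.prodMk hν)).aestronglyMeasurable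
  · refine norm_sum_smul_le (hκ r) (fun j => ?_) (mul_nonneg hB0 D.K_nonneg)
    have := norm_integral_le_of_norm_le_const (μ := (ν r).toMeasure)
      (f := fun x => fderiv ℝ χ x (D.vec (μ r) j x)) (C := B * D.K) (ae_of_all _ fun x =>
        ((fderiv ℝ χ x).le_opNorm _).trans (mul_le_mul (hB x)
          (((D.vec (μ r) j).norm_coe_le_norm x).trans (D.norm_vec_le _ j)) (norm_nonneg _) hB0))
    simpa using this

theorem intervalIntegral_apply {h : ℝ → Disp n} {a b : ℝ} (hh : IntervalIntegrable h volume a b)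
    (x : Rn n) : (∫ r in a..b, h r) x = ∫ r in a..b, h r x := by
  have := ContinuousLinearMap.intervalIntegral_comp_comm
    (BoundedContinuousFunction.evalCLM ℝ x : Disp n →L[ℝ] Rn n) hh
  exact this.symm

theorem FieldData.continuous_nonlocal (ϑ : P1 n) (j : Option (Fin m)) :
    Continuous (D.nonlocal ϑ j) :=
  (LipschitzWith.of_dist_le_mul (K := (2 * D.K).toNNReal) fun ξ η => by
    have := D.K_nonneg
    rw [dist_eq_norm, dist_eq_norm, Real.coe_toNNReal _ (by positivity)]
    exact D.norm_nonlocal_sub_le ϑ j ξ η).continuous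

theorem FieldData.sum_lifted_apply (c : Option (Fin m) → ℝ) (μ : P1 n) (ξ : Disp n) (x : Rn n) :
    (∑ j, c j • D.lifted μ j ξ) x = D.velocity c μ (x + ξ x) := by
  simp [velocity]

theorem FieldData.exists_isFlow (ϑ : P1 n) {c : ℝ → Option (Fin m) → ℝ} (hc : Measurable c)
    {κ : ℝ} (hκ : ∀ t, ∑ j, |c t j| ≤ κ) {R : ℝ} (hR : 0 ≤ R) : ∃ ξ, D.IsFlow ϑ c R ξ := by
  have hκ0 : 0 ≤ κ := (Finset.sum_nonneg fun _ _ => abs_nonneg _).trans (hκ 0)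
  have hK := D.K_nonneg
  refine exists_integral_solution (F := fun r ξ => ∑ j, c r j • D.nonlocal ϑ j ξ)
    (K := κ * (2 * D.K)) hR (by positivity) (fun t ξ => ?_) (fun t ξ η => ?_) (fun ξ hξ => ?_)
  · exact norm_sum_smul_le (hκ t) (fun j => D.norm_nonlocal_le ϑ j ξ) (by positivity)
  · rw [mul_assoc]
    exact norm_sum_smul_sub_le (hκ t) (fun j => D.norm_nonlocal_sub_le ϑ j ξ η) (by positivity)
  · exact aestronglyMeasurable_sum_smul hc (D.continuous_nonlocal ϑ) hξ

theorem FieldData.IsFlow.isWeakSolution {D : FieldData n m} {ϑ : P1 n}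
    {c : ℝ → Option (Fin m) → ℝ} (hc : Measurable c) {κ : ℝ} (hκ : ∀ t, ∑ j, |c t j| ≤ κ)
    {R : ℝ} (hR : 0 ≤ R) {ξ : ℝ → Disp n} (h : D.IsFlow ϑ c R ξ) :
    IsWeakSolution R ϑ (fun t x => D.velocity (c t) (push ϑ (ξ t)) x) fun t => push ϑ (ξ t) := by
  have hμ : Continuous fun t => push ϑ (ξ t) := (lipschitzWith_push ϑ).continuous.comp h.1
  refine isWeakSolution_push hR (D.isVelocity hc hκ hμ) h.1 (fun t ht x => ?_) ϑ
  have hi : IntervalIntegrable (fun r => ∑ j, c r j • D.nonlocal ϑ j (ξ r)) volume 0 t :=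
    intervalIntegrable_of_norm_le
      (aestronglyMeasurable_sum_smul hc (D.continuous_nonlocal ϑ) h.1)
      (fun r => norm_sum_smul_le (hκ r) (fun j => D.norm_nonlocal_le ϑ j _)
        (mul_nonneg zero_le_two D.K_nonneg)) _ _
  rw [h.2 t ht, intervalIntegral_apply hi]
  exact intervalIntegral.integral_congr fun r _ => D.sum_lifted_apply _ _ _ _

/-- With the curve `μ` frozen inside the velocity, the equation is linear. The push-forward along
its characteristics solves the same linear equation, hence equals `μ`, so the frozen characteristics
solve the nonlocal equation. -/
theorem FieldData.exists_isFlow_of_isWeakSolution {ϑ : P1 n}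
    {c : ℝ → Option (Fin m) → ℝ} (hc : Measurable c) {κ : ℝ} (hκ : ∀ t, ∑ j, |c t j| ≤ κ)
    {R : ℝ} (hR : 0 ≤ R) {μ : ℝ → P1 n}
    (h : IsWeakSolution R ϑ (fun t x => D.velocity (c t) (μ t) x) μ) :
    ∃ ξ, D.IsFlow ϑ c R ξ ∧ ∀ t ∈ Icc 0 R, μ t = push ϑ (ξ t) := by
  have hκ0 : 0 ≤ κ := (Finset.sum_nonneg fun _ _ => abs_nonneg _).trans (hκ 0)
  have hK := D.K_nonneg
  have hμc : ContinuousOn μ (Icc 0 R) := by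
    have h1 : AbsolutelyContinuousOnInterval μ 0 R := h.1
    have h2 : ContinuousOn μ (uIcc 0 R) := AbsolutelyContinuousOnInterval.continuousOn_of_metric h1
    rwa [uIcc_of_le hR] at h2
  -- Extended by its end values, the curve is continuous on all of `ℝ`, as the global measurability
  -- statements require.
  obtain ⟨ν, hνc, hνμ⟩ : ∃ ν : ℝ → P1 n, Continuous ν ∧ ∀ t ∈ Icc 0 R, ν t = μ t :=
    ⟨IccExtend hR (fun t : Icc 0 R => μ t),
      (continuousOn_iff_continuous_domRestrict.1 hμc).Icc_extend', fun t ht => IccExtend_of_mem hR _ ht⟩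
  have hveq : ∀ t ∈ Icc 0 R, ∀ x, D.velocity (c t) (μ t) x = D.velocity (c t) (ν t) x :=
    fun t ht x => by rw [hνμ t ht]
  have hνw : IsWeakSolution R ϑ (fun t x => D.velocity (c t) (ν t) x) ν :=
    h.congr hR (ae_of_all _ hveq) fun t ht => (hνμ t ht).symm
  have hv := D.isVelocity hc hκ hνc
  have hmeas : ∀ ξ : ℝ → Disp n, Continuous ξ →
      AEStronglyMeasurable (fun r => ∑ j, c r j • D.lifted (ν r) j (ξ r)) volume := fun ξ hξ => by
    refine Finset.aestronglyMeasurable_fun_sum _ fun j _ => ?_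
    exact ((measurable_pi_iff.1 hc j).aestronglyMeasurable).smul
      (D.continuous_lifted hνc hξ j).aestronglyMeasurable
  have hbd : ∀ r (ξ : Disp n), ‖∑ j, c r j • D.lifted (ν r) j ξ‖ ≤ κ * D.K := fun r ξ =>
    norm_sum_smul_le (hκ r) (fun j => D.norm_lifted_le _ j ξ) hK
  obtain ⟨ξ, hξc, hξ⟩ := exists_integral_solution
    (F := fun r ξ => ∑ j, c r j • D.lifted (ν r) j ξ) (K := κ * D.K) hR (by positivity) hbd
    (fun t ξ η => by
      rw [mul_assoc]
      exact norm_sum_smul_sub_le (hκ t) (fun j => by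
        simpa using D.norm_lifted_sub_le (ν t) (ν t) j ξ η) (by positivity)) hmeas
  have hpw : IsWeakSolution R ϑ (fun t x => D.velocity (c t) (ν t) x) fun t => push ϑ (ξ t) := by
    refine isWeakSolution_push hR hv hξc (fun t ht x => ?_) ϑ
    rw [hξ t ht, intervalIntegral_apply
      (intervalIntegrable_of_norm_le (hmeas ξ hξc) (fun r => hbd r _) _ _)]
    exact intervalIntegral.integral_congr fun r _ => D.sum_lifted_apply _ _ _ _
  have hpc : Continuous fun t => push ϑ (ξ t) := (lipschitzWith_push ϑ).continuous.comp hξc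
  have hI1 := hνw.isIntegratedSolution hR hv fun χ hχ hχc =>
    D.intervalIntegrable_fderiv_velocity hc hκ hνc hνc hχ hχc 0 R
  have hI2 := hpw.isIntegratedSolution hR hv fun χ hχ hχc =>
    D.intervalIntegrable_fderiv_velocity hc hκ hνc hpc hχ hχc 0 R
  have heq : ∀ t ∈ Icc 0 R, ν t = push ϑ (ξ t) := by
    intro t ht
    have hsub : uIcc 0 t ⊆ uIcc 0 R := by
      rw [uIcc_of_le hR, uIcc_of_le ht.1]; exact Icc_subset_Icc_right ht.2
    have hmono : ∀ ρ : ℝ → P1 n,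
        IsIntegratedSolution R (fun t x => D.velocity (c t) (ν t) x) ρ →
        IsIntegratedSolution t (fun t x => D.velocity (c t) (ν t) x) ρ := fun ρ hρ χ h1 h2 =>
      ⟨(hρ χ h1 h2).1.mono_set hsub, fun s hs t' ht' =>
        (hρ χ h1 h2).2 s ⟨hs.1, hs.2.trans ht.2⟩ t' ⟨ht'.1, ht'.2.trans ht.2⟩⟩
    refine IsIntegratedSolution.unique ht.1 hv (hmono _ hI1) (hmono _ hI2) hνc.continuousOn
      hpc.continuousOn ?_
    rw [hνw.2.1]
    exact hpw.2.1.symm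
  -- Substituting `push ϑ (ξ r)` for the frozen measure turns `lifted` into `nonlocal`.
  refine ⟨ξ, ⟨hξc, fun t ht => ?_⟩, fun t ht => by rw [← hνμ t ht, heq t ht]⟩
  rw [hξ t ht]
  refine intervalIntegral.integral_congr fun r hr => ?_
  rw [uIcc_of_le ht.1] at hr
  simp only [nonlocal, heq r ⟨hr.1, hr.2.trans ht.2⟩]

end Representation

/-! ### Passage between admissible controls and flows. -/

section Controls

variable {n m : ℕ} (D : FieldData n m) (ϑ : P1 n)

theorem FieldData.velocity_elim (a : ℝ) (b : Fin m → ℝ) (μ : P1 n) (x : Rn n) :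
    D.velocity (fun j => j.elim a b) μ x =
      a • (D.f₀ x + conv D.g μ x) + ∑ i, b i • D.f i x := by
  unfold velocity
  rw [Fintype.sum_option]
  rfl

theorem measurable_elim {a : ℝ → ℝ} {b : ℝ → Fin m → ℝ} (ha : Measurable a) (hb : Measurable b) :
    Measurable fun t (j : Option (Fin m)) => j.elim (a t) (b t) := by
  refine measurable_pi_iff.2 fun j => ?_
  cases j with
  | none => exact ha
  | some i => exact measurable_pi_iff.1 hb i

theorem sum_abs_elim (a : ℝ) (b : Fin m → ℝ) :
    ∑ j : Option (Fin m), |j.elim a b| = |a| + ∑ i, |b i| := by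
  rw [Fintype.sum_option]
  rfl

/-- Every trajectory of the reduced system comes from a flow. -/
theorem FieldData.exists_isFlow_of_mem_reducedTrajectories {T M : ℝ} (hT : 0 < T) (hM : 0 < M)
    {ν : ℝ → P1 n}
    (hν : ν ∈ reducedTrajectories T M D.f₀ (fun i => D.f i) D.g ϑ) :
    ∃ c : ℝ → Option (Fin m) → ℝ, Measurable c ∧ (∀ t, 0 ≤ c t none) ∧ (∀ t, ∑ j, |c t j| ≤ 1) ∧
      ∫ t in (0 : ℝ)..(T + M), c t none = T ∧
      ∃ ξ, D.IsFlow ϑ c (T + M) ξ ∧ ∀ t ∈ Icc 0 (T + M), ν t = push ϑ (ξ t) := by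
  obtain ⟨α, β, ⟨hα, hβ, hae, hint⟩, hw⟩ := hν
  have hS : 0 ≤ T + M := by positivity
  -- Setting the control to zero off the set where its constraints hold changes it only on a null
  -- subset of the interval and makes the bounds valid at every time.
  set A : Set ℝ := {s | 0 ≤ α s ∧ α s + ∑ j, |β s j| ≤ 1} with hA
  have hAm : MeasurableSet A := by
    have h1 : MeasurableSet {s | 0 ≤ α s} := measurableSet_le measurable_const hα
    have h2 : MeasurableSet {s | α s + ∑ j, |β s j| ≤ 1} :=
      measurableSet_le (hα.add (Finset.measurable_fun_sum _ fun j _ =>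
        continuous_abs.measurable.comp (measurable_pi_iff.1 hβ j))) measurable_const
    exact h1.inter h2
  let α' := A.indicator α
  let β' := A.indicator β
  let c : ℝ → Option (Fin m) → ℝ := fun t j => j.elim (α' t) (β' t)
  have hc : Measurable c := measurable_elim (hα.indicator hAm) (hβ.indicator hAm)
  have hae' : ∀ᵐ s, s ∈ Icc 0 (T + M) → s ∈ A := (ae_restrict_iff' measurableSet_Icc).1 hae
  have hc0 : ∀ t, 0 ≤ c t none := fun t => indicator_nonneg (fun s hs => hs.1) t
  have hc1 : ∀ t, ∑ j, |c t j| ≤ 1 := fun t => by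
    simp only [c]
    rw [sum_abs_elim]
    by_cases ht : t ∈ A
    · simp only [α', β', indicator_of_mem ht, abs_of_nonneg ht.1]
      exact ht.2
    · simp [α', β', indicator_of_notMem ht]
  refine ⟨c, hc, hc0, hc1, ?_, ?_⟩
  · refine Eq.trans ?_ hint
    refine intervalIntegral.integral_congr_ae (E := ℝ) ?_
    filter_upwards [hae'] with t ht hmem
    rw [uIoc_of_le hS] at hmem
    exact indicator_of_mem (ht ⟨hmem.1.le, hmem.2⟩) _
  · refine D.exists_isFlow_of_isWeakSolution hc hc1 hS (hw.congr hS ?_ fun _ _ => rfl)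
    filter_upwards [hae'] with t ht hmem x
    simp only [c]
    rw [D.velocity_elim]
    simp only [α', β', indicator_of_mem (ht hmem)]

theorem FieldData.mem_reducedTrajectories_of_isFlow {T M : ℝ} (hT : 0 < T) (hM : 0 < M)
    {c : ℝ → Option (Fin m) → ℝ} (hc : Measurable c) (hc0 : ∀ t, 0 ≤ c t none)
    (hc1 : ∀ t, ∑ j, |c t j| ≤ 1) (hcT : ∫ t in (0 : ℝ)..(T + M), c t none = T)
    {ξ : ℝ → Disp n} (hξ : D.IsFlow ϑ c (T + M) ξ) :
    (fun t => push ϑ (ξ t)) ∈ reducedTrajectories T M D.f₀ (fun i => D.f i) D.g ϑ := by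
  have hS : 0 ≤ T + M := by positivity
  refine ⟨fun t => c t none, fun t i => c t (some i), ⟨measurable_pi_iff.1 hc none,
    measurable_pi_iff.2 fun i => measurable_pi_iff.1 hc (some i), ae_of_all _ fun t => ⟨hc0 t, ?_⟩,
    hcT⟩, ?_⟩
  · have := hc1 t
    rw [Fintype.sum_option, abs_of_nonneg (hc0 t)] at this
    exact this
  · refine (hξ.isWeakSolution hc hc1 hS).congr hS (ae_of_all _ fun t _ x => ?_) fun _ _ => rfl
    unfold velocity
    rw [Fintype.sum_option]
    rfl

/-- Every trajectory of the original system comes from a flow. -/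
theorem FieldData.exists_isFlow_of_mem_trajectories {T M : ℝ} (hT : 0 < T) {μ : ℝ → P1 n}
    (hμ : μ ∈ trajectories T M D.f₀ (fun i => D.f i) D.g ϑ) :
    ∃ (u : ℝ → Fin m → ℝ) (κ : ℝ), Measurable u ∧ (∀ t, ∑ i, |u t i| ≤ κ) ∧
      ∫ t in (0 : ℝ)..T, ∑ i, |u t i| = M ∧
      ∃ ξ, D.IsFlow ϑ (fun t j => j.elim 1 (u t)) T ξ ∧ ∀ t ∈ Icc 0 T, μ t = push ϑ (ξ t) := by
  obtain ⟨u, ⟨hu, ⟨K, hK⟩, hint⟩, hw⟩ := hμ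
  set A : Set ℝ := {s | ∀ i, |u s i| ≤ K} with hA
  have hAm : MeasurableSet A := by
    rw [hA, ofPred_forall]
    exact MeasurableSet.iInter fun i =>
      measurableSet_le (continuous_abs.measurable.comp (measurable_pi_iff.1 hu i)) measurable_const
  let u' := A.indicator u
  have hu' : Measurable u' := hu.indicator hAm
  have hae : ∀ᵐ s, s ∈ Icc 0 T → s ∈ A := (ae_restrict_iff' measurableSet_Icc).1 hK
  have hb : ∀ t, ∑ i, |u' t i| ≤ m * |K| := fun t => by
    by_cases ht : t ∈ A
    · simp only [u', indicator_of_mem ht]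
      refine (Finset.sum_le_sum fun i _ => (ht i).trans (le_abs_self K)).trans ?_
      simp
    · simp only [u', indicator_of_notMem ht, Pi.zero_apply, abs_zero, Finset.sum_const_zero]
      positivity
  refine ⟨u', m * |K|, hu', hb, ?_, ?_⟩
  · rw [← hint]
    refine intervalIntegral.integral_congr_ae (E := ℝ) ?_
    filter_upwards [hae] with t ht hmem
    rw [uIoc_of_le hT.le] at hmem
    simp only [u', indicator_of_mem (ht ⟨hmem.1.le, hmem.2⟩)]
  · refine D.exists_isFlow_of_isWeakSolution (κ := 1 + m * |K|)
      (measurable_elim measurable_const hu') (fun t => ?_) hT.le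
      (hw.congr hT.le ?_ fun _ _ => rfl)
    · rw [sum_abs_elim, abs_one]
      linarith [hb t]
    · filter_upwards [hae] with t ht hmem x
      rw [D.velocity_elim]
      simp only [u', indicator_of_mem (ht hmem), one_smul]
      abel

theorem FieldData.mem_trajectories_of_isFlow {T M : ℝ} (hT : 0 < T) {u : ℝ → Fin m → ℝ}
    (hu : Measurable u) {κ : ℝ} (hκ : ∀ t, ∑ i, |u t i| ≤ κ)
    (hint : ∫ t in (0 : ℝ)..T, ∑ i, |u t i| = M) {ξ : ℝ → Disp n}
    (hξ : D.IsFlow ϑ (fun t j => j.elim 1 (u t)) T ξ) :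
    (fun t => push ϑ (ξ t)) ∈ trajectories T M D.f₀ (fun i => D.f i) D.g ϑ := by
  refine ⟨u, ⟨hu, ⟨κ, ae_of_all _ fun t i => ?_⟩, hint⟩, ?_⟩
  · exact (Finset.single_le_sum (f := fun i => |u t i|) (fun _ _ => abs_nonneg _)
      (Finset.mem_univ i)).trans (hκ t)
  · refine (hξ.isWeakSolution (measurable_elim measurable_const hu) (κ := 1 + κ) (fun t => ?_)
      hT.le).congr hT.le (ae_of_all _ fun t _ x => ?_) fun _ _ => rfl
    · rw [sum_abs_elim, abs_one]
      linarith [hκ t]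
    · rw [D.velocity_elim, one_smul]
      abel

end Controls

/-! ### Driving paths and the compactness of reduced paths. -/

section Paths

variable {n m : ℕ} (D : FieldData n m) (ϑ : P1 n)

/-- The primitive of a control. -/
def primitive {ι : Type*} (c : ℝ → ι → ℝ) (t : ℝ) (j : ι) : ℝ := ∫ r in (0 : ℝ)..t, c r j

theorem sum_abs_primitive_sub_le_integral {ι : Type*} [Fintype ι] {c : ℝ → ι → ℝ}
    (hc : Measurable c) {κ : ℝ} (hκ : ∀ t, ∑ j, |c t j| ≤ κ) {s t : ℝ} (hst : s ≤ t) :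
    ∑ j, |primitive c t j - primitive c s j| ≤ ∫ r in s..t, ∑ j, |c r j| := by
  have hi := intervalIntegrable_coord hc hκ
  rw [intervalIntegral.integral_finsetSum fun j _ => (hi j s t).abs]
  refine Finset.sum_le_sum fun j _ => ?_
  unfold primitive
  rw [intervalIntegral.integral_interval_sub_left (hi j _ _) (hi j _ _)]
  exact intervalIntegral.abs_integral_le_integral_abs hst

theorem intervalIntegrable_sum_abs {ι : Type*} [Fintype ι] {c : ℝ → ι → ℝ}
    (hc : Measurable c) {κ : ℝ} (hκ : ∀ t, ∑ j, |c t j| ≤ κ) (s t : ℝ) :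
    IntervalIntegrable (fun r => ∑ j, |c r j|) volume s t := by
  simpa only [Finset.sum_fn] using IntervalIntegrable.sum Finset.univ
    fun j _ => (intervalIntegrable_coord hc hκ j s t).abs

theorem sum_abs_primitive_sub_le {ι : Type*} [Fintype ι] {c : ℝ → ι → ℝ} (hc : Measurable c)
    {κ : ℝ} (hκ : ∀ t, ∑ j, |c t j| ≤ κ) (s t : ℝ) :
    ∑ j, |primitive c t j - primitive c s j| ≤ κ * |t - s| := by
  have h1 : ∀ s t, s ≤ t → ∑ j, |primitive c t j - primitive c s j| ≤ κ * |t - s| := by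
    intro s t hst
    refine (sum_abs_primitive_sub_le_integral hc hκ hst).trans ?_
    refine (intervalIntegral.integral_mono_on hst (intervalIntegrable_sum_abs hc hκ s t)
      intervalIntegrable_const fun r _ => hκ r).trans (le_of_eq ?_)
    rw [intervalIntegral.integral_const, abs_of_nonneg (sub_nonneg.2 hst), smul_eq_mul, mul_comm]
  rcases le_total s t with h | h
  · exact h1 s t h
  · have := h1 t s h
    rw [abs_sub_comm t s]
    simpa [abs_sub_comm] using this

theorem FieldData.IsFlow.driven {D : FieldData n m} {ϑ : P1 n} {c : ℝ → Option (Fin m) → ℝ}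
    (hc : Measurable c) {κ : ℝ} (hκ : ∀ t, ∑ j, |c t j| ≤ κ) {R : ℝ} {ξ : ℝ → Disp n}
    (h : D.IsFlow ϑ c R ξ) :
    Driven (D.nonlocal ϑ) (primitive c) ξ 0 R (κ * (2 * D.K * (κ * (2 * D.K)))) :=
  driven_of_integral_solution hc hκ (D.norm_nonlocal_le ϑ) (D.norm_nonlocal_sub_le ϑ)
    (mul_nonneg zero_le_two D.K_nonneg) h.1 h.2

theorem FieldData.IsFlow.zero {D : FieldData n m} {ϑ : P1 n} {c : ℝ → Option (Fin m) → ℝ} {R : ℝ}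
    (hR : 0 ≤ R) {ξ : ℝ → Disp n} (h : D.IsFlow ϑ c R ξ) : ξ 0 = 0 := by
  rw [h.2 0 ⟨le_rfl, hR⟩, intervalIntegral.integral_same]

/-- The control associated with a Lipschitz path. -/
def pathControl {ι : Type*} (P : ℝ → ι → ℝ) (t : ℝ) (j : ι) : ℝ := deriv (fun s => P s j) t

theorem measurable_pathControl {ι : Type*} [Fintype ι] (P : ℝ → ι → ℝ) :
    Measurable (pathControl P) :=
  measurable_pi_iff.2 fun _ => measurable_deriv _

/-- The bound holds at every time, not just almost everywhere: coordinates without a derivative have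
derivative `0` by convention, and the remaining ones are limits of slopes. -/
theorem sum_abs_pathControl_le {ι : Type*} [Fintype ι] {P : ℝ → ι → ℝ} {κ : ℝ}
    (hP : ∀ s t, ∑ j, |P t j - P s j| ≤ κ * |t - s|) (t : ℝ) :
    ∑ j, |pathControl P t j| ≤ κ := by
  classical
  let a : ι → ℝ → ℝ := fun j s =>
    if DifferentiableAt ℝ (fun s => P s j) t then slope (fun s => P s j) t s else 0
  have ha : ∀ j, Tendsto (a j) (𝓝[≠] t) (𝓝 (pathControl P t j)) := fun j => by
    by_cases hj : DifferentiableAt ℝ (fun s => P s j) t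
    · simp only [a, if_pos hj]
      exact hasDerivAt_iff_tendsto_slope.1 hj.hasDerivAt
    · simp only [a, if_neg hj, pathControl, deriv_zero_of_not_differentiableAt hj]
      exact tendsto_const_nhds
  have hlim : Tendsto (fun s => ∑ j, |a j s|) (𝓝[≠] t) (𝓝 (∑ j, |pathControl P t j|)) :=
    tendsto_finsetSum _ fun j _ => (ha j).abs
  refine le_of_tendsto hlim ?_
  filter_upwards [self_mem_nhdsWithin] with s hs
  have hst : 0 < |s - t| := abs_pos.2 (sub_ne_zero.2 hs)
  have h1 : ∑ j, |a j s| ≤ ∑ j, |P s j - P t j| / |s - t| := by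
    refine Finset.sum_le_sum fun j _ => ?_
    by_cases hj : DifferentiableAt ℝ (fun s => P s j) t
    · simp only [a, if_pos hj]
      rw [slope_def_field, abs_div]
    · simp only [a, if_neg hj, abs_zero]
      positivity
  refine h1.trans ?_
  rw [← Finset.sum_div, div_le_iff₀ hst]
  exact hP t s

theorem primitive_pathControl {ι : Type*} [Fintype ι] {P : ℝ → ι → ℝ} {κ : ℝ}
    (hP : ∀ s t, ∑ j, |P t j - P s j| ≤ κ * |t - s|) (t : ℝ) (j : ι) :
    primitive (pathControl P) t j = P t j - P 0 j := by
  have hL : LipschitzWith κ.toNNReal fun s => P s j := LipschitzWith.of_dist_le' fun s t => by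
    rw [Real.dist_eq, Real.dist_eq]
    exact (Finset.single_le_sum (f := fun j => |P s j - P t j|) (fun _ _ => abs_nonneg _)
      (Finset.mem_univ j)).trans (hP t s)
  exact (hL.lipschitzOnWith (s := uIcc 0 t)).absolutelyContinuousOnInterval.integral_deriv_eq_sub

/-- The primitives of the admissible controls of the reduced system. -/
def reducedPaths (m : ℕ) (T S : ℝ) : Set (ℝ → Option (Fin m) → ℝ) :=
  {P | (∀ j, P 0 j = 0) ∧ (∀ s t, s ≤ t → P s none ≤ P t none) ∧
    (∀ s t, ∑ j, |P t j - P s j| ≤ 1 * |t - s|) ∧ P S none = T}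

/-- The topology is that of pointwise convergence. All conditions are closed conditions on finitely
many values at a time, and the paths lie in a product of compact intervals, so Tychonoff's theorem
applies; no uniform convergence is needed because `Driven.tendsto` asks for none. -/
theorem isCompact_reducedPaths (T S : ℝ) : IsCompact (reducedPaths m T S) := by
  have hbox : IsCompact (univ.pi fun s : ℝ => univ.pi fun _ : Option (Fin m) =>
      Icc (-|s|) |s|) :=
    isCompact_univ_pi fun s => isCompact_univ_pi fun _ => isCompact_Icc
  refine hbox.of_isClosed_subset ?_ ?_
  · have hev : ∀ s j, Continuous fun P : ℝ → Option (Fin m) → ℝ => P s j := fun s j =>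
      (continuous_apply j).comp (continuous_apply s)
    simp only [reducedPaths, ofPred_and, ofPred_forall]
    refine IsClosed.inter ?_ (IsClosed.inter ?_ (IsClosed.inter ?_ ?_))
    · exact isClosed_iInter fun j => isClosed_eq (hev 0 j) continuous_const
    · exact isClosed_iInter fun s => isClosed_iInter fun t => isClosed_iInter fun _ =>
        isClosed_le (hev s none) (hev t none)
    · exact isClosed_iInter fun s => isClosed_iInter fun t =>
        isClosed_le (continuous_finsetSum _ fun j _ => ((hev t j).sub (hev s j)).abs)
          continuous_const
    · exact isClosed_eq (hev S none) continuous_const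
  · intro P hP s _ j _
    have h1 := (Finset.single_le_sum (f := fun j => |P s j - P 0 j|) (fun _ _ => abs_nonneg _)
      (Finset.mem_univ j)).trans (hP.2.2.1 0 s)
    simp only [hP.1 j, sub_zero, one_mul] at h1
    exact abs_le.1 h1

theorem nonempty_reducedPaths {T M : ℝ} (hT : 0 < T) (hM : 0 < M) :
    (reducedPaths m T (T + M)).Nonempty := by
  refine ⟨fun s j => j.elim (T / (T + M) * s) fun _ => 0, fun j => ?_, fun s t hst => ?_,
    fun s t => ?_, ?_⟩
  · cases j <;> simp
  · exact mul_le_mul_of_nonneg_left hst (by positivity)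
  · rw [Fintype.sum_option]
    have h1 : T / (T + M) ≤ 1 := (div_le_one (by positivity)).2 (by linarith)
    have h2 : 0 ≤ T / (T + M) := by positivity
    simp only [Option.elim_none, Option.elim_some, sub_self, abs_zero, Finset.sum_const_zero,
      add_zero]
    rw [← mul_sub, abs_mul, abs_of_nonneg h2]
    exact mul_le_mul_of_nonneg_right h1 (abs_nonneg _)
  · simp only [Option.elim_none]
    field_simp

theorem primitive_mem_reducedPaths {T S : ℝ} {c : ℝ → Option (Fin m) → ℝ} (hc : Measurable c)
    (hc0 : ∀ t, 0 ≤ c t none) (hc1 : ∀ t, ∑ j, |c t j| ≤ 1)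
    (hcT : ∫ t in (0 : ℝ)..S, c t none = T) : primitive c ∈ reducedPaths m T S := by
  refine ⟨fun j => by simp [primitive], fun s t hst => ?_, sum_abs_primitive_sub_le hc hc1, hcT⟩
  have hi := intervalIntegrable_coord hc hc1 none
  rw [← sub_nonneg]
  unfold primitive
  rw [intervalIntegral.integral_interval_sub_left (hi _ _) (hi _ _)]
  exact intervalIntegral.integral_nonneg hst fun r _ => hc0 r

theorem FieldData.exists_isFlow_pathControl {P : ℝ → Option (Fin m) → ℝ} {κ : ℝ}
    (hP : ∀ s t, ∑ j, |P t j - P s j| ≤ κ * |t - s|) (hP0 : ∀ j, P 0 j = 0) {R : ℝ} (hR : 0 ≤ R) :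
    ∃ ξ, D.IsFlow ϑ (pathControl P) R ξ ∧
      Driven (D.nonlocal ϑ) P ξ 0 R (κ * (2 * D.K * (κ * (2 * D.K)))) := by
  have hc := measurable_pathControl P
  have hκ := sum_abs_pathControl_le hP
  obtain ⟨ξ, hξ⟩ := D.exists_isFlow ϑ hc hκ hR
  refine ⟨ξ, hξ, ?_⟩
  have := hξ.driven hc hκ
  rwa [show primitive (pathControl P) = P by
    funext t j; rw [primitive_pathControl hP, hP0, sub_zero]] at this

theorem FieldData.mem_reducedTrajectories_of_path {T M : ℝ} (hT : 0 < T) (hM : 0 < M)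
    {P : ℝ → Option (Fin m) → ℝ} (hP : P ∈ reducedPaths m T (T + M)) {ξ : ℝ → Disp n}
    (hξ : D.IsFlow ϑ (pathControl P) (T + M) ξ) :
    (fun t => push ϑ (ξ t)) ∈ reducedTrajectories T M D.f₀ (fun i => D.f i) D.g ϑ := by
  refine D.mem_reducedTrajectories_of_isFlow ϑ hT hM (measurable_pathControl P) (fun t => ?_)
    (sum_abs_pathControl_le hP.2.2.1) ?_ hξ
  · exact Monotone.deriv_nonneg fun s t hst => hP.2.1 s t hst
  · have := primitive_pathControl hP.2.2.1 (T + M) none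
    rw [hP.1, sub_zero, hP.2.2.2] at this
    exact this

/-- The displacement fields driven by the paths in `reducedPaths`. -/
theorem FieldData.exists_continuous_endpoint {T S : ℝ} (hS : 0 ≤ S) :
    ∃ Ξ : reducedPaths m T S → ℝ → Disp n,
      (∀ P, D.IsFlow ϑ (pathControl P.1) S (Ξ P)) ∧
      (∀ P, Driven (D.nonlocal ϑ) P.1 (Ξ P) 0 S (1 * (2 * D.K * (1 * (2 * D.K))))) ∧
      Continuous fun P => Ξ P S := by
  have hK := D.K_nonneg
  choose Ξ h1 h2 using fun P : reducedPaths m T S =>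
    D.exists_isFlow_pathControl ϑ P.2.2.2.1 P.2.1 hS
  refine ⟨Ξ, h1, h2, continuous_iff_continuousAt.2 fun P => ?_⟩
  refine Driven.tendsto (Q := fun P : reducedPaths m T S => P.1) (η := Ξ) hS (h2 P)
    (fun Q => h2 Q) (D.norm_nonlocal_le ϑ) (D.norm_nonlocal_sub_le ϑ) (by positivity) zero_le_one
    (by positivity) (by positivity) P.2.2.2.1
    (fun Q => by rw [(h1 Q).zero hS, (h1 P).zero hS]) fun t _ j => ?_
  exact ((continuous_apply j).comp ((continuous_apply t).comp continuous_subtype_val)).tendsto P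

end Paths

/-! ### From the original system to the reduced one. -/

section TimeChange

variable {n m : ℕ} (D : FieldData n m) (ϑ : P1 n)

/-- A continuous function with slope bounded below has a Lipschitz inverse. -/
theorem exists_inverse_of_slope_ge {τ : ℝ → ℝ} (hc : Continuous τ) {lam : ℝ} (hlam : 0 < lam)
    (hτ : ∀ s t, s ≤ t → lam * (t - s) ≤ τ t - τ s) :
    ∃ A : ℝ → ℝ, (∀ s, τ (A s) = s) ∧ (∀ t, A (τ t) = t) ∧ StrictMono A ∧
      ∀ s t, |A t - A s| ≤ lam⁻¹ * |t - s| := by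
  have hmono : StrictMono τ := fun s t hst => by
    have := hτ s t hst.le
    have h2 : 0 < lam * (t - s) := mul_pos hlam (sub_pos.2 hst)
    linarith
  have hsurj : Function.Surjective τ := by
    refine hc.surjective ?_ ?_
    · refine tendsto_atTop_mono' _ (f₁ := fun t => lam * t + τ 0) ?_ ?_
      · filter_upwards [eventually_ge_atTop 0] with t ht
        have := hτ 0 t ht
        linarith
      · exact tendsto_atTop_add_const_right _ _ (tendsto_id.const_mul_atTop hlam)
    · refine tendsto_atBot_mono' _ (f₁ := fun t => lam * t + τ 0) ?_ ?_
      · filter_upwards [eventually_le_atBot 0] with t ht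
        have := hτ t 0 ht
        linarith
      · exact tendsto_atBot_add_const_right _ _ (tendsto_id.const_mul_atBot hlam)
  let e := hmono.orderIsoOfSurjective τ hsurj
  have h1 : ∀ s, τ (e.symm s) = s := fun s => e.apply_symm_apply s
  have h2 : ∀ s t, s ≤ t → |e.symm t - e.symm s| ≤ lam⁻¹ * |t - s| := fun s t hst => by
    have hle : e.symm s ≤ e.symm t := e.symm.monotone hst
    have := hτ _ _ hle
    rw [h1, h1] at this
    rw [abs_of_nonneg (sub_nonneg.2 hle), abs_of_nonneg (sub_nonneg.2 hst), le_inv_mul_iff₀ hlam]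
    exact this
  refine ⟨e.symm, h1, fun t => e.symm_apply_apply t, e.symm.strictMono, fun s t => ?_⟩
  rcases le_total s t with h | h
  · exact h2 s t h
  · rw [abs_sub_comm, abs_sub_comm t s]
    exact h2 t s h

theorem primitive_elim_one_none (u : ℝ → Fin m → ℝ) (t : ℝ) :
    primitive (fun t (j : Option (Fin m)) => j.elim 1 (u t)) t none = t := by
  simp [primitive]

/-- The time change `s = t + ∫₀ᵗ |u|` maps trajectories of the original system to trajectories of
the reduced one. -/
theorem FieldData.exists_reduced_of_isFlow {T M : ℝ} (hT : 0 < T) (hM : 0 < M)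
    {u : ℝ → Fin m → ℝ} (hu : Measurable u) {κ : ℝ} (hκ : ∀ t, ∑ i, |u t i| ≤ κ)
    (hint : ∫ t in (0 : ℝ)..T, ∑ i, |u t i| = M) {ξ : ℝ → Disp n}
    (hξ : D.IsFlow ϑ (fun t j => j.elim 1 (u t)) T ξ) :
    ∃ P ∈ reducedPaths m T (T + M), ∀ (ζ : ℝ → Disp n) (C : ℝ), 0 ≤ C → ζ 0 = 0 →
      Driven (D.nonlocal ϑ) P ζ 0 (T + M) C → ζ (T + M) = ξ T := by
  have hK := D.K_nonneg
  have hκ0 : 0 ≤ κ := (Finset.sum_nonneg fun _ _ => abs_nonneg _).trans (hκ 0)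
  set c : ℝ → Option (Fin m) → ℝ := fun t j => j.elim 1 (u t) with hcdef
  have hc : Measurable c := measurable_elim measurable_const hu
  have hsum : ∀ t, ∑ j, |c t j| = 1 + ∑ i, |u t i| := fun t => by
    rw [hcdef]; simp only [sum_abs_elim, abs_one]
  have hcκ : ∀ t, ∑ j, |c t j| ≤ 1 + κ := fun t => by rw [hsum]; linarith [hκ t]
  have hi := intervalIntegrable_sum_abs hc hcκ
  -- The new time is the `ℓ¹` arc length of the path whose drift coordinate is `t`. Its slope is at
  -- least one, so its inverse is 1-Lipschitz; and the path parametrized by arc length satisfies the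
  -- Lipschitz condition in `reducedPaths`.
  let τ : ℝ → ℝ := fun t => ∫ r in (0 : ℝ)..t, ∑ j, |c r j|
  have hτsub : ∀ s t, τ t - τ s = ∫ r in s..t, ∑ j, |c r j| := fun s t =>
    intervalIntegral.integral_interval_sub_left (hi _ _) (hi _ _)
  have hslope : ∀ s t, s ≤ t → 1 * (t - s) ≤ τ t - τ s := fun s t hst => by
    rw [hτsub]
    have := intervalIntegral.integral_mono_on hst (intervalIntegrable_const (c := (1 : ℝ)))
      (hi s t) fun r _ => by
        rw [hsum]
        linarith [Finset.sum_nonneg fun (i : Fin m) (_ : i ∈ Finset.univ) => abs_nonneg (u r i)]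
    simpa using this
  obtain ⟨A, hA1, hA2, hAm, hAL⟩ := exists_inverse_of_slope_ge
    (intervalIntegral.continuous_primitive hi 0) one_pos hslope
  have hτ0 : τ 0 = 0 := intervalIntegral.integral_same
  have hτT : τ T = T + M := by
    simp only [τ, hsum]
    rw [intervalIntegral.integral_add intervalIntegrable_const
      (intervalIntegrable_sum_abs hu hκ 0 T), hint]
    simp
  have hA0 : A 0 = 0 := by
    have := hA2 0
    rwa [intervalIntegral.integral_same] at this
  have hAS : A (T + M) = T := by
    have := hA2 T
    rwa [show (∫ r in (0 : ℝ)..T, ∑ j, |c r j|) = T + M from hτT] at this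
  have hP : primitive c ∘ A ∈ reducedPaths m T (T + M) := by
    refine ⟨fun j => ?_, fun s t hst => ?_, fun s t => ?_, ?_⟩
    · simp [hA0, primitive]
    · simp only [Function.comp_apply]
      rw [primitive_elim_one_none, primitive_elim_one_none]
      exact hAm.monotone hst
    · have key : ∀ s t, s ≤ t →
          ∑ j, |(primitive c ∘ A) t j - (primitive c ∘ A) s j| ≤ t - s := fun s t hst => by
        refine (sum_abs_primitive_sub_le_integral hc hcκ (hAm.monotone hst)).trans ?_
        rw [← hτsub]
        exact (congrArg₂ (· - ·) (hA1 t) (hA1 s)).le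
      rw [one_mul]
      rcases le_total s t with h | h
      · rw [abs_of_nonneg (sub_nonneg.2 h)]
        exact key s t h
      · rw [abs_sub_comm, abs_of_nonneg (sub_nonneg.2 h)]
        simpa only [abs_sub_comm] using key t s h
    · simp only [Function.comp_apply]
      rw [primitive_elim_one_none, hAS]
  refine ⟨_, hP, fun ζ C hC hζ0 hζ => ?_⟩
  have hdr := (hξ.driven hc hcκ).comp (by positivity) (θ := A) (a' := 0) (b' := T + M)
    (Λ := 1⁻¹) (fun s hs => ⟨by rw [← hA0]; exact hAm.monotone hs.1,
      by rw [← hAS]; exact hAm.monotone hs.2⟩) fun s _ t _ => hAL s t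
  have := hdr.unique hζ (D.norm_nonlocal_le ϑ) (D.norm_nonlocal_sub_le ϑ) (by positivity)
    zero_le_one (by positivity) hC hP.2.2.1
    (by rw [hζ0, Function.comp_apply, hA0, hξ.zero hT.le]) (t := T + M)
    ⟨by positivity, le_rfl⟩
  rw [this, Function.comp_apply, hAS]

end TimeChange

/-! ### Using up the remaining variation by a loop. -/

section Extension

variable {n m : ℕ} (D : FieldData n m) (ϑ : P1 n)

theorem integral_indicator_Ioc {a b t : ℝ} (ha : 0 ≤ a) (ht : 0 ≤ t) (φ : ℝ → ℝ) :
    ∫ r in (0 : ℝ)..t, (Ioc a b).indicator φ r = ∫ r in Ioc a (min t b), φ r := by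
  rw [intervalIntegral.integral_of_le ht, setIntegral_indicator measurableSet_Ioc, Ioc_inter_Ioc,
    sup_eq_right.2 ha]

theorem integral_indicator_Ioc_one {a b t : ℝ} (ha : 0 ≤ a) (ht : 0 ≤ t) :
    ∫ r in (0 : ℝ)..t, (Ioc a b).indicator (fun _ => (1 : ℝ)) r = max (min t b - a) 0 := by
  rw [integral_indicator_Ioc ha ht, setIntegral_const, Real.volume_real_Ioc, smul_eq_mul, mul_one]

/-- The control that equals `1` on `(S, S + d]` and `-1` on `(S + d, S + 2 d]`. -/
def loopControl (S d t : ℝ) : ℝ :=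
  (Ioc S (S + d)).indicator (fun _ => (1 : ℝ)) t -
    (Ioc (S + d) (S + 2 * d)).indicator (fun _ => (1 : ℝ)) t

theorem measurable_loopControl (S d : ℝ) : Measurable (loopControl S d) :=
  (measurable_const.indicator measurableSet_Ioc).sub (measurable_const.indicator measurableSet_Ioc)

theorem abs_loopControl {S d : ℝ} (hd : 0 ≤ d) (t : ℝ) :
    |loopControl S d t| = (Ioc S (S + 2 * d)).indicator (fun _ => (1 : ℝ)) t := by
  unfold loopControl
  simp only [indicator_apply, mem_Ioc]
  split_ifs <;> first | (exfalso; grind) | norm_num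

theorem abs_loopControl_le {S d : ℝ} (hd : 0 ≤ d) (t : ℝ) : |loopControl S d t| ≤ 1 := by
  rw [abs_loopControl hd]
  exact indicator_le_self' (fun _ _ => zero_le_one) t

theorem loopControl_of_le {S d t : ℝ} (hd : 0 ≤ d) (ht : t ≤ S) : loopControl S d t = 0 := by
  rw [← abs_eq_zero, abs_loopControl hd, indicator_of_notMem fun h => h.1.not_ge ht]

/-- The time reflection associated with `loopControl`. -/
def reflection (S d t : ℝ) : ℝ := max S (min t (2 * (S + d) - t))

theorem integral_loopControl {S d t : ℝ} (hS : 0 ≤ S) (hd : 0 ≤ d) (ht : S ≤ t) :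
    ∫ r in (0 : ℝ)..t, loopControl S d r = reflection S d t - S := by
  have hi : ∀ a b : ℝ, IntervalIntegrable ((Ioc a b).indicator fun _ => (1 : ℝ)) volume 0 t :=
    fun a b => by
      rw [intervalIntegrable_iff]
      exact (integrableOn_const (by simp)).indicator measurableSet_Ioc
  unfold loopControl reflection
  rw [intervalIntegral.integral_sub (hi _ _) (hi _ _),
    integral_indicator_Ioc_one hS (hS.trans ht),
    integral_indicator_Ioc_one (add_nonneg hS hd) (hS.trans ht)]
  grind

/-- Idempotence makes the looping path invariant under the reflection, since after time `S` that
path depends on `t` only through `reflection S d t`. -/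
theorem reflection_reflection {S d t : ℝ} (hd : 0 ≤ d) :
    reflection S d (reflection S d t) = reflection S d t := by
  unfold reflection
  grind

theorem reflection_mem {S d t R : ℝ} (hd : 0 ≤ d) (hR : S + d ≤ R) :
    reflection S d t ∈ Icc S R := by
  unfold reflection
  constructor <;> grind

theorem abs_reflection_sub_le (S d s t : ℝ) :
    |reflection S d t - reflection S d s| ≤ 1 * |t - s| := by
  unfold reflection
  rcases abs_cases (t - s) with h | h <;> rw [h.1, abs_le] <;> constructor <;> grind

/-- A trajectory of the reduced system can be continued so that the total variation of the control
equals `M`, without changing the endpoint. -/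
theorem FieldData.exists_extension (hm : 1 ≤ m) {T M : ℝ} (hT : 0 < T) (hM : 0 < M)
    {c : ℝ → Option (Fin m) → ℝ} (hc : Measurable c) (hc0 : ∀ t, 0 ≤ c t none)
    (hc1 : ∀ t, ∑ j, |c t j| ≤ 1) (hcT : ∫ t in (0 : ℝ)..(T + M), c t none = T)
    {ξ : ℝ → Disp n} (hξ : D.IsFlow ϑ c (T + M) ξ) :
    ∃ (R : ℝ) (c' : ℝ → Option (Fin m) → ℝ) (ξ' : ℝ → Disp n), 1 ≤ R ∧ Measurable c' ∧
      (∀ t, 0 ≤ c' t none) ∧ (∀ t, ∑ j, |c' t j| ≤ 1) ∧ (∀ t ≤ 0, c' t none = 0) ∧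
      (∀ t, R - 1 < t → c' t none = 0) ∧ ∫ t in (0 : ℝ)..R, c' t none = T ∧
      ∫ t in (0 : ℝ)..R, ∑ i, |c' t (some i)| = M ∧ D.IsFlow ϑ c' R ξ' ∧ ξ' R = ξ (T + M) := by
  classical
  have hK := D.K_nonneg
  set S := T + M with hS
  have hS0 : 0 ≤ S := by positivity
  have hi := intervalIntegrable_coord hc hc1
  have his : IntervalIntegrable (fun t => ∑ i, |c t (some i)|) volume 0 S := by
    simpa only [Finset.sum_fn] using IntervalIntegrable.sum Finset.univ
      fun i _ => (hi (some i) 0 S).abs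
  set W := ∫ t in (0 : ℝ)..S, ∑ i, |c t (some i)| with hW
  -- The constraint gives `T + W ≤ S = T + M`.
  have hWM : W ≤ M := by
    have h1 := intervalIntegral.integral_mono_on hS0 ((hi none 0 S).add his)
      (intervalIntegrable_const (c := (1 : ℝ))) fun t _ => by
        have := hc1 t
        rwa [Fintype.sum_option, abs_of_nonneg (hc0 t)] at this
    rw [intervalIntegral.integral_add (hi none 0 S) his, hcT] at h1
    simp only [intervalIntegral.integral_const, sub_zero, smul_eq_mul, mul_one] at h1
    linarith
  -- The loop runs for time `d` forward and `d` backward along one field at unit speed, so it uses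
  -- exactly the missing variation `M - W`.
  set d := (M - W) / 2 with hd'
  have hd : 0 ≤ d := by rw [hd']; linarith
  -- The extra unit of time is idle; the regularization of the physical time will use it to make up
  -- a small deficit.
  set R := S + 2 * d + 1 with hR
  have hSR : S ≤ R := by rw [hR]; linarith
  have hR0 : 0 ≤ R := hS0.trans hSR
  let i₀ : Fin m := ⟨0, hm⟩
  let δ : Option (Fin m) → ℝ := fun j => if j = some i₀ then 1 else 0
  let c' : ℝ → Option (Fin m) → ℝ := fun t j =>
    (Ioc 0 S).indicator (fun t => c t j) t + loopControl S d t * δ j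
  have hc' : Measurable c' := measurable_pi_iff.2 fun j =>
    ((measurable_pi_iff.1 hc j).indicator measurableSet_Ioc).add
      ((measurable_loopControl S d).mul_const _)
  have hin : ∀ t ∈ Ioc 0 S, ∀ j, c' t j = c t j := fun t ht j => by
    simp only [c', indicator_of_mem ht, loopControl_of_le hd ht.2, zero_mul, add_zero]
  have hout : ∀ t ∉ Ioc 0 S, ∀ j, c' t j = loopControl S d t * δ j := fun t ht j => by
    simp only [c', indicator_of_notMem ht, zero_add]
  have hsome : ∀ t, ∑ i, |c' t (some i)| = (Ioc 0 S).indicator (fun t => ∑ i, |c t (some i)|) t +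
      (Ioc S (S + 2 * d)).indicator (fun _ => (1 : ℝ)) t := fun t => by
    rw [← abs_loopControl hd]
    by_cases ht : t ∈ Ioc 0 S
    · simp only [hin t ht, indicator_of_mem ht, loopControl_of_le hd ht.2, abs_zero, add_zero]
    · simp only [hout t ht, indicator_of_notMem ht, zero_add, abs_mul, ← Finset.mul_sum]
      simp [δ, apply_ite abs]
  have hnone : ∀ t, c' t none = (Ioc 0 S).indicator (fun t => c t none) t := fun t => by
    simp [c', δ]
  have hc0' : ∀ t, 0 ≤ c' t none := fun t => by
    rw [hnone]; exact indicator_nonneg (fun s _ => hc0 s) t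
  have hc1' : ∀ t, ∑ j, |c' t j| ≤ 1 := fun t => by
    by_cases ht : t ∈ Ioc 0 S
    · simp only [hin t ht, hc1]
    · rw [Fintype.sum_option, hsome, hnone, indicator_of_notMem ht, indicator_of_notMem ht,
        ← abs_loopControl hd]
      simpa using abs_loopControl_le hd t
  have hprim : ∀ t ∈ Icc 0 S, ∀ j, primitive c' t j = primitive c t j := fun t ht j => by
    unfold primitive
    rw [intervalIntegral.integral_of_le ht.1, intervalIntegral.integral_of_le ht.1]
    exact setIntegral_congr_fun measurableSet_Ioc fun r hr => hin r ⟨hr.1, hr.2.trans ht.2⟩ j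
  have hprim' : ∀ t, S ≤ t → ∀ j,
      primitive c' t j = primitive c S j + (reflection S d t - S) * δ j := fun t ht j => by
    unfold primitive
    have h1 : IntervalIntegrable ((Ioc 0 S).indicator fun t => c t j) volume 0 t := by
      rw [intervalIntegrable_iff]
      exact (intervalIntegrable_iff.1 (hi j 0 t)).indicator measurableSet_Ioc
    have h2 : IntervalIntegrable (fun t => loopControl S d t * δ j) volume 0 t :=
      (intervalIntegrable_of_norm_le (measurable_loopControl S d).aestronglyMeasurable
        (fun t => abs_loopControl_le hd t) 0 t).mul_const _
    rw [intervalIntegral.integral_add h1 h2, intervalIntegral.integral_mul_const,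
      integral_loopControl hS0 hd ht, integral_indicator_Ioc le_rfl (hS0.trans ht),
      min_eq_right ht, intervalIntegral.integral_of_le hS0]
  obtain ⟨ξ', hξ'⟩ := D.exists_isFlow ϑ hc' hc1' hR0
  refine ⟨R, c', ξ', by rw [hR]; linarith, hc', hc0', hc1', fun t ht => ?_, fun t ht => ?_, ?_, ?_,
    hξ', ?_⟩
  · rw [hnone, indicator_of_notMem fun h => h.1.not_ge ht]
  · rw [hnone, indicator_of_notMem fun h => by rw [hR] at ht; linarith [h.2]]
  · simp only [hnone]
    rw [integral_indicator_Ioc le_rfl hR0, min_eq_right hSR, ← intervalIntegral.integral_of_le hS0,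
      hcT]
  · simp only [hsome]
    rw [intervalIntegral.integral_add, integral_indicator_Ioc le_rfl hR0,
      integral_indicator_Ioc_one hS0 hR0, min_eq_right hSR, ← intervalIntegral.integral_of_le hS0,
      min_eq_right (by rw [hR]; linarith), max_eq_left (by linarith), ← hW, hd']
    · ring
    · rw [intervalIntegrable_iff]
      have := (intervalIntegrable_sum_abs hc hc1 0 R)
      have h3 : IntervalIntegrable (fun t => ∑ i, |c t (some i)|) volume 0 R := by
        simpa only [Finset.sum_fn] using IntervalIntegrable.sum Finset.univ
          fun i _ => (hi (some i) 0 R).abs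
      exact (intervalIntegrable_iff.1 h3).indicator measurableSet_Ioc
    · rw [intervalIntegrable_iff]
      exact (integrableOn_const (by simp)).indicator measurableSet_Ioc
  · have hdr := hξ'.driven hc' hc1'
    have h1 : ξ' S = ξ S := by
      have hdS := (hdr.mono le_rfl hSR).congr (P' := primitive c) fun t ht => by
        funext j; exact (hprim t ht j).symm
      exact (hξ.driven hc hc1).unique hdS (D.norm_nonlocal_le ϑ) (D.norm_nonlocal_sub_le ϑ)
        (by positivity) zero_le_one (by positivity) (by positivity)
        (sum_abs_primitive_sub_le hc hc1) (by rw [hξ.zero hS0, hξ'.zero hR0]) ⟨hS0, le_rfl⟩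
    have hdR := hdr.mono hS0 le_rfl
    -- Both `ξ'` and its reflection are driven by the same path on `[S, R]` and agree at `S`, so
    -- they coincide; as `R` is reflected to `S`, the curve has returned to its starting point.
    have hcomp := (hdR.comp (by positivity) (θ := reflection S d) (a' := S) (b' := R) (Λ := 1)
      (fun s _ => reflection_mem hd (by rw [hR]; linarith))
      (fun s _ t _ => abs_reflection_sub_le S d s t)).congr (P' := primitive c') fun t ht => by
        funext j
        rw [Function.comp_apply, hprim' _ (reflection_mem hd le_rfl).1, hprim' _ ht.1,
          reflection_reflection hd]
    have hrS : reflection S d S = S := by unfold reflection; grind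
    have hrR : reflection S d R = S := by unfold reflection; grind
    have := hdR.unique hcomp (D.norm_nonlocal_le ϑ) (D.norm_nonlocal_sub_le ϑ)
        (by positivity) zero_le_one (by positivity) (by positivity)
        (sum_abs_primitive_sub_le hc' hc1') (by rw [Function.comp_apply, hrS]) ⟨hSR, le_rfl⟩
    rw [← this, Function.comp_apply, hrR, h1]

end Extension

/-! ### Approximating the physical time by functions with positive derivative. -/

section Regularization

/-- A nondecreasing Lipschitz function, constant near the right end of `[0, R]`, is approximated by
smooth functions with positive derivative that take the same values at the endpoints. -/
theorem exists_regularization {Φ : ℝ → ℝ} {T R h : ℝ} (hT : 0 < T) (hR : 1 ≤ R) (hh : 0 < h)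
    (hh2 : h ≤ 1 / 2) (hΦm : Monotone Φ) (hΦL : ∀ s t, s ≤ t → Φ t - Φ s ≤ t - s)
    (hΦ0 : ∀ s ≤ 0, Φ s = 0) (hΦT : ∀ s, R - 1 ≤ s → Φ s = T) :
    ∃ (A A' : ℝ → ℝ) (lam : ℝ), 0 < lam ∧ (∀ s, HasDerivAt A (A' s) s) ∧ Continuous A' ∧
      (∀ s, lam ≤ A' s) ∧ (∀ s, A' s ≤ 1 + 3 * T) ∧ A 0 = 0 ∧ A R = T ∧
      (∀ s ∈ Icc 0 R, (1 - h) * Φ (s - h) ≤ A s) ∧ (∀ s ∈ Icc 0 R, A s ≤ Φ s + T * h) ∧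
      ∀ s ∈ Icc 0 (R - 1), A s ≤ (1 - h) * Φ s + T * h ^ 2 := by
  have hΦc : Continuous Φ := by
    refine (LipschitzWith.of_dist_le_mul (K := 1) fun s t => ?_).continuous
    rw [Real.dist_eq, Real.dist_eq, NNReal.coe_one, one_mul]
    rcases le_total s t with hst | hst
    · rw [abs_sub_comm, abs_sub_comm s, abs_of_nonneg (sub_nonneg.2 (hΦm hst)),
        abs_of_nonneg (sub_nonneg.2 hst)]
      exact hΦL s t hst
    · rw [abs_of_nonneg (sub_nonneg.2 (hΦm hst)), abs_of_nonneg (sub_nonneg.2 hst)]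
      exact hΦL t s hst
  let ρ : ℝ → ℝ := fun s => min 1 (max 0 (2 * (s - (R - 1))))
  have hρc : Continuous ρ := by fun_prop
  have hρm : Monotone ρ := fun s t hst => by simp only [ρ]; gcongr
  have hρL : ∀ s t, s ≤ t → ρ t - ρ s ≤ 2 * (t - s) := fun s t hst => by simp only [ρ]; grind
  have hρ0 : ∀ s, s ≤ R - 1 → ρ s = 0 := fun s hs => by simp only [ρ]; grind
  have hρ1 : ∀ s, R - 1 / 2 ≤ s → ρ s = 1 := fun s hs => by simp only [ρ]; grind
  have hρle : ∀ s, ρ s ≤ 1 := fun s => min_le_left _ _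
  have hρnn : ∀ s, 0 ≤ ρ s := fun s => le_min zero_le_one (le_max_left _ _)
  have hh1 : 0 ≤ 1 - h := by linarith
  -- Chosen so that the endpoint value is exactly `(1 - h) * T + q + T * h ^ 2 = T`; the three terms
  -- come from the scaled `Φ`, from the ramp `ρ` on `[R - 1, R - 1 / 2]`, and from the linear term
  -- of slope `lam`.
  set q := T * (h - h ^ 2) with hq
  have hq0 : 0 ≤ q := by
    rw [hq, show T * (h - h ^ 2) = T * h * (1 - h) by ring]
    positivity
  have hqT : 2 * q ≤ 2 * T * h := by rw [hq]; linarith [mul_pos hT (pow_pos hh 2)]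
  let B : ℝ → ℝ := fun s => (1 - h) * Φ s + q * ρ s
  have hBc : Continuous B := by fun_prop
  have hBm : Monotone B := fun s t hst =>
    add_le_add (mul_le_mul_of_nonneg_left (hΦm hst) hh1) (mul_le_mul_of_nonneg_left (hρm hst) hq0)
  set lam := T * h ^ 2 / R with hlam
  have hlam0 : 0 < lam := by positivity
  have hlamR : lam * R = T * h ^ 2 := by rw [hlam]; field_simp
  have hlams : ∀ s, 0 ≤ s → 0 ≤ lam * s := fun s hs => by positivity
  have hlams' : ∀ s, s ≤ R → lam * s ≤ T * h ^ 2 := fun s hs => by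
    rw [← hlamR]; exact mul_le_mul_of_nonneg_left hs hlam0.le
  have hBi : ∀ a b, IntervalIntegrable B volume a b := fun a b => hBc.intervalIntegrable a b
  have hder : ∀ s, HasDerivAt (fun s => ∫ r in (0 : ℝ)..s, B r) (B s) s := fun s =>
    hBc.integral_hasStrictDerivAt 0 s |>.hasDerivAt
  -- A backward average over `[s - h, s]` keeps `A` below `B` up to the linear term and vanishes at
  -- `0`. At `R` it returns `B R`, because `h ≤ 1 / 2` and `B` is constant on `[R - 1 / 2, R]`. The
  -- factor `1 - h` keeps `A` strictly below positive plateaus of `Φ` when `h` is small.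
  let A : ℝ → ℝ := fun s =>
    h⁻¹ * ((∫ r in (0 : ℝ)..s, B r) - ∫ r in (0 : ℝ)..(s - h), B r) + lam * s
  have hA : ∀ s, B (s - h) + lam * s ≤ A s ∧ A s ≤ B s + lam * s := fun s => by
    have hle : s - h ≤ s := by linarith
    simp only [A, add_le_add_iff_right]
    rw [intervalIntegral.integral_interval_sub_left (hBi _ _) (hBi _ _), le_inv_mul_iff₀ hh,
      inv_mul_le_iff₀ hh]
    have h1 := intervalIntegral.integral_mono_on hle (intervalIntegrable_const (c := B (s - h)))
      (hBi _ _) fun r hr => hBm hr.1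
    have h2 := intervalIntegral.integral_mono_on hle (hBi _ _)
      (intervalIntegrable_const (c := B s)) fun r hr => hBm hr.2
    simp only [intervalIntegral.integral_const, sub_sub_cancel, smul_eq_mul] at h1 h2
    exact ⟨h1, h2⟩
  have hB0 : ∀ s ≤ 0, B s = 0 := fun s hs => by
    simp only [B, hΦ0 s hs, hρ0 s (by linarith), mul_zero, add_zero]
  have hBT : ∀ s, R - 1 / 2 ≤ s → B s = T - T * h ^ 2 := fun s hs => by
    simp only [B, hΦT s (by linarith), hρ1 s hs, hq]
    ring
  refine ⟨A, fun s => h⁻¹ * (B s - B (s - h)) + lam, lam, hlam0, fun s => ?_, by fun_prop,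
    fun s => ?_, fun s => ?_, ?_, ?_, fun s hs => ?_, fun s hs => ?_, fun s hs => ?_⟩
  · have h1 : HasDerivAt (fun s => ∫ r in (0 : ℝ)..(s - h), B r) (B (s - h)) s :=
       (hder (s - h)).comp_sub_const s h
    have h2 : HasDerivAt (fun s => lam * s) lam s := by
      simpa using (hasDerivAt_id s).const_mul lam
    exact (((hder s).sub h1).const_mul _).add h2
  · have : B (s - h) ≤ B s := hBm (by linarith)
    have h1 : 0 ≤ h⁻¹ * (B s - B (s - h)) := mul_nonneg (inv_nonneg.2 hh.le) (by linarith)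
    linarith
  · have h1 := hΦL (s - h) s (by linarith)
    have h2 := hρL (s - h) s (by linarith)
    rw [sub_sub_cancel] at h1 h2
    have h0 : 0 ≤ Φ s - Φ (s - h) := sub_nonneg.2 (hΦm (by linarith))
    have h3 : B s - B (s - h) ≤ h * (1 + 2 * T * h) := by
      have e1 : (1 - h) * (Φ s - Φ (s - h)) ≤ 1 * h :=
        mul_le_mul (by linarith) h1 h0 zero_le_one
      have e2 : q * (ρ s - ρ (s - h)) ≤ q * (2 * h) := mul_le_mul_of_nonneg_left h2 hq0
      have e3 : q * (2 * h) ≤ 2 * T * h * h := by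
        have := mul_le_mul_of_nonneg_right hqT hh.le
        linarith
      simp only [B]
      linarith
    have h4 : h⁻¹ * (B s - B (s - h)) ≤ 1 + 2 * T * h := by rwa [inv_mul_le_iff₀ hh]
    have h5 : lam ≤ T * h ^ 2 := by
      have := hlams' 1 hR
      rwa [mul_one] at this
    have h6 : T * h ^ 2 ≤ T := mul_le_of_le_one_right hT.le (by nlinarith)
    have h7 : T * h ≤ T := mul_le_of_le_one_right hT.le (by linarith)
    linarith
  · have := hA 0
    rw [hB0 0 le_rfl, hB0 (0 - h) (by linarith)] at this
    linarith [this.1, this.2]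
  · have := hA R
    rw [hBT R (by linarith), hBT (R - h) (by linarith), hlamR] at this
    linarith [this.1, this.2]
  · have h1 := (hA s).1
    have h2 : 0 ≤ q * ρ (s - h) := mul_nonneg hq0 (hρnn _)
    have h3 := hlams s hs.1
    simp only [B] at h1
    linarith
  · have h1 := (hA s).2
    have h2 : q * ρ s ≤ q := mul_le_of_le_one_right hq0 (hρle s)
    have h3 := hlams' s hs.2
    have h4 : 0 ≤ Φ s := by rw [← hΦ0 0 le_rfl]; exact hΦm hs.1
    have h5 : 0 ≤ h * Φ s := by positivity
    simp only [B] at h1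
    rw [hq] at h2
    linarith
  · have h1 := (hA s).2
    have h3 := hlams' s (by linarith [hs.2])
    simp only [B, hρ0 s hs.2, mul_zero, add_zero] at h1
    linarith

end Regularization

/-! ### From positive drift back to the original system. -/

section TimeChangeInverse

variable {n m : ℕ} (D : FieldData n m) (ϑ : P1 n)

/-- Change of variables along an increasing bijection. -/
theorem integral_comp_inverse {A A' σ : ℝ → ℝ} (hA : ∀ s, HasDerivAt A (A' s) s)
    (hA' : ∀ s, 0 < A' s) (hσ1 : ∀ t, A (σ t) = t) (hσ2 : ∀ s, σ (A s) = s) (hσ : StrictMono σ)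
    (hA0 : A 0 = 0) (F : ℝ → ℝ) {t : ℝ} (ht : 0 ≤ t) :
    ∫ r in (0 : ℝ)..t, F (σ r) / A' (σ r) = ∫ r in (0 : ℝ)..σ t, F r := by
  have hσ0 : σ 0 = 0 := by rw [← hA0, hσ2, hA0]
  have hAm : StrictMono A := fun a b hab => by
    rw [← hσ.lt_iff_lt, hσ2, hσ2]; exact hab
  have himg : A '' Ioc 0 (σ t) = Ioc 0 t := by
    ext r
    constructor
    · rintro ⟨s, hs, rfl⟩
      exact ⟨by rw [← hA0]; exact hAm hs.1, by rw [← hσ1 t]; exact hAm.monotone hs.2⟩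
    · intro hr
      exact ⟨σ r, ⟨by rw [← hσ0]; exact hσ hr.1, hσ.monotone hr.2⟩, hσ1 r⟩
  rw [intervalIntegral.integral_of_le ht,
    intervalIntegral.integral_of_le (by rw [← hσ0]; exact hσ.monotone ht), ← himg,
    integral_image_eq_integral_deriv_smul_of_monotoneOn measurableSet_Ioc
      (fun s _ => (hA s).hasDerivWithinAt) (hAm.monotone.monotoneOn _)]
  refine setIntegral_congr_fun measurableSet_Ioc fun s _ => ?_
  simp only [hσ2, smul_eq_mul]
  rw [mul_div_cancel₀ _ (hA' s).ne']

/-- A flow of the auxiliary system with positive drift coefficient is, up to a time change, a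
trajectory of the original system. -/
theorem FieldData.exists_mem_trajectories_of_time_change {T M R : ℝ} (hT : 0 < T)
    {A A' σ : ℝ → ℝ} (hA : ∀ s, HasDerivAt A (A' s) s) (hA'c : Continuous A') {lam κ : ℝ}
    (hlam : 0 < lam) (hA' : ∀ s, lam ≤ A' s) (hσ1 : ∀ t, A (σ t) = t) (hσ2 : ∀ s, σ (A s) = s)
    (hσ : StrictMono σ) (hσL : ∀ s t, |σ t - σ s| ≤ lam⁻¹ * |t - s|) (hA0 : A 0 = 0)
    (hAR : A R = T) {β : ℝ → Fin m → ℝ} (hβ : Measurable β) (hβ1 : ∀ t, ∑ i, |β t i| ≤ 1)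
    (hβM : ∫ t in (0 : ℝ)..R, ∑ i, |β t i| = M)
    (hκ : ∀ t, ∑ j : Option (Fin m), |j.elim (A' t) (β t)| ≤ κ) {η : ℝ → Disp n}
    (hη : D.IsFlow ϑ (fun t j => j.elim (A' t) (β t)) R η) :
    ∃ μ ∈ trajectories T M D.f₀ (fun i => D.f i) D.g ϑ, ∀ t ∈ Icc 0 T, μ t = push ϑ (η (σ t)) := by
  have hK := D.K_nonneg
  have hpos : ∀ s, 0 < A' s := fun s => hlam.trans_le (hA' s)
  have hσ0 : σ 0 = 0 := by
    have := hσ2 0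
    rwa [hA0] at this
  have hσT : σ T = R := by rw [← hAR, hσ2]
  have hR0 : 0 ≤ R := by rw [← hσT, ← hσ0]; exact hσ.monotone hT.le
  have hκ0 : 0 ≤ κ := (Finset.sum_nonneg fun _ _ => abs_nonneg _).trans (hκ 0)
  -- Division by `A'` is the Jacobian of the time change: it preserves the total variation `M`, and
  -- `lam ≤ A'` keeps `u` bounded.
  let u : ℝ → Fin m → ℝ := fun t i => β (σ t) i / A' (σ t)
  have hu : Measurable u := measurable_pi_iff.2 fun i =>
    ((measurable_pi_iff.1 hβ i).comp hσ.monotone.measurable).div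
      (hA'c.measurable.comp hσ.monotone.measurable)
  have hsum : ∀ t, ∑ i, |u t i| = (∑ i, |β (σ t) i|) / A' (σ t) := fun t => by
    simp only [u, abs_div, abs_of_pos (hpos _), Finset.sum_div]
  have hu1 : ∀ t, ∑ i, |u t i| ≤ lam⁻¹ := fun t => by
    rw [hsum, div_le_iff₀ (hpos _)]
    refine (hβ1 _).trans ?_
    rw [le_inv_mul_iff₀ hlam, mul_one]
    exact hA' _
  have hint : ∫ t in (0 : ℝ)..T, ∑ i, |u t i| = M := by
    simp only [hsum]
    rw [integral_comp_inverse hA hpos hσ1 hσ2 hσ hA0 (fun r => ∑ i, |β r i|) hT.le, hσT, hβM]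
  set c : ℝ → Option (Fin m) → ℝ := fun t j => j.elim (A' t) (β t)
  have hc : Measurable c := measurable_elim hA'c.measurable hβ
  have hcu : Measurable fun t (j : Option (Fin m)) => j.elim (1 : ℝ) (u t) :=
    measurable_elim measurable_const hu
  have hcu1 : ∀ t, ∑ j : Option (Fin m), |j.elim (1 : ℝ) (u t)| ≤ 1 + lam⁻¹ := fun t => by
    rw [sum_abs_elim, abs_one]; linarith [hu1 t]
  -- The drift coordinate becomes `A (σ t) = t`, and the others agree by change of variables. Thus
  -- the flow of `u` and `η ∘ σ` are driven by the same path.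
  have hprim : ∀ t ∈ Icc 0 T,
      primitive (fun t (j : Option (Fin m)) => j.elim (1 : ℝ) (u t)) t = (primitive c ∘ σ) t := by
    intro t ht
    funext j
    cases j with
    | none =>
      rw [primitive_elim_one_none]
      have : ∫ r in (0 : ℝ)..σ t, A' r = A (σ t) - A 0 :=
        intervalIntegral.integral_eq_sub_of_hasDerivAt (fun s _ => hA s)
          (hA'c.intervalIntegrable _ _)
      rw [hσ1, hA0, sub_zero] at this
      exact this.symm
    | some i => exact integral_comp_inverse hA hpos hσ1 hσ2 hσ hA0 (fun r => β r i) ht.1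
  obtain ⟨ξ, hξ⟩ := D.exists_isFlow ϑ hcu hcu1 hT.le
  refine ⟨_, D.mem_trajectories_of_isFlow ϑ hT hu hu1 hint hξ, fun t ht => ?_⟩
  have h1 := ((hη.driven hc hκ).comp (by positivity) (θ := σ) (a' := 0) (b' := T)
    (fun s hs => ⟨by rw [← hσ0]; exact hσ.monotone hs.1, by rw [← hσT]; exact hσ.monotone hs.2⟩)
    fun s _ t _ => hσL s t).congr hprim
  have := (hξ.driven hcu hcu1).unique h1 (D.norm_nonlocal_le ϑ) (D.norm_nonlocal_sub_le ϑ)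
    (by positivity) (by positivity) (by positivity) (by positivity)
    (sum_abs_primitive_sub_le hcu hcu1)
    (by rw [Function.comp_apply, hσ0, hη.zero hR0, hξ.zero hT.le]) ht
  rw [Function.comp_apply] at this
  simp only [this]

end TimeChangeInverse

/-! ### The right-continuous inverse of the physical time. -/

section RightInverse

/-- The right-continuous generalized inverse of a nondecreasing function on `[0, R]`. -/
def rightInverse (Φ : ℝ → ℝ) (R t : ℝ) : ℝ := sSup {s | s ∈ Icc 0 R ∧ Φ s ≤ t}

variable {Φ : ℝ → ℝ} {R t : ℝ}

theorem bddAbove_rightInverse : BddAbove {s | s ∈ Icc 0 R ∧ Φ s ≤ t} :=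
  ⟨R, fun _ hs => hs.1.2⟩

theorem le_rightInverse {s : ℝ} (hs : s ∈ Icc 0 R) (h : Φ s ≤ t) : s ≤ rightInverse Φ R t :=
  le_csSup bddAbove_rightInverse ⟨hs, h⟩

theorem rightInverse_le (hR : 0 ≤ R) (h0 : Φ 0 ≤ t) {b : ℝ}
    (hb : ∀ s ∈ Icc 0 R, Φ s ≤ t → s ≤ b) : rightInverse Φ R t ≤ b :=
  csSup_le ⟨0, ⟨le_rfl, hR⟩, h0⟩ fun s hs => hb s hs.1 hs.2

theorem rightInverse_mem (hR : 0 ≤ R) (h0 : Φ 0 ≤ t) : rightInverse Φ R t ∈ Icc 0 R :=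
  ⟨le_rightInverse ⟨le_rfl, hR⟩ h0, rightInverse_le hR h0 fun _ hs _ => hs.2⟩

theorem apply_le_of_lt_rightInverse (hΦ : Monotone Φ) (hR : 0 ≤ R) (h0 : Φ 0 ≤ t) {a : ℝ}
    (ha : a < rightInverse Φ R t) : Φ a ≤ t := by
  obtain ⟨s, hs, has⟩ := exists_lt_of_lt_csSup (s := {s | s ∈ Icc 0 R ∧ Φ s ≤ t})
    ⟨0, ⟨le_rfl, hR⟩, h0⟩ ha
  exact (hΦ has.le).trans hs.2

theorem lt_apply_of_rightInverse_lt {b : ℝ} (hb : b ∈ Icc 0 R) (h : rightInverse Φ R t < b) :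
    t < Φ b :=
  not_le.1 fun hle => (le_rightInverse hb hle).not_gt h

theorem rightInverse_mono (hR : 0 ≤ R) {t' : ℝ} (h0 : Φ 0 ≤ t) (htt' : t ≤ t') :
    rightInverse Φ R t ≤ rightInverse Φ R t' :=
  rightInverse_le hR h0 fun _ hs h => le_rightInverse hs (h.trans htt')

theorem continuousWithinAt_rightInverse (hΦ : Monotone Φ) (hR : 0 ≤ R) (h0 : Φ 0 ≤ t) :
    ContinuousWithinAt (rightInverse Φ R) (Ici t) t := by
  refine tendsto_order.2 ⟨fun a ha => ?_, fun b hb => ?_⟩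
  · filter_upwards [self_mem_nhdsWithin] with t' ht'
    exact ha.trans_le (rightInverse_mono hR h0 ht')
  · obtain ⟨b', hb', hb'b⟩ := exists_between hb
    have hb'0 : 0 ≤ b' := (rightInverse_mem hR h0).1.trans hb'.le
    rcases lt_or_ge R b' with hRb | hRb
    · filter_upwards [self_mem_nhdsWithin] with t' ht'
      exact (rightInverse_mem hR (h0.trans ht')).2.trans_lt (hRb.trans hb'b)
    · have ht := lt_apply_of_rightInverse_lt ⟨hb'0, hRb⟩ hb'
      filter_upwards [self_mem_nhdsWithin, nhdsWithin_le_nhds (Iio_mem_nhds ht)] with t' ht' hlt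
      exact (rightInverse_le hR (h0.trans ht') fun s _ hs => not_lt.1 fun hbs =>
        ((hΦ hbs.le).trans hs).not_gt hlt).trans_lt hb'b

end RightInverse

/-! ### Generalized solutions as limits of reparametrized flows. -/

section Approximation

theorem Driven.norm_sub_le_mul {E ι : Type*} [NormedAddCommGroup E] [NormedSpace ℝ E] [Fintype ι]
    {G : ι → E → E} {P : ℝ → ι → ℝ} {ξ : ℝ → E} {a b C K κ : ℝ} (h : Driven G P ξ a b C)
    (hGK : ∀ j x, ‖G j x‖ ≤ K) (hK : 0 ≤ K) (hC : 0 ≤ C)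
    (hP : ∀ s t, ∑ j, |P t j - P s j| ≤ κ * |t - s|) {s t : ℝ} (hs : s ∈ Icc a b)
    (ht : t ∈ Icc a b) : ‖ξ t - ξ s‖ ≤ (κ * K + C * (b - a)) * |t - s| := by
  have h1 := norm_sum_smul_le (hP s t) (fun j => hGK j (ξ s)) hK
  have h2 := h s hs t ht
  have h3 := norm_le_norm_sub_add (ξ t - ξ s) (∑ j, (P t j - P s j) • G j (ξ s))
  have h4 : |t - s| ≤ b - a := abs_le.2 ⟨by linarith [hs.2, ht.1], by linarith [hs.1, ht.2]⟩
  have h5 : C * (t - s) ^ 2 ≤ C * ((b - a) * |t - s|) := by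
    rw [← sq_abs, sq]
    exact mul_le_mul_of_nonneg_left (mul_le_mul_of_nonneg_right h4 (abs_nonneg _)) hC
  linarith

/-- Generalized inverses converge away from the left endpoint. -/
theorem tendsto_inverse_rightInverse {Φ : ℝ → ℝ} {T R : ℝ} (hT : 0 < T) (hR : 1 ≤ R)
    (hΦm : Monotone Φ) (hΦ0 : Φ 0 = 0) (hΦT : ∀ s, R - 1 ≤ s → Φ s = T) {A σ : ℕ → ℝ → ℝ}
    {h : ℕ → ℝ} (hh : ∀ k, 0 < h k) (hlim : Tendsto h atTop (𝓝 0))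
    (hA : ∀ s ∈ Icc 0 R, Tendsto (fun k => A k s) atTop (𝓝 (Φ s)))
    (hAle : ∀ k, ∀ s ∈ Icc 0 (R - 1), A k s ≤ (1 - h k) * Φ s + T * h k ^ 2)
    (hAR : ∀ k, A k R = T) (hσ2 : ∀ k s, σ k (A k s) = s)
    (hσ : ∀ k, StrictMono (σ k)) (hσ0 : ∀ k, σ k 0 = 0) {t : ℝ} (ht : t ∈ Ioc 0 T) :
    Tendsto (fun k => σ k t) atTop (𝓝 (rightInverse Φ R t)) := by
  have hR0 : 0 ≤ R := zero_le_one.trans hR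
  have h0 : Φ 0 ≤ t := hΦ0.le.trans ht.1.le
  have hσT : ∀ k, σ k T = R := fun k => by rw [← hAR k, hσ2]
  rcases eq_or_lt_of_le ht.2 with rfl | htT
  · have : rightInverse Φ R t = R := le_antisymm (rightInverse_mem hR0 h0).2
      (le_rightInverse ⟨hR0, le_rfl⟩ (hΦT R (by linarith)).le)
    simp only [hσT, this]
    exact tendsto_const_nhds
  · have hlt : ∀ k s, A k s < t → s < σ k t := fun k s hs => by
      rw [← hσ2 k s]; exact hσ k hs
    have hgt : ∀ k s, t < A k s → σ k t < s := fun k s hs => by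
      rw [← hσ2 k s]; exact hσ k hs
    have hmem : ∀ k, σ k t ∈ Icc 0 R := fun k =>
      ⟨by rw [← hσ0 k]; exact (hσ k).monotone ht.1.le,
        by rw [← hσT k]; exact (hσ k).monotone ht.2⟩
    refine tendsto_order.2 ⟨fun a ha => ?_, fun b hb => ?_⟩
    · rcases lt_or_ge a 0 with ha0 | ha0
      · exact Eventually.of_forall fun k => ha0.trans_le (hmem k).1
      -- From `R - 1` on, `Φ` already has the value `T > t`.
      · have haR : a ≤ R - 1 := not_lt.1 fun hcon => by
          have h1 := apply_le_of_lt_rightInverse hΦm hR0 h0 ha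
          rw [hΦT a hcon.le] at h1
          exact h1.not_gt htT
        have hat := apply_le_of_lt_rightInverse hΦm hR0 h0 ha
        rcases eq_or_lt_of_le hat with hat | hat
        -- Here `a` lies on the plateau of `Φ` at level `t`, where convergence alone decides
        -- nothing. The sharp upper bound gives `A k a ≤ (1 - h k) * t + T * h k ^ 2 < t`, which
        -- selects the right end of the plateau.
        · have hev : ∀ᶠ k in atTop, h k < t / T := hlim.eventually_lt_const (div_pos ht.1 hT)
          filter_upwards [hev] with k hk
          refine hlt k a ?_
          have h1 := hAle k a ⟨ha0, haR⟩
          rw [lt_div_iff₀ hT] at hk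
          have h2 := mul_lt_mul_of_pos_left hk (hh k)
          rw [hat] at h1
          linarith
        · filter_upwards [(hA a ⟨ha0, by linarith⟩).eventually_lt_const hat] with k hk
          exact hlt k a hk
    · rcases lt_or_ge R b with hbR | hbR
      · exact Eventually.of_forall fun k => (hmem k).2.trans_lt hbR
      · have hbm : b ∈ Icc 0 R := ⟨(rightInverse_mem hR0 h0).1.trans hb.le, hbR⟩
        filter_upwards [(hA b hbm).eventually_const_lt (lt_apply_of_rightInverse_lt hbm hb)]
          with k hk
        exact hgt k b hk

variable {n m : ℕ} (D : FieldData n m) (ϑ : P1 n)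

/-- A flow of the reduced system, reparametrized by the generalized inverse of the physical time,
is a generalized solution. -/
theorem FieldData.exists_mem_generalizedSolutions {T M R : ℝ} (hT : 0 < T) (hR : 1 ≤ R)
    {c : ℝ → Option (Fin m) → ℝ} (hc : Measurable c) (hc0 : ∀ t, 0 ≤ c t none)
    (hc1 : ∀ t, ∑ j, |c t j| ≤ 1) (hcl : ∀ t ≤ 0, c t none = 0)
    (hcr : ∀ t, R - 1 < t → c t none = 0) (hcT : ∫ t in (0 : ℝ)..R, c t none = T)
    (hcM : ∫ t in (0 : ℝ)..R, ∑ i, |c t (some i)| = M) {ξ : ℝ → Disp n} (hξ : D.IsFlow ϑ c R ξ) :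
    ∃ μ ∈ generalizedSolutions T M D.f₀ (fun i => D.f i) D.g ϑ, μ T = push ϑ (ξ R) := by
  have hK := D.K_nonneg
  have hR0 : 0 ≤ R := zero_le_one.trans hR
  have hi := intervalIntegrable_coord hc hc1 none
  set Φ : ℝ → ℝ := fun t => primitive c t none with hΦ
  have hΦsub : ∀ s t, Φ t - Φ s = ∫ r in s..t, c r none := fun s t =>
    intervalIntegral.integral_interval_sub_left (hi _ _) (hi _ _)
  have hΦm : Monotone Φ := fun s t hst => by
    rw [← sub_nonneg, hΦsub]
    exact intervalIntegral.integral_nonneg hst fun r _ => hc0 r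
  have hΦL : ∀ s t, s ≤ t → Φ t - Φ s ≤ t - s := fun s t hst => by
    have h1 := (Finset.single_le_sum (f := fun j => |primitive c t j - primitive c s j|)
      (fun _ _ => abs_nonneg _) (Finset.mem_univ none)).trans (sum_abs_primitive_sub_le hc hc1 s t)
    rw [one_mul, abs_of_nonneg (sub_nonneg.2 hst)] at h1
    exact (le_abs_self _).trans h1
  have hΦ0 : ∀ s ≤ 0, Φ s = 0 := fun s hs => by
    have := hΦsub s 0
    rw [show Φ 0 = 0 from intervalIntegral.integral_same, intervalIntegral.integral_of_le hs,
      setIntegral_congr_fun (g := fun _ => (0 : ℝ)) measurableSet_Ioc fun r hr => hcl r hr.2,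
      integral_zero] at this
    linarith
  have hΦR : ∀ s t, R - 1 ≤ s → s ≤ t → Φ t = Φ s := fun s t hs hst => by
    have := hΦsub s t
    rw [intervalIntegral.integral_of_le hst,
      setIntegral_congr_fun (g := fun _ => (0 : ℝ)) measurableSet_Ioc
        fun r hr => hcr r (hs.trans_lt hr.1),
      integral_zero] at this
    linarith
  have hΦT : ∀ s, R - 1 ≤ s → Φ s = T := fun s hs =>
    ((hΦR (R - 1) s le_rfl hs).trans (hΦR (R - 1) R le_rfl (by linarith)).symm).trans hcT
  let h : ℕ → ℝ := fun k => 1 / ((k : ℝ) + 1 + 1)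
  have hh : ∀ k, 0 < h k := fun k => by positivity
  have hh2 : ∀ k, h k ≤ 1 / 2 := fun k => by
    refine one_div_le_one_div_of_le two_pos ?_
    linarith [(Nat.cast_nonneg k : (0 : ℝ) ≤ k)]
  have hlim : Tendsto h atTop (𝓝 0) := by
    refine ((tendsto_one_div_add_atTop_nhds_zero_nat (𝕜 := ℝ)).comp
      (tendsto_add_atTop_nat 1)).congr fun k => ?_
    simp [h]
  choose A A' lam hlam hA hA'c hA'l hA'u hA0 hAR hAge hAle hAle' using fun k =>
    exists_regularization hT hR (hh k) (hh2 k) hΦm hΦL hΦ0 hΦT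
  have hAm : ∀ k s t, s ≤ t → lam k * (t - s) ≤ A k t - A k s := fun k s t hst => by
    rw [← intervalIntegral.integral_eq_sub_of_hasDerivAt (fun r _ => hA k r)
      ((hA'c k).intervalIntegrable _ _)]
    have := intervalIntegral.integral_mono_on hst (intervalIntegrable_const (μ := volume) (c := lam k))
      ((hA'c k).intervalIntegrable _ _) fun r _ => hA'l k r
    rwa [intervalIntegral.integral_const, smul_eq_mul, mul_comm] at this
  choose σ hσ1 hσ2 hσ hσL using fun k => exists_inverse_of_slope_ge
    (continuous_iff_continuousAt.2 fun s => (hA k s).continuousAt) (hlam k) (hAm k)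
  have hσ0 : ∀ k, σ k 0 = 0 := fun k => by
    have := hσ2 k 0
    rwa [hA0] at this
  have hAlim : ∀ s ∈ Icc 0 R, Tendsto (fun k => A k s) atTop (𝓝 (Φ s)) := fun s hs => by
    refine tendsto_of_tendsto_of_tendsto_of_le_of_le (g := fun k => (1 - h k) * (Φ s - h k))
      (h := fun k => Φ s + T * h k) ?_ ?_ (fun k => ?_) fun k => hAle k s hs
    · simpa using (hlim.const_sub 1).mul (hlim.const_sub (Φ s))
    · simpa using (hlim.const_mul T).const_add (Φ s)
    · refine le_trans ?_ (hAge k s hs)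
      have := hΦL (s - h k) s (by linarith [hh k])
      exact mul_le_mul_of_nonneg_left (by linarith) (by linarith [hh2 k])
  let β : ℝ → Fin m → ℝ := fun t i => c t (some i)
  have hβ : Measurable β := measurable_pi_iff.2 fun i => measurable_pi_iff.1 hc (some i)
  have hβ1 : ∀ t, ∑ i, |β t i| ≤ 1 := fun t => by
    have := hc1 t
    rw [Fintype.sum_option] at this
    linarith [abs_nonneg (c t none)]
  -- From `A' k ≤ 1 + 3 * T` and `∑ |β| ≤ 1`. The bound is independent of `k`, so the error
  -- constants and Lipschitz constants of the flows `η k` are too.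
  set κ := 2 + 3 * T with hκdef
  have hκ0 : 0 ≤ κ := by positivity
  let ck : ℕ → ℝ → Option (Fin m) → ℝ := fun k t j => j.elim (A' k t) (β t)
  have hck : ∀ k, Measurable (ck k) := fun k => measurable_elim (hA'c k).measurable hβ
  have hκ : ∀ k t, ∑ j, |ck k t j| ≤ κ := fun k t => by
    simp only [ck]
    rw [sum_abs_elim, abs_of_pos ((hlam k).trans_le (hA'l k t))]
    linarith [hβ1 t, hA'u k t]
  choose η hη using fun k => D.exists_isFlow ϑ (hck k) (hκ k) hR0
  choose μk hμk hμkη using fun k => D.exists_mem_trajectories_of_time_change ϑ hT (hA k) (hA'c k)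
    (hlam k) (hA'l k) (hσ1 k) (hσ2 k) (hσ k) (hσL k) (hA0 k) (hAR k) hβ hβ1 hcM (hκ k) (hη k)
  have hηd := fun k => (hη k).driven (hck k) (hκ k)
  have hξd := hξ.driven hc hc1
  have hηlim : ∀ s ∈ Icc 0 R, Tendsto (fun k => η k s) atTop (𝓝 (ξ s)) := fun s hs => by
    refine Driven.tendsto hs.1 (hξd.mono le_rfl hs.2) (fun k => (hηd k).mono le_rfl hs.2)
      (D.norm_nonlocal_le ϑ) (D.norm_nonlocal_sub_le ϑ) (by positivity) zero_le_one (by positivity)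
      (by positivity) (sum_abs_primitive_sub_le hc hc1)
      (fun k => by rw [(hη k).zero hR0, hξ.zero hR0]) fun t ht j => ?_
    cases j with
    | none =>
      refine (hAlim t ⟨ht.1, ht.2.trans hs.2⟩).congr fun k => ?_
      have : ∫ r in (0 : ℝ)..t, A' k r = A k t - A k 0 :=
        intervalIntegral.integral_eq_sub_of_hasDerivAt (fun s _ => hA k s)
          ((hA'c k).intervalIntegrable _ _)
      rw [hA0, sub_zero] at this
      exact this.symm
    | some i => exact tendsto_const_nhds
  obtain ⟨L, hL⟩ : ∃ L, ∀ k, ∀ s ∈ Icc 0 R, ∀ t ∈ Icc 0 R, ‖η k t - η k s‖ ≤ L * |t - s| :=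
    ⟨_, fun k s hs t ht => (hηd k).norm_sub_le_mul (D.norm_nonlocal_le ϑ) (by positivity)
      (by positivity) (sum_abs_primitive_sub_le (hck k) (hκ k)) hs ht⟩
  obtain ⟨L', hL'⟩ : ∃ L : ℝ≥0, LipschitzOnWith L ξ (Icc 0 R) := by
    refine ⟨(1 * (2 * D.K) + 1 * (2 * D.K * (1 * (2 * D.K))) * (R - 0)).toNNReal,
      LipschitzOnWith.of_dist_le_mul fun s hs t ht => ?_⟩
    rw [dist_comm, dist_comm s, dist_eq_norm, Real.dist_eq, Real.coe_toNNReal _ (by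
      rw [sub_zero]; positivity)]
    exact hξd.norm_sub_le_mul (D.norm_nonlocal_le ϑ) (by positivity)
      (by positivity) (sum_abs_primitive_sub_le hc hc1) hs ht
  have hmem : ∀ t, 0 ≤ t → rightInverse Φ R t ∈ Icc 0 R := fun t ht =>
    rightInverse_mem hR0 ((hΦ0 0 le_rfl).le.trans ht)
  have hconv : ∀ t ∈ Ioc 0 T,
      Tendsto (fun k => μk k t) atTop (𝓝 (push ϑ (ξ (rightInverse Φ R t)))) := fun t ht => by
    have htm := hmem t ht.1.le
    have hσt := tendsto_inverse_rightInverse hT hR hΦm (hΦ0 0 le_rfl) hΦT hh hlim hAlim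
      hAle' hAR hσ2 hσ hσ0 ht
    have hσm : ∀ k, σ k t ∈ Icc 0 R := fun k =>
      ⟨by rw [← hσ0 k]; exact (hσ k).monotone ht.1.le,
        by rw [← hσ2 k R, hAR]; exact (hσ k).monotone ht.2⟩
    -- The uniform Lipschitz bound allows the moving time `σ k t` to be replaced by its limit before
    -- pointwise convergence of `η k` is used.
    have h1 : Tendsto (fun k => η k (σ k t) - η k (rightInverse Φ R t)) atTop (𝓝 0) := by
      refine squeeze_zero_norm (fun k => hL k _ htm _ (hσm k)) ?_
      simpa using ((hσt.sub_const (rightInverse Φ R t)).abs).const_mul L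
    have h2 := h1.add (hηlim _ htm)
    simp only [sub_add_cancel, zero_add] at h2
    refine (((lipschitzWith_push ϑ).continuous.tendsto _).comp h2).congr fun k => ?_
    exact (hμkη k t ⟨ht.1.le, ht.2⟩).symm
  refine ⟨fun t => push ϑ (ξ (rightInverse Φ R t)), ⟨⟨?_, fun t ht => ?_⟩, μk, hμk,
    fun t ht _ => hconv t ⟨ht.1, ht.2.le⟩, hconv T ⟨hT, le_rfl⟩⟩, ?_⟩
  -- The limit curve is a Lipschitz curve composed with a bounded monotone function; right
  -- continuity is likewise inherited from `rightInverse`.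
  · have hbv : BoundedVariationOn (rightInverse Φ R) (Icc 0 T) :=
      MonotoneOn.boundedVariationOn (C := R)
        (fun s hs t ht hst => rightInverse_mono hR0 ((hΦ0 0 le_rfl).le.trans hs.1) hst)
        fun s hs => by rw [abs_of_nonneg (hmem s hs.1).1]; exact (hmem s hs.1).2
    exact ((lipschitzWith_push ϑ).comp_lipschitzOnWith hL').comp_boundedVariationOn
      (fun s hs => hmem s hs.1) hbv
  · exact ((lipschitzWith_push ϑ).continuous.comp hξ.1).continuousAt.comp_continuousWithinAt
      (continuousWithinAt_rightInverse hΦm hR0 ((hΦ0 0 le_rfl).le.trans ht.1))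
  · have : rightInverse Φ R T = R := le_antisymm (hmem T hT.le).2
      (le_rightInverse ⟨hR0, le_rfl⟩ (hΦT R (by linarith)).le)
    simp only [this]

end Approximation

/-! ### The compact set of endpoints, and the conclusion. -/

section Main

theorem exists_fieldData {n m : ℕ} {f₀ : Rn n → Rn n} {f : Fin m → Rn n → Rn n} {g : Rn n → Rn n}
    (hA : HypA1 f₀ f g) :
    ∃ D : FieldData n m, (D.f₀ : Rn n → Rn n) = f₀ ∧ (fun i => (D.f i : Rn n → Rn n)) = f ∧
      (D.g : Rn n → Rn n) = g := by
  obtain ⟨C, L, hC, hL, hb, hlip⟩ := hA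
  have hb' : ∀ x, ‖f₀ x‖ + ‖g x‖ ≤ C ∧ ∀ i, ‖f i x‖ ≤ C := fun x => by
    have h0 : 0 ≤ ∑ i, ‖f i x‖ := Finset.sum_nonneg fun _ _ => norm_nonneg _
    refine ⟨by linarith [hb x], fun i => ?_⟩
    have := Finset.single_le_sum (f := fun i => ‖f i x‖) (fun _ _ => norm_nonneg _)
      (Finset.mem_univ i)
    linarith [hb x, norm_nonneg (f₀ x), norm_nonneg (g x)]
  have hl' : ∀ x y, ‖f₀ x - f₀ y‖ ≤ L * ‖x - y‖ ∧ ‖g x - g y‖ ≤ L * ‖x - y‖ ∧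
      ∀ i, ‖f i x - f i y‖ ≤ L * ‖x - y‖ := fun x y => by
    have h0 : 0 ≤ ∑ i, ‖f i x - f i y‖ := Finset.sum_nonneg fun _ _ => norm_nonneg _
    have h1 := norm_nonneg (f₀ x - f₀ y)
    have h2 := norm_nonneg (g x - g y)
    refine ⟨by linarith [hlip x y], by linarith [hlip x y], fun i => ?_⟩
    have := Finset.single_le_sum (f := fun i => ‖f i x - f i y‖) (fun _ _ => norm_nonneg _)
      (Finset.mem_univ i)
    linarith [hlip x y]
  have hcont : ∀ φ : Rn n → Rn n, (∀ x y, ‖φ x - φ y‖ ≤ L * ‖x - y‖) → Continuous φ := fun φ hφ =>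
    (LipschitzWith.of_dist_le' fun x y => by
      rw [dist_eq_norm, dist_eq_norm]; exact hφ x y).continuous
  let F₀ : Disp n := BoundedContinuousFunction.ofNormedAddCommGroup f₀
    (hcont f₀ fun x y => (hl' x y).1) C fun x => by linarith [(hb' x).1, norm_nonneg (g x)]
  let G : Disp n := BoundedContinuousFunction.ofNormedAddCommGroup g
    (hcont g fun x y => (hl' x y).2.1) C fun x => by linarith [(hb' x).1, norm_nonneg (f₀ x)]
  let F : Fin m → Disp n := fun i => BoundedContinuousFunction.ofNormedAddCommGroup (f i)
    (hcont (f i) fun x y => (hl' x y).2.2 i) C fun x => (hb' x).2 i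
  have hF₀ : ‖F₀‖ ≤ C := BoundedContinuousFunction.norm_ofNormedAddCommGroup_le _ hC.le _
  have hG : ‖G‖ ≤ C := BoundedContinuousFunction.norm_ofNormedAddCommGroup_le _ hC.le _
  have hF : ∀ i, ‖F i‖ ≤ C := fun i =>
    BoundedContinuousFunction.norm_ofNormedAddCommGroup_le _ hC.le _
  have hmul : ∀ {a : ℝ} (x y : Rn n) {b : ℝ}, b ≤ L * ‖x - y‖ → L ≤ a → b ≤ a * ‖x - y‖ :=
    fun x y _ h hLa => h.trans (mul_le_mul_of_nonneg_right hLa (norm_nonneg _))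
  exact ⟨{
    f₀ := F₀
    g := G
    f := F
    -- The factors two pay for the sum of the two sup norms in `norm_drift` and for the constants `K
    -- / 2` in `lip_f₀` and `lip_g`.
    K := 2 * C + 2 * L
    K_nonneg := by positivity
    norm_drift := by linarith
    norm_f := fun i => by linarith [hF i]
    lip_f₀ := fun x y => hmul x y (hl' x y).1 (by linarith)
    lip_g := fun x y => hmul x y (hl' x y).2.1 (by linarith)
    lip_f := fun i x y => hmul x y ((hl' x y).2.2 i) (by linarith) }, rfl, rfl, rfl⟩

/-- There is a compact family of measures which are exactly the endpoints of the trajectories of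
the reduced system, all endpoints of generalized solutions, and which contains the endpoints of
the trajectories of the original system. -/
theorem FieldData.exists_endpoints {n m : ℕ} (hm : 1 ≤ m) {T M : ℝ} (hT : 0 < T) (hM : 0 < M)
    (D : FieldData n m) (ϑ : P1 n) :
    ∃ 𝓔 : Set (P1 n), IsCompact 𝓔 ∧ 𝓔.Nonempty ∧
      (∀ ν ∈ reducedTrajectories T M D.f₀ (fun i => D.f i) D.g ϑ, ν (T + M) ∈ 𝓔) ∧
      (∀ p ∈ 𝓔, ∃ ν ∈ reducedTrajectories T M D.f₀ (fun i => D.f i) D.g ϑ, ν (T + M) = p) ∧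
      (∀ μ ∈ trajectories T M D.f₀ (fun i => D.f i) D.g ϑ, μ T ∈ 𝓔) ∧
      ∀ p ∈ 𝓔, ∃ μ ∈ generalizedSolutions T M D.f₀ (fun i => D.f i) D.g ϑ, μ T = p := by
  have hK := D.K_nonneg
  have hS : 0 ≤ T + M := by positivity
  obtain ⟨Ξ, hΞ, hΞd, hΞc⟩ := D.exists_continuous_endpoint ϑ (T := T) hS
  have hcomp : CompactSpace (reducedPaths m T (T + M)) :=
    isCompact_iff_compactSpace.1 (isCompact_reducedPaths T (T + M))
  obtain ⟨P₀, hP₀⟩ := nonempty_reducedPaths (m := m) hT hM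
  refine ⟨range fun P => push ϑ (Ξ P (T + M)),
    isCompact_range ((lipschitzWith_push ϑ).continuous.comp hΞc), ⟨_, ⟨P₀, hP₀⟩, rfl⟩,
    fun ν hν => ?_, ?_, fun μ hμ => ?_, ?_⟩
  · obtain ⟨c, hc, hc0, hc1, hcT, ξ, hξ, hνξ⟩ :=
      D.exists_isFlow_of_mem_reducedTrajectories ϑ hT hM hν
    let P : reducedPaths m T (T + M) := ⟨primitive c, primitive_mem_reducedPaths hc hc0 hc1 hcT⟩
    have key : Ξ P (T + M) = ξ (T + M) := (hξ.driven hc hc1).unique (hΞd P) (D.norm_nonlocal_le ϑ)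
      (D.norm_nonlocal_sub_le ϑ) (by positivity) zero_le_one (by positivity) (by positivity)
      (sum_abs_primitive_sub_le hc hc1) (by rw [(hΞ P).zero hS, hξ.zero hS]) ⟨hS, le_rfl⟩
    exact ⟨P, by rw [hνξ _ ⟨hS, le_rfl⟩, ← key]⟩
  · rintro _ ⟨P, rfl⟩
    exact ⟨_, D.mem_reducedTrajectories_of_path ϑ hT hM P.2 (hΞ P), rfl⟩
  · obtain ⟨u, κ, hu, hκ, hint, ξ, hξ, hμξ⟩ := D.exists_isFlow_of_mem_trajectories ϑ hT hμ
    obtain ⟨P, hP, hPξ⟩ := D.exists_reduced_of_isFlow ϑ hT hM hu hκ hint hξ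
    have key := hPξ (Ξ ⟨P, hP⟩) _ (by positivity) ((hΞ _).zero hS) (hΞd ⟨P, hP⟩)
    exact ⟨⟨P, hP⟩, by rw [hμξ _ ⟨hT.le, le_rfl⟩, ← key]⟩
  · rintro _ ⟨P, rfl⟩
    obtain ⟨R, c, ξ, hR, hc, hc0, hc1, hcl, hcr, hcT, hcM, hξ, hξR⟩ :=
      D.exists_extension ϑ hm hT hM (measurable_pathControl P.1)
        (fun t => Monotone.deriv_nonneg fun s t hst => P.2.2.1 s t hst)
        (sum_abs_pathControl_le P.2.2.2.1)
        (by
          have := primitive_pathControl P.2.2.2.1 (T + M) none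
          rwa [P.2.1, sub_zero, P.2.2.2.2] at this) (hΞ P)
    simp only
    rw [← hξR]
    exact D.exists_mem_generalizedSolutions ϑ hT hR hc hc0 hc1 hcl hcr hcT hcM hξ

end Main

end ImpulsiveTransport

end

open MeasureTheory Filter

theorem mainTheorem3 {n m : ℕ} (hm : 1 ≤ m) (T M : ℝ) (hT : 0 < T) (hM : 0 < M)
    (f₀ : Rn n → Rn n) (f : Fin m → Rn n → Rn n) (g : Rn n → Rn n) (hA : HypA1 f₀ f g)
    (ϑ : P1 n) (ℓ : Rn n → ℝ) (hℓ : Continuous ℓ)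
    (hsub : ∃ C : ℝ, 0 < C ∧ ∀ x, |ℓ x| ≤ C * (1 + ‖x‖)) :
    ∃ μbar ∈ generalizedSolutions T M f₀ f g ϑ,
      ∃ νhat ∈ reducedTrajectories T M f₀ f g ϑ,
        (∀ μ ∈ generalizedSolutions T M f₀ f g ϑ, cost ℓ T μbar ≤ cost ℓ T μ) ∧
        (∀ ν ∈ reducedTrajectories T M f₀ f g ϑ, cost ℓ (T + M) νhat ≤ cost ℓ (T + M) ν) ∧
        cost ℓ T μbar = cost ℓ (T + M) νhat ∧
        IsGLB (cost ℓ T '' trajectories T M f₀ f g ϑ) (cost ℓ (T + M) νhat) := by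
  obtain ⟨D, rfl, rfl, rfl⟩ := exists_fieldData hA
  obtain ⟨C, hC, hCℓ⟩ := hsub
  have hJ : Continuous fun μ : P1 n => ∫ x, ℓ x ∂μ.toMeasure :=
    continuous_integral_of_sublinear hℓ hC.le hCℓ
  obtain ⟨𝓔, hcomp, hne, hred, hred', htraj, hgen⟩ := D.exists_endpoints hm hT hM ϑ
  obtain ⟨p, hp, hpmin⟩ := hcomp.exists_isMinOn hne hJ.continuousOn
  obtain ⟨μbar, hμbar, hμp⟩ := hgen p hp
  obtain ⟨νhat, hνhat, hνp⟩ := hred' p hp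
  have hcμ : cost ℓ T μbar = ∫ x, ℓ x ∂p.toMeasure := by rw [cost, hμp]
  have hcν : cost ℓ (T + M) νhat = ∫ x, ℓ x ∂p.toMeasure := by rw [cost, hνp]
  refine ⟨μbar, hμbar, νhat, hνhat, ?_, fun ν hν => ?_, by rw [hcμ, hcν], ?_, ?_⟩
  -- The endpoint of a generalized solution is only used as a limit of original endpoints, each of
  -- cost at least the minimum over `𝓔`.
  · rintro μ ⟨-, μk, hμk, -, hlim⟩
    rw [hcμ]
    exact ge_of_tendsto ((hJ.tendsto (μ T)).comp hlim)
      (Eventually.of_forall fun k => hpmin (htraj _ (hμk k)))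
  · rw [hcν]
    exact hpmin (hred ν hν)
  · rintro _ ⟨μ, hμ, rfl⟩
    rw [hcν]
    exact hpmin (htraj μ hμ)
  -- A lower bound for the original costs passes to the limit along the trajectories approximating
  -- the optimal `μbar`.
  · intro b hb
    obtain ⟨-, μk, hμk, -, hlim⟩ := hμbar
    rw [hcν, ← hcμ]
    exact ge_of_tendsto ((hJ.tendsto (μbar T)).comp hlim)
      (Eventually.of_forall fun k => hb ⟨_, hμk k, rfl⟩)
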